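/- Let $K$ be a field with a discrete valuation $v\colon K^*\to\mathbb Z$, $v(K^*)=\mathbb Z$. Let $K_v$ be its completion, $\mathcal O_v$ the valuation ring of $K_v$, and denote again by $v\colon\overline K_v\to\mathbb Q\cup\{\infty\}$ the unique extension of $v$ to an algebraic closure of $K_v$. *Valuations.* For $k\in\{K,K_v\}$ consider the discrete valuations $\mu\colon k(x)^*\to\mathbb Q$ that extend $v$ and satisfy $\mu(x)\ge0$. For $\alpha\in\mathbb Q$ let $\mathcal P_\alpha=\{g\in k[x]:\mu(g)\ge\alpha\}$, $\mathcal P_\alpha^+=\{g\in k[x]:\mu(g)>\alpha\}$, let $\mathcal Gr(\mu)=\bigoplus_\alpha\mathcal P_\alpha/\mathcal P_\alpha^+$ be the graded algebra, $\Delta(\mu)=\mathcal P_0/\mathcal P_0^+$ its degree-zero subring, and let $H_\mu(g)=g+\mathcal P^+_{\mu(g)}$ for $g\neq 0$, $H_\mu(0)=0$. Write $g\sim_\mu h$ if $H_\mu(g)=H_\mu(h)$; $h\mid_\mu g$ if $H_\mu(h)$ divides $H_\mu(g)$ in $\mathcal Gr(\mu)$; and $\mathcal R(g)=\Delta(\mu)\cap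 H_\mu(g)\mathcal Gr(\mu)$. A polynomial $\phi\in k[x]$ is *$\mu$-minimal* if $\deg\phi>0$ and $\phi\nmid_\mu g$ for all non-zero $g\in k[x]$ with $\deg g<\deg\phi$. A *key polynomial* for $\mu$ is a monic $\mu$-minimal $\phi\in k[x]$ such that $H_\mu(\phi)\mathcal Gr(\mu)$ is a non-zero prime ideal. For a monic $\phi$ of positive degree, every $g\in k[x]$ has a unique $\phi$-expansion $g=\sum_{s\ge0}a_s\phi^s$ with $\deg a_s<\deg\phi$. If $\phi$ is a key polynomial for $\mu$ and $\lambda\in\mathbb Q_{>0}$, the augmented valuation $[\mu;(\phi,\lambda)]$ is given by $g\mapsto\min_s\{\mu(a_s\phi^s)+s\lambda\}$ on $k[x]$. A valuation is *inductive* if it is obtained by finitely many (possibly zero) augmentations from $\mu_0\colon\sum_s c_sx^s\mapsto\min_s v(c_s)$. *Newton polygons.* $N_{\mu,\phi}(g)$ is the lower convex hull in $\mathbb R^2$ of the points $(s,\mu(a_s\phi^s))$ with $a_s\ne0$, where $g=\sum_s a_s\phi^s$ is the $\phi$-expansion. Its length $\ell(N_{\mu,\phi}(g))$ is the abscissa of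 its right end point. It is *one-sided of slope $-\lambda$* if it coincides with the set of its points at which $y+\lambda x$ is minimal, its left end point has abscissa $0$, and its right end point has positive abscissa. **Theorem.** Let $F\in\mathcal O_v[x]$ be a prime polynomial (i.e. monic and irreducible in $\mathcal O_v[x]$), $\theta\in\overline K_v$ a root of $F$, $\mu$ an inductive valuation on $K(x)$, and $\phi\in K[x]$ a key polynomial for $\mu$. Then there is a unique inductive valuation on $K_v(x)$ whose restriction to $K(x)$ is $\mu$. Denoting it again by $\mu$ and using it in everything that follows (so that $\mid_\mu$, $\sim_\mu$, $\mu$-minimality, $\mathcal R$ and $N_{\mu,\phi}$ refer to polynomials in $K_v[x]$), we have $$\phi\mid_\mu F\iff v(\phi(\theta))>\mu(\phi).$$ Moreover, if this condition holds, then: 1. Either $F=\phi$, or $\lambda:=v(\phi(\theta))-\mu(\phi)$ is a positive rational number and $N_{\mu,\phi}(F)$ is one-sided of slope $-\lambda$. 2. Let $\ell=\ell(N_{\mu,\phi}(F))$. Then $\ell$ is a non-negative integer, $\deg F=\ell\deg\phi$, and $F$ is $\mu$-minimal. 3. $F\sim_\mu\phi^\ell$; moreover $\mathcal R(\phi)$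 is a maximal ideal of $\Delta(\mu)$ and $\mathcal R(F)=\mathcal R(\phi)^n$ for some integer $n\ge1$. -/

import Mathlib

open Polynomial
open scoped DirectSum WithZero

noncomputable section

namespace MacLane

/-- The additive, `ℚ ∪ {∞}`-valued form of an element of `ℤᵐ⁰`: `0` is sent to `∞` and
`exp n` is sent to `-n`. -/
def addVal (a : ℤᵐ⁰) : WithTop ℚ :=
  if a = 0 then ⊤ else (((-WithZero.log a : ℤ) : ℚ) : WithTop ℚ)

section Expansion

variable {k : Type*} [Field k]

/-- The `s`-th coefficient `a_s` (`deg a_s < deg φ`) of the canonical `φ`-expansion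
`g = ∑ a_s φ ^ s`, for a monic `φ` of positive degree. -/
def expCoeff (φ g : k[X]) (s : ℕ) : k[X] :=
  ((fun h : k[X] => h /ₘ φ)^[s] g) %ₘ φ

/-- The canonical expansion: `g = ∑ a_s φ ^ s`. -/
theorem sum_expCoeff_add (φ g : k[X]) (n : ℕ) :
    ∑ s ∈ Finset.range n, expCoeff φ g s * φ ^ s
      + ((fun h : k[X] => h /ₘ φ)^[n] g) * φ ^ n = g := by
  induction n with
  | zero => simp
  | succ n ih =>
    rw [Finset.sum_range_succ, Function.iterate_succ_apply', pow_succ]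
    conv_rhs => rw [← ih]
    have h := Polynomial.modByMonic_add_div ((fun h : k[X] => h /ₘ φ)^[n] g) φ
    unfold expCoeff
    conv_rhs => rw [← h]
    ring

/-- The minimal (Gauss) valuation on polynomials: the minimum of the values of the coefficients. -/
def gauss (w : Valuation k ℤᵐ⁰) (g : k[X]) : WithTop ℚ :=
  g.support.inf fun s => addVal (w (g.coeff s))

end Expansion

/-- The set `𝕍` of (discrete, `ℚ`-valued) valuations `μ` on `k(x)` which extend the valuation
`w` of `k` and satisfy `μ(x) ≥ 0`. -/
@[ext]
structure RatVal {k : Type*} [Field k] (w : Valuation k ℤᵐ⁰) where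
  /-- the valuation on `k(x)` -/
  val : AddValuation (RatFunc k) (WithTop ℚ)
  extends_base : ∀ a : k, val (RatFunc.C a) = addVal (w a)
  nonneg_X : 0 ≤ val RatFunc.X
  discrete : ∃ e : ℕ, 0 < e ∧ ∀ f : RatFunc k, f ≠ 0 →
    ∃ n : ℤ, val f = (((n : ℚ) / (e : ℚ) : ℚ) : WithTop ℚ)

namespace RatVal

variable {k : Type*} [Field k] {w : Valuation k ℤᵐ⁰} (μ : RatVal w)

/-- The value `μ(g) ∈ ℚ ∪ {∞}` of a polynomial. -/
def pval (g : k[X]) : WithTop ℚ := μ.val (algebraMap k[X] (RatFunc k) g)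

theorem pval_zero : μ.pval 0 = ⊤ := by simp [pval]

theorem pval_one : μ.pval 1 = 0 := by simp [pval]

theorem pval_mul (g h : k[X]) : μ.pval (g * h) = μ.pval g + μ.pval h := by simp [pval]

theorem pval_add (g h : k[X]) : min (μ.pval g) (μ.pval h) ≤ μ.pval (g + h) := by
  rw [pval, pval, pval, map_add]
  exact μ.val.map_add _ _

theorem pval_neg (g : k[X]) : μ.pval (-g) = μ.pval g := by
  simp [pval, AddValuation.map_neg]

/-- The value of a non-zero polynomial as a rational number (with the convention `0` for `g = 0`,
which is never relied upon). -/
def qval (g : k[X]) : ℚ := (μ.pval g).untopD 0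

theorem qval_le_pval (g : k[X]) : ((μ.qval g : ℚ) : WithTop ℚ) ≤ μ.pval g := by
  unfold qval
  cases h : μ.pval g with
  | top => simp
  | coe a => simp

/-! ### The graded algebra -/

/-- `𝒫_α = {g ∈ k[x] | μ(g) ≥ α}`. -/
def P (α : ℚ) : AddSubgroup k[X] where
  carrier := {g | (α : WithTop ℚ) ≤ μ.pval g}
  add_mem' {a b} ha hb := le_trans (le_min ha hb) (μ.pval_add a b)
  zero_mem' := by simp [pval_zero]
  neg_mem' {a} ha := by simpa [pval_neg] using ha

theorem self_mem_P (g : k[X]) : g ∈ μ.P (μ.qval g) := μ.qval_le_pval g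

/-- `𝒫_α⁺ = {g ∈ k[x] | μ(g) > α}`. -/
def PPlus (α : ℚ) : AddSubgroup k[X] where
  carrier := {g | (α : WithTop ℚ) < μ.pval g}
  add_mem' {a b} ha hb := lt_of_lt_of_le (lt_min ha hb) (μ.pval_add a b)
  zero_mem' := by simp [pval_zero, WithTop.coe_lt_top]
  neg_mem' {a} ha := by simpa [pval_neg] using ha

/-- The graded piece `𝒫_α / 𝒫_α⁺`. -/
abbrev Piece (α : ℚ) : Type _ := μ.P α ⧸ (μ.PPlus α).addSubgroupOf (μ.P α)

/-- The class `g + 𝒫_α⁺` of an element `g` of `𝒫_α`. -/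
def cls {α : ℚ} (g : μ.P α) : μ.Piece α := QuotientAddGroup.mk g

theorem cls_eq_cls {α : ℚ} (g h : μ.P α) :
    μ.cls g = μ.cls h ↔ (α : WithTop ℚ) < μ.pval (g.1 - h.1) := by
  unfold cls
  rw [QuotientAddGroup.eq, AddSubgroup.mem_addSubgroupOf, ← μ.pval_neg (g.1 - h.1)]
  have : -(g.1 - h.1) = ((-g + h : μ.P α) : k[X]) := by
    simp; ring
  rw [this]
  rfl

theorem cls_surjective {α : ℚ} (a : μ.Piece α) : ∃ g, μ.cls g = a :=
  QuotientAddGroup.mk_surjective a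

theorem cls_zero {α : ℚ} : μ.cls (0 : μ.P α) = 0 := rfl

theorem cls_add {α : ℚ} (g h : μ.P α) : μ.cls (g + h) = μ.cls g + μ.cls h := rfl

theorem cls_neg {α : ℚ} (g : μ.P α) : μ.cls (-g) = -μ.cls g := rfl

theorem mk_cls_ext {α β : ℚ} (hαβ : α = β) (g : μ.P α) (h : μ.P β) (hgh : g.1 = h.1) :
    (GradedMonoid.mk α (μ.cls g) : GradedMonoid μ.Piece) = GradedMonoid.mk β (μ.cls h) := by
  subst hαβ
  obtain rfl : g = h := Subtype.ext hgh
  rfl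

/-- The product `𝒫_α × 𝒫_β → 𝒫_{α+β}`. -/
def pmul {α β : ℚ} (g : μ.P α) (h : μ.P β) : μ.P (α + β) :=
  ⟨g.1 * h.1, by
    have h1 : (α : WithTop ℚ) ≤ μ.pval g.1 := g.2
    have h2 : (β : WithTop ℚ) ≤ μ.pval h.1 := h.2
    change ((α + β : ℚ) : WithTop ℚ) ≤ μ.pval (g.1 * h.1)
    rw [pval_mul, WithTop.coe_add]
    exact add_le_add h1 h2⟩

/-- The unit `1 ∈ 𝒫_0`. -/
def pone : μ.P 0 := ⟨1, by change ((0 : ℚ) : WithTop ℚ) ≤ μ.pval 1; simp [pval_one]⟩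

/-- Multiplication of classes: `(g + 𝒫_α⁺)(h + 𝒫_β⁺) = gh + 𝒫_{α+β}⁺`. -/
def gmul {α β : ℚ} (a : μ.Piece α) (b : μ.Piece β) : μ.Piece (α + β) :=
  Quotient.liftOn₂' a b (fun g h => μ.cls (μ.pmul g h)) (by
    intro g₁ h₁ g₂ h₂ hg hh
    have hg' := (μ.cls_eq_cls g₁ g₂).1 (Quotient.sound' hg)
    have hh' := (μ.cls_eq_cls h₁ h₂).1 (Quotient.sound' hh)
    rw [cls_eq_cls]
    have e : (μ.pmul g₁ h₁).1 - (μ.pmul g₂ h₂).1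
        = (g₁.1 - g₂.1) * h₁.1 + g₂.1 * (h₁.1 - h₂.1) := by
      simp only [pmul]; ring
    rw [e]
    refine lt_of_lt_of_le (lt_min ?_ ?_) (μ.pval_add _ _)
    · rw [pval_mul, WithTop.coe_add]
      exact WithTop.add_lt_add_of_lt_of_le WithTop.coe_ne_top hg' h₁.2
    · rw [pval_mul, WithTop.coe_add]
      exact WithTop.add_lt_add_of_le_of_lt WithTop.coe_ne_top g₂.2 hh')

theorem gmul_cls {α β : ℚ} (g : μ.P α) (h : μ.P β) :
    μ.gmul (μ.cls g) (μ.cls h) = μ.cls (μ.pmul g h) := rfl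

/-- `n ∈ 𝒫_0` for every natural number `n`. -/
def pnat : ℕ → μ.P 0
  | 0 => 0
  | n + 1 => pnat n + μ.pone

instance : GradedMonoid.GOne μ.Piece := ⟨μ.cls μ.pone⟩

instance : GradedMonoid.GMul μ.Piece := ⟨μ.gmul⟩

instance : DirectSum.GCommRing μ.Piece where
  mul_zero {i j} a := by
    obtain ⟨g, rfl⟩ := μ.cls_surjective a
    exact congrArg μ.cls (Subtype.ext (mul_zero g.1) : μ.pmul g (0 : μ.P j) = 0)
  zero_mul {i j} a := by
    obtain ⟨g, rfl⟩ := μ.cls_surjective a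
    exact congrArg μ.cls (Subtype.ext (zero_mul g.1) : μ.pmul (0 : μ.P i) g = 0)
  mul_add {i j} a b c := by
    obtain ⟨a, rfl⟩ := μ.cls_surjective a
    obtain ⟨b, rfl⟩ := μ.cls_surjective b
    obtain ⟨c, rfl⟩ := μ.cls_surjective c
    exact congrArg μ.cls
      (Subtype.ext (mul_add a.1 b.1 c.1) : μ.pmul a (b + c) = μ.pmul a b + μ.pmul a c)
  add_mul {i j} a b c := by
    obtain ⟨a, rfl⟩ := μ.cls_surjective a
    obtain ⟨b, rfl⟩ := μ.cls_surjective b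
    obtain ⟨c, rfl⟩ := μ.cls_surjective c
    exact congrArg μ.cls
      (Subtype.ext (add_mul a.1 b.1 c.1) : μ.pmul (a + b) c = μ.pmul a c + μ.pmul b c)
  one_mul := by
    rintro ⟨i, a⟩
    obtain ⟨a, rfl⟩ := μ.cls_surjective a
    exact μ.mk_cls_ext (zero_add _) (μ.pmul μ.pone a) a (one_mul _)
  mul_one := by
    rintro ⟨i, a⟩
    obtain ⟨a, rfl⟩ := μ.cls_surjective a
    exact μ.mk_cls_ext (add_zero _) (μ.pmul a μ.pone) a (mul_one _)
  mul_assoc := by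
    rintro ⟨i, a⟩ ⟨j, b⟩ ⟨l, c⟩
    obtain ⟨a, rfl⟩ := μ.cls_surjective a
    obtain ⟨b, rfl⟩ := μ.cls_surjective b
    obtain ⟨c, rfl⟩ := μ.cls_surjective c
    exact μ.mk_cls_ext (add_assoc _ _ _) (μ.pmul (μ.pmul a b) c) (μ.pmul a (μ.pmul b c))
      (mul_assoc _ _ _)
  mul_comm := by
    rintro ⟨i, a⟩ ⟨j, b⟩
    obtain ⟨a, rfl⟩ := μ.cls_surjective a
    obtain ⟨b, rfl⟩ := μ.cls_surjective b
    exact μ.mk_cls_ext (add_comm _ _) (μ.pmul a b) (μ.pmul b a) (mul_comm _ _)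
  natCast n := μ.cls (μ.pnat n)
  natCast_zero := rfl
  natCast_succ _ := rfl
  intCast n := match n with
    | Int.ofNat n => μ.cls (μ.pnat n)
    | Int.negSucc n => -μ.cls (μ.pnat (n + 1))
  intCast_ofNat _ := rfl
  intCast_negSucc_ofNat _ := rfl

/-- The graded algebra `𝒢r(μ) = ⨁_α 𝒫_α / 𝒫_α⁺`. All pieces with `α` outside the value group
`Γ(μ)` vanish, so that the sum may be taken over all rational numbers `α`. -/
abbrev Gr : Type _ := ⨁ α : ℚ, μ.Piece α

/-- The degree-zero subring `Δ(μ) = 𝒫_0 / 𝒫_0⁺` of `𝒢r(μ)`. -/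
abbrev Delta : Type _ := μ.Piece 0

/-- `H_μ(g) = g + 𝒫_{μ(g)}⁺`, placed in degree `μ(g)`; in particular `H_μ(0) = 0`. -/
def H (g : k[X]) : μ.Gr :=
  DirectSum.of μ.Piece (μ.qval g) (μ.cls ⟨g, μ.self_mem_P g⟩)

/-- `g ∼_μ h`: `μ`-equivalence. -/
def Equivalent (g h : k[X]) : Prop := μ.H g = μ.H h

/-- `h ∣_μ g`: `μ`-divisibility. -/
def Divides (h g : k[X]) : Prop := μ.H h ∣ μ.H g

/-- `φ` is `μ`-irreducible. -/
def IsIrreducible (φ : k[X]) : Prop :=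
  Ideal.span {μ.H φ} ≠ ⊥ ∧ (Ideal.span {μ.H φ}).IsPrime

/-- `φ` is `μ`-minimal. -/
def IsMinimal (φ : k[X]) : Prop :=
  0 < φ.natDegree ∧ ∀ g : k[X], g ≠ 0 → g.natDegree < φ.natDegree → ¬ μ.Divides φ g

/-- `φ` is a key polynomial for `μ`. -/
def IsKey (φ : k[X]) : Prop :=
  φ.Monic ∧ μ.IsMinimal φ ∧ μ.IsIrreducible φ

/-- The residual ideal `ℛ_μ(g) = Δ(μ) ∩ H_μ(g) 𝒢r(μ)`. -/
def residualIdeal (g : k[X]) : Ideal μ.Delta :=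
  (Ideal.span {μ.H g}).comap (DirectSum.ofZeroRingHom μ.Piece)

/-! ### Augmentation and inductive valuations -/

/-- `μ' = [μ; (φ, l)]`: on polynomials, `μ'(g) = min_s (μ(a_s φ^s) + s l)`, where `∑ a_s φ^s` is
the canonical `φ`-expansion of `g` (whose coefficients `a_s` vanish for `s > deg g`). -/
def IsAugmentation (φ : k[X]) (l : ℚ) (μ' : RatVal w) : Prop :=
  ∀ g : k[X], μ'.pval g = (Finset.range (g.natDegree + 1)).inf fun s =>
    μ.pval (expCoeff φ g s * φ ^ s) + (((s : ℚ) * l : ℚ) : WithTop ℚ)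

/-- Inductive valuations: those obtained from the minimal valuation `μ₀` after finitely many
augmentation steps. -/
inductive IsInductive : RatVal w → Prop
  | minimal (μ : RatVal w) (h : ∀ g : k[X], μ.pval g = gauss w g) : IsInductive μ
  | augment (μ μ' : RatVal w) (φ : k[X]) (l : ℚ) (hμ : IsInductive μ) (hφ : μ.IsKey φ)
      (hl : 0 < l) (h : μ.IsAugmentation φ l μ') : IsInductive μ'

/-! ### Newton polygons -/

/-- The cloud of points `(s, μ(a_s φ^s))`, `a_s ≠ 0`, attached to the `φ`-expansion of `g`. -/
def cloud (φ g : k[X]) : Set (ℝ × ℝ) :=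
  {p | ∃ s : ℕ, expCoeff φ g s ≠ 0 ∧ p = ((s : ℝ), ((μ.qval (expCoeff φ g s * φ ^ s) : ℚ) : ℝ))}

/-- The Newton polygon `N_{μ,φ}(g)`: the lower convex hull of the cloud of points. -/
def newton (φ g : k[X]) : Set (ℝ × ℝ) :=
  {p | p ∈ convexHull ℝ (μ.cloud φ g) ∧
    ∀ y : ℝ, (p.1, y) ∈ convexHull ℝ (μ.cloud φ g) → p.2 ≤ y}

end RatVal

/-- The `l`-component of a polygon `N`: the points of `N` where `y + l x` is minimal. -/
def component (N : Set (ℝ × ℝ)) (l : ℝ) : Set (ℝ × ℝ) :=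
  {p | p ∈ N ∧ ∀ q ∈ N, p.2 + l * p.1 ≤ q.2 + l * q.1}

/-- `N` is one-sided of slope `-l`: it equals its `l`-component, whose end points have abscissas
`0` and some `t > 0`. -/
def IsOneSided (N : Set (ℝ × ℝ)) (l : ℝ) : Prop :=
  N = component N l ∧ IsLeast (Prod.fst '' component N l) 0 ∧
    ∃ t : ℝ, IsGreatest (Prod.fst '' component N l) t ∧ 0 < t

/-- `t` is the length of the polygon `N`, i.e. the abscissa of its right end point. -/
def IsLength (N : Set (ℝ × ℝ)) (t : ℝ) : Prop := IsGreatest (Prod.fst '' N) t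

/-- The canonical extension of the valuation `w` of a complete field `k` to an algebraic
extension `Ω` of `k`, with values in `ℚ ∪ {∞}`: the value of `y` is
`w(N(y)) / [k(y) : k]`, where `± N(y)` is the constant term of the minimal polynomial of `y`. -/
def algVal {k : Type*} [Field k] (w : Valuation k ℤᵐ⁰) {Ω : Type*} [Field Ω] [Algebra k Ω]
    (y : Ω) : WithTop ℚ :=
  (addVal (w ((minpoly k y).coeff 0))).map fun q => q / ((minpoly k y).natDegree : ℚ)

section Completion

variable {K : Type*} [Field K] (v : Valuation K ℤᵐ⁰)

/-- The valuation of the completion `K_v`. -/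
abbrev complVal : Valuation v.Completion ℤᵐ⁰ := Valued.v

/-- The canonical inclusion `K ⊂ K_v`. -/
def toCompl : K →+* v.Completion :=
  (UniformSpace.Completion.coeRingHom (α := WithVal v)).comp
    (WithVal.equiv v).symm.toRingHom

variable {v}

/-- `μ'` is the natural extension to `K_v(x)` of the valuation `μ` of `K(x)`: it is inductive and
it restricts to `μ`. -/
def IsNaturalExtension (μ : RatVal v) (μ' : RatVal (complVal v)) : Prop :=
  μ'.IsInductive ∧ ∀ g : K[X], μ'.pval (g.map (toCompl v)) = μ.pval g

end Completion

end MacLane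

end

noncomputable section

namespace MacLane

/-! ### The additive form of the base valuation -/

/-! Values at a root are compared with `μ` through minimal polynomials. Let φ ∣_μ F, and let p, of
degree d, be the minimal polynomial of g(θ) ≠ 0. Over a complete field all conjugates of g(θ) have
the same value q, so v(p_j) ≥ (d - j)q, with equality at j = 0. As F divides p(g), also φ ∣_μ p(g).
If q < μ(g), or if q = μ(g) and φ ∣_μ g, the constant p_0 dominates p(g) modulo φ, and φ would
μ-divide a constant. If q > μ(g), the term g^d dominates, so φ ∣_μ g. Hence μ(g) ≤ v(g(θ)), strictly
if and only if φ ∣_μ g (`IsKey.pval_le_algVal_and`); the case g = φ is one half of the criterion.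

The other half has two inputs: the reciprocity deg F · v(φ(θ)) = deg φ · v(F(ξ)), for a root ξ of φ,
which comes from the resultant (`natDegree_nsmul_algVal_comm`); and the inequality μ(g)/deg g ≤
μ(φ)/deg φ for monic g (`natDegree_mul_qval_le`, multiplied out). If φ does not μ-divide F, then
v(F(ξ)) = μ(F), by the comparison applied to the prime polynomial φ itself, and the two inputs give
v(φ(θ)) ≤ μ(φ).

Suppose now F ≠ φ and δ = v(φ(θ)) > μ(φ). The function g ↦ min_s (μ(a_s) + sδ) is multiplicative
(`augVal_mul`). For p(φ), with p the minimal polynomial of φ(θ), the minimum is attained at s = 0;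
hence the same is true of its factor F (`IsKey.pval_mod_eq_augVal`). Reciprocity computes μ(a_0),
and comparison with the leading coefficient of the φ-expansion forces that coefficient to be 1
(`IsKey.expansion_of_divides`). The polygon is therefore a segment, and F ∼_μ φ^ℓ.

For residual ideals, let e > 0 be least such that eμ(φ) is the value of a polynomial of degree less
than deg φ. Then ℛ(φ^n) is constant for n between consecutive multiples of e, and ℛ(φ^ℓ) =
ℛ(φ)^⌈ℓ/e⌉ (`IsKey.exists_residualIdeal_pow`).

The passage from K to K_v is by continuity: an inductive μ exceeds the Gauss value by at most a
multiple of the degree, so values of approximants stabilize. The graded algebra does not change, and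
key polynomials and augmentations carry over (`exists_isNaturalExtension`). -/

theorem addVal_zero : addVal 0 = ⊤ := by simp [addVal]

theorem addVal_one : addVal 1 = 0 := by simp [addVal]

theorem addVal_of_ne_zero {a : ℤᵐ⁰} (ha : a ≠ 0) :
    addVal a = (((-WithZero.log a : ℤ) : ℚ) : WithTop ℚ) := by simp [addVal, ha]

theorem addVal_eq_top_iff {a : ℤᵐ⁰} : addVal a = ⊤ ↔ a = 0 := by
  by_cases ha : a = 0
  · simp [ha, addVal_zero]
  · simp [ha, addVal_of_ne_zero ha]

theorem addVal_mul (a b : ℤᵐ⁰) : addVal (a * b) = addVal a + addVal b := by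
  by_cases ha : a = 0
  · simp [ha, addVal_zero]
  by_cases hb : b = 0
  · simp [hb, addVal_zero]
  rw [addVal_of_ne_zero ha, addVal_of_ne_zero hb, addVal_of_ne_zero (mul_ne_zero ha hb),
    WithZero.log_mul ha hb, neg_add, Int.cast_add, WithTop.coe_add]

theorem addVal_le_addVal_iff {a b : ℤᵐ⁰} : addVal a ≤ addVal b ↔ b ≤ a := by
  by_cases hb : b = 0
  · simp [hb, addVal_zero]
  by_cases ha : a = 0
  · simp [ha, addVal_zero, addVal_eq_top_iff]
  rw [addVal_of_ne_zero ha, addVal_of_ne_zero hb, WithTop.coe_le_coe, Int.cast_le, neg_le_neg_iff,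
    WithZero.log_le_log hb ha]

theorem addVal_lt_addVal_iff {a b : ℤᵐ⁰} : addVal a < addVal b ↔ b < a := by
  rw [lt_iff_lt_of_le_iff_le addVal_le_addVal_iff]

theorem min_addVal_le {k : Type*} [Field k] (w : Valuation k ℤᵐ⁰) (a b : k) :
    min (addVal (w a)) (addVal (w b)) ≤ addVal (w (a + b)) := by
  rcases le_total (w a) (w b) with h | h
  · rw [min_eq_right (addVal_le_addVal_iff.2 h), addVal_le_addVal_iff]
    exact (w.map_add a b).trans (max_le h le_rfl)
  · rw [min_eq_left (addVal_le_addVal_iff.2 h), addVal_le_addVal_iff]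
    exact (w.map_add a b).trans (max_le le_rfl h)

/-! ### The Gauss value of a polynomial. -/

section Gauss

variable {k : Type*} [Field k] (w : Valuation k ℤᵐ⁰)

theorem le_gauss_iff {T : WithTop ℚ} {g : k[X]} :
    T ≤ gauss w g ↔ ∀ i, T ≤ addVal (w (g.coeff i)) := by
  rw [gauss, Finset.le_inf_iff]
  refine ⟨fun h i => ?_, fun h i _ => h i⟩
  by_cases hi : i ∈ g.support
  · exact h i hi
  · simp [Polynomial.notMem_support_iff.1 hi, addVal_zero]

theorem lt_gauss_iff {T : ℚ} {g : k[X]} :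
    (T : WithTop ℚ) < gauss w g ↔ ∀ i, (T : WithTop ℚ) < addVal (w (g.coeff i)) := by
  rw [gauss, Finset.lt_inf_iff (WithTop.coe_lt_top T)]
  refine ⟨fun h i => ?_, fun h i _ => h i⟩
  by_cases hi : i ∈ g.support
  · exact h i hi
  · simp [Polynomial.notMem_support_iff.1 hi, addVal_zero]

theorem gauss_le_coeff (g : k[X]) (i : ℕ) : gauss w g ≤ addVal (w (g.coeff i)) :=
  (le_gauss_iff w).1 le_rfl i

theorem gauss_zero : gauss w (0 : k[X]) = ⊤ := by simp [gauss]

theorem gauss_ne_top {g : k[X]} (hg : g ≠ 0) : gauss w g ≠ ⊤ := by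
  intro h
  have := gauss_le_coeff w g g.natDegree
  rw [h, top_le_iff, addVal_eq_top_iff, map_eq_zero] at this
  exact hg (leadingCoeff_eq_zero.1 this)

theorem gauss_neg (g : k[X]) : gauss w (-g) = gauss w g := by
  simp [gauss, Valuation.map_neg]

theorem min_gauss_le (g h : k[X]) : min (gauss w g) (gauss w h) ≤ gauss w (g + h) := by
  rw [le_gauss_iff]
  intro i
  rw [coeff_add]
  exact (min_le_min (gauss_le_coeff w g i) (gauss_le_coeff w h i)).trans (min_addVal_le w _ _)

theorem le_addVal_sum {ι : Type*} (s : Finset ι) (f : ι → k) {T : WithTop ℚ}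
    (h : ∀ i ∈ s, T ≤ addVal (w (f i))) : T ≤ addVal (w (∑ i ∈ s, f i)) := by
  classical
  induction s using Finset.induction_on with
  | empty => simp [addVal_zero]
  | insert a s ha ih =>
    rw [Finset.sum_insert ha]
    refine (le_min (h a (Finset.mem_insert_self a s)) (ih fun i hi => ?_)).trans
      (min_addVal_le w _ _)
    exact h i (Finset.mem_insert_of_mem hi)

theorem gauss_add_le_mul (g h : k[X]) : gauss w g + gauss w h ≤ gauss w (g * h) := by
  rw [le_gauss_iff]
  intro i
  rw [coeff_mul]
  refine le_addVal_sum w _ _ fun p _ => ?_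
  rw [map_mul, addVal_mul]
  exact add_le_add (gauss_le_coeff w g _) (gauss_le_coeff w h _)

theorem gauss_le_zero_of_monic {g : k[X]} (hg : g.Monic) : gauss w g ≤ 0 := by
  refine (gauss_le_coeff w g g.natDegree).trans ?_
  rw [show g.coeff g.natDegree = 1 from hg, map_one, addVal_one]

end Gauss

namespace RatVal

variable {k : Type*} [Field k] {w : Valuation k ℤᵐ⁰} (μ : RatVal w)

/-! ### Values of polynomials -/

/-- The restriction of `μ` to polynomials. -/
def polyVal : AddValuation k[X] (WithTop ℚ) := μ.val.comap (algebraMap k[X] (RatFunc k))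

theorem polyVal_apply (g : k[X]) : μ.polyVal g = μ.pval g := rfl

theorem pval_eq_top_iff {g : k[X]} : μ.pval g = ⊤ ↔ g = 0 := by
  rw [pval, AddValuation.top_iff, map_eq_zero_iff _ (RatFunc.algebraMap_injective k)]

theorem pval_eq_coe {g : k[X]} (hg : g ≠ 0) : μ.pval g = (μ.qval g : ℚ) := by
  unfold qval
  cases h : μ.pval g with
  | top => exact absurd (μ.pval_eq_top_iff.1 h) hg
  | coe a => simp

theorem pval_pow (g : k[X]) (n : ℕ) : μ.pval (g ^ n) = n • μ.pval g := by
  rw [← polyVal_apply, AddValuation.map_pow, polyVal_apply]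

theorem pval_C (a : k) : μ.pval (C a) = addVal (w a) := by
  rw [← μ.extends_base, pval, RatFunc.algebraMap_C]

theorem qval_mul {g h : k[X]} (hg : g ≠ 0) (hh : h ≠ 0) :
    μ.qval (g * h) = μ.qval g + μ.qval h := by
  have := μ.pval_mul g h
  rw [μ.pval_eq_coe hg, μ.pval_eq_coe hh, μ.pval_eq_coe (mul_ne_zero hg hh)] at this
  exact_mod_cast this

theorem qval_pow {g : k[X]} (hg : g ≠ 0) (n : ℕ) : μ.qval (g ^ n) = n * μ.qval g := by
  have := μ.pval_pow g n
  rw [μ.pval_eq_coe hg, μ.pval_eq_coe (pow_ne_zero n hg), ← WithTop.coe_nsmul] at this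
  simpa using WithTop.coe_injective this

theorem pval_sub (g h : k[X]) : min (μ.pval g) (μ.pval h) ≤ μ.pval (g - h) := by
  rw [sub_eq_add_neg, ← μ.pval_neg h]
  exact μ.pval_add g (-h)

theorem pval_sub_comm (g h : k[X]) : μ.pval (g - h) = μ.pval (h - g) := by
  rw [← μ.pval_neg, neg_sub]

theorem pval_eq_of_lt_sub {g h : k[X]} (hgh : μ.pval g < μ.pval (g - h)) :
    μ.pval h = μ.pval g := by
  have h1 := μ.pval_sub g (g - h)
  rw [sub_sub_cancel, min_eq_left hgh.le] at h1
  refine le_antisymm ?_ h1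
  by_contra hlt
  have := μ.pval_add (g - h) h
  rw [sub_add_cancel] at this
  exact absurd this (not_le.2 (lt_min hgh (not_le.1 hlt)))

/-- This is where μ(x) ≥ 0 enters. It makes every valuation considered here continuous for
coefficientwise convergence, on which the passage to the completion rests. -/
theorem gauss_le_pval (g : k[X]) : gauss w g ≤ μ.pval g := by
  conv_rhs => rw [g.as_sum_support_C_mul_X_pow]
  rw [← polyVal_apply]
  refine AddValuation.map_le_sum _ fun i _ => ?_
  rw [polyVal_apply, pval_mul, pval_C, pval_pow]
  have hX : 0 ≤ μ.pval (X : k[X]) := by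
    have := μ.nonneg_X
    rwa [← RatFunc.algebraMap_X] at this
  exact (gauss_le_coeff w g i).trans (le_add_of_nonneg_right (nsmul_nonneg hX i))

/-! ### Homogeneous elements of the graded algebra -/

theorem mem_P_iff {α : ℚ} {g : k[X]} : g ∈ μ.P α ↔ (α : WithTop ℚ) ≤ μ.pval g := Iff.rfl

theorem of_cls_eq {α β : ℚ} (hαβ : α = β) (g : μ.P α) (h : μ.P β) (hgh : g.1 = h.1) :
    DirectSum.of μ.Piece α (μ.cls g) = DirectSum.of μ.Piece β (μ.cls h) := by
  subst hαβ
  obtain rfl : g = h := Subtype.ext hgh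
  rfl

theorem of_cls_eq_zero_iff {α : ℚ} (g : μ.P α) :
    DirectSum.of μ.Piece α (μ.cls g) = 0 ↔ (α : WithTop ℚ) < μ.pval g.1 := by
  rw [← map_zero (DirectSum.of μ.Piece α), (DirectSum.of_injective α).eq_iff, ← cls_zero,
    cls_eq_cls]
  simp

theorem H_zero : μ.H 0 = 0 := by
  rw [H, of_cls_eq_zero_iff]
  simp [pval_zero]

theorem H_ne_zero {g : k[X]} (hg : g ≠ 0) : μ.H g ≠ 0 := by
  rw [H, Ne, of_cls_eq_zero_iff, μ.pval_eq_coe hg]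
  exact lt_irrefl _

theorem H_eq_of {g : k[X]} (hg : g ≠ 0) {α : ℚ} (hα : μ.pval g = α) (hm : g ∈ μ.P α) :
    μ.H g = DirectSum.of μ.Piece α (μ.cls ⟨g, hm⟩) := by
  refine μ.of_cls_eq ?_ _ _ rfl
  rw [μ.pval_eq_coe hg] at hα
  exact_mod_cast hα

theorem H_mul (g h : k[X]) : μ.H (g * h) = μ.H g * μ.H h := by
  by_cases hg : g = 0
  · simp [hg, H_zero]
  by_cases hh : h = 0
  · simp [hh, H_zero]
  rw [H, H, H, DirectSum.of_mul_of]
  exact μ.of_cls_eq (μ.qval_mul hg hh) _ (μ.pmul _ _) rfl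

theorem H_one : μ.H 1 = 1 := by
  have h : μ.pval (1 : k[X]) = ((0 : ℚ) : WithTop ℚ) := by rw [pval_one]; rfl
  rw [μ.H_eq_of one_ne_zero h (by rw [mem_P_iff, h])]
  rfl

theorem H_pow (g : k[X]) (n : ℕ) : μ.H (g ^ n) = μ.H g ^ n := by
  induction n with
  | zero => simp [H_one]
  | succ n ih => rw [pow_succ, pow_succ, H_mul, ih]

theorem H_eq_iff {g h : k[X]} (hg : g ≠ 0) : μ.H g = μ.H h ↔ μ.pval g < μ.pval (g - h) := by
  constructor
  · intro e
    have hh : h ≠ 0 := by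
      rintro rfl
      exact μ.H_ne_zero hg (e.trans μ.H_zero)
    have hq : μ.qval g = μ.qval h := by
      by_contra hne
      have h1 : μ.H g (μ.qval g) = 0 := by
        rw [e, H]
        exact DirectSum.of_eq_of_ne _ _ _ hne
      rw [H, DirectSum.of_eq_same] at h1
      apply μ.H_ne_zero hg
      rw [H, h1, map_zero]
    have hm : h ∈ μ.P (μ.qval g) := by
      rw [hq]
      exact μ.self_mem_P h
    rw [μ.H_eq_of hh (by rw [hq, μ.pval_eq_coe hh]) hm, H,
      (DirectSum.of_injective _).eq_iff, cls_eq_cls] at e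
    rwa [μ.pval_eq_coe hg]
  · intro hlt
    have e := μ.pval_eq_of_lt_sub hlt
    have hh : h ≠ 0 := by
      rintro rfl
      rw [sub_zero] at hlt
      exact lt_irrefl _ hlt
    have hm : h ∈ μ.P (μ.qval g) := by
      rw [mem_P_iff, e]
      exact μ.qval_le_pval g
    rw [μ.H_eq_of hh (by rw [e, μ.pval_eq_coe hg]) hm, H]
    congr 1
    rw [cls_eq_cls, ← μ.pval_eq_coe hg]
    exact hlt

theorem of_mul_apply_add {α : ℚ} (a : μ.Piece α) (z : μ.Gr) (β : ℚ) :
    (DirectSum.of μ.Piece α a * z) (α + β) = μ.gmul a (z β) := by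
  induction z using DirectSum.induction_on with
  | zero =>
    obtain ⟨g, rfl⟩ := μ.cls_surjective a
    rw [mul_zero]
    exact (congrArg μ.cls (Subtype.ext (mul_zero g.1) : μ.pmul g (0 : μ.P β) = 0)).symm
  | of γ c =>
    rw [DirectSum.of_mul_of]
    by_cases h : γ = β
    · subst h
      rw [DirectSum.of_eq_same, DirectSum.of_eq_same]
      rfl
    · rw [DirectSum.of_eq_of_ne _ _ _ (fun e => h (add_left_cancel e).symm),
        DirectSum.of_eq_of_ne _ _ _ (Ne.symm h)]
      exact (DirectSum.GNonUnitalNonAssocSemiring.mul_zero a).symm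
  | add x y hx hy =>
    rw [mul_add, DirectSum.add_apply, hx, hy, DirectSum.add_apply]
    exact (DirectSum.GNonUnitalNonAssocSemiring.mul_add a _ _).symm

/-- Divisibility of a homogeneous element by the initial form of a polynomial. -/
theorem H_dvd_of_cls_iff {f : k[X]} (hf : f ≠ 0) {α : ℚ} (g : μ.P α) :
    μ.H f ∣ DirectSum.of μ.Piece α (μ.cls g) ↔
      ∃ h, (α : WithTop ℚ) ≤ μ.pval (f * h) ∧ (α : WithTop ℚ) < μ.pval (g.1 - f * h) := by
  constructor
  · rintro ⟨z, hz⟩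
    -- Only the component of the cofactor in degree α - μ(f) contributes to degree α, so the
    -- cofactor may be replaced by a homogeneous one.
    obtain ⟨β, hβ⟩ : ∃ β, α = μ.qval f + β := ⟨α - μ.qval f, by ring⟩
    obtain ⟨h, hh⟩ := μ.cls_surjective (z β)
    subst hβ
    have e := congrArg (fun x : μ.Gr => x (μ.qval f + β)) hz
    simp only [H] at e
    rw [DirectSum.of_eq_same, of_mul_apply_add, ← hh, gmul_cls, cls_eq_cls] at e
    refine ⟨h.1, ?_, e⟩
    exact (μ.pmul ⟨f, μ.self_mem_P f⟩ h).2
  · rintro ⟨h, h1, h2⟩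
    rw [← mem_P_iff] at h1
    by_cases h0 : h = 0
    · subst h0
      rw [mul_zero, sub_zero] at h2
      rw [(μ.of_cls_eq_zero_iff g).2 h2]
      exact dvd_zero _
    have e : DirectSum.of μ.Piece α (μ.cls g) =
        DirectSum.of μ.Piece α (μ.cls ⟨f * h, h1⟩) := by
      congr 1
      rwa [cls_eq_cls]
    rw [e]
    rcases (μ.mem_P_iff.1 h1).eq_or_lt with h3 | h3
    · rw [← μ.H_eq_of (mul_ne_zero hf h0) h3.symm, H_mul]
      exact dvd_mul_right _ _
    · rw [(μ.of_cls_eq_zero_iff (⟨f * h, h1⟩ : μ.P α)).2 h3]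
      exact dvd_zero _

/-- The working form of μ-divisibility. The inequality already forces μ(f h) = μ(g), so no separate
condition on the degree of the cofactor is needed. -/
theorem divides_iff {f g : k[X]} (hg : g ≠ 0) :
    μ.Divides f g ↔ ∃ h, μ.pval g < μ.pval (g - f * h) := by
  by_cases hf : f = 0
  · subst hf
    simp [Divides, H_zero, H_ne_zero μ hg]
  rw [Divides, show μ.H g = DirectSum.of μ.Piece (μ.qval g) (μ.cls ⟨g, μ.self_mem_P g⟩) from rfl,
    H_dvd_of_cls_iff μ hf, ← μ.pval_eq_coe hg]
  refine exists_congr fun h => ⟨fun h' => h'.2, fun h' => ⟨?_, h'⟩⟩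
  rw [μ.pval_eq_of_lt_sub h']

theorem mem_residualIdeal_iff {f : k[X]} (hf : f ≠ 0) (g : μ.P 0) :
    μ.cls g ∈ μ.residualIdeal f ↔ ∃ h, 0 ≤ μ.pval (f * h) ∧ 0 < μ.pval (g.1 - f * h) := by
  rw [residualIdeal, Ideal.mem_comap, Ideal.mem_span_singleton]
  exact μ.H_dvd_of_cls_iff hf g

theorem divides_zero (f : k[X]) : μ.Divides f 0 := by
  rw [Divides, H_zero]
  exact dvd_zero _

theorem Divides.mul_right {f g : k[X]} (h : μ.Divides f g) (r : k[X]) : μ.Divides f (g * r) := by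
  rw [Divides, H_mul]
  exact Dvd.dvd.mul_right h _

theorem Divides.trans_dvd {f g h : k[X]} (hfg : μ.Divides f g) (hgh : g ∣ h) : μ.Divides f h := by
  obtain ⟨r, rfl⟩ := hgh
  exact hfg.mul_right μ r

theorem divides_self (f : k[X]) : μ.Divides f f := dvd_refl _

end RatVal

/-! ### Expansions -/

section Expansion

variable {k : Type*} [Field k]

theorem expCoeff_zero (φ g : k[X]) : expCoeff φ g 0 = g %ₘ φ := rfl

theorem expCoeff_succ (φ g : k[X]) (s : ℕ) :
    expCoeff φ g (s + 1) = expCoeff φ (g /ₘ φ) s := by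
  simp [expCoeff, Function.iterate_succ_apply]

variable {φ : k[X]}

theorem mod_div_add_mul (hφ : φ.Monic) {a : k[X]} (ha : a.degree < φ.degree) (h : k[X]) :
    (a + φ * h) %ₘ φ = a ∧ (a + φ * h) /ₘ φ = h :=
  (div_modByMonic_unique h a hφ ⟨rfl, ha⟩).symm

theorem degree_divByMonic_lt_of_lt_succ (hφ : φ.Monic) (hd : 0 < φ.natDegree) {g : k[X]} {n : ℕ}
    (hg : g.degree < ((n + 1 : ℕ) : WithBot ℕ)) : (g /ₘ φ).degree < (n : WithBot ℕ) := by
  by_cases h0 : g /ₘ φ = 0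
  · rw [h0, degree_zero]
    exact WithBot.bot_lt_coe n
  have hg0 : g ≠ 0 := by
    rintro rfl
    simp at h0
  rw [← natDegree_lt_iff_degree_lt h0, natDegree_divByMonic _ hφ]
  rw [← natDegree_lt_iff_degree_lt hg0] at hg
  have : g.natDegree ≠ 0 ∨ g.natDegree - φ.natDegree < n := by
    by_contra! hc
    apply h0
    rw [divByMonic_eq_zero_iff hφ]
    rw [← natDegree_lt_natDegree_iff hg0]
    omega
  omega

/-- Induction along the Horner form a_0 + φ(a_1 + φ(a_2 + ⋯)); it spares manipulations of the whole
φ-expansion. -/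
theorem expansion_induction (hφ : φ.Monic) (hd : 0 < φ.natDegree) {P : k[X] → Prop} (h0 : P 0)
    (h : ∀ a g, a.degree < φ.degree → P g → P (a + φ * g)) (g : k[X]) : P g := by
  obtain ⟨n, hn⟩ : ∃ n : ℕ, g.degree < (n : WithBot ℕ) :=
    ⟨g.natDegree + 1, degree_le_natDegree.trans_lt (by exact_mod_cast Nat.lt_succ_self _)⟩
  induction n generalizing g with
  | zero =>
    have hg : g = 0 := by
      rw [← degree_eq_bot]
      simpa using hn
    rwa [hg]
  | succ n ih =>
    rw [← modByMonic_add_div g φ]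
    exact h _ _ (degree_modByMonic_lt g hφ) (ih _ (degree_divByMonic_lt_of_lt_succ hφ hd hn))

theorem expCoeff_degree_lt (hφ : φ.Monic) (g : k[X]) (s : ℕ) :
    (expCoeff φ g s).degree < φ.degree :=
  degree_modByMonic_lt _ hφ

theorem expCoeff_eq_zero (hφ : φ.Monic) (hd : 0 < φ.natDegree) {g : k[X]} {s : ℕ}
    (hg : g.natDegree < s * φ.natDegree) : expCoeff φ g s = 0 := by
  induction s generalizing g with
  | zero => simp at hg
  | succ s ih =>
    rw [expCoeff_succ]
    by_cases hs : s * φ.natDegree = 0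
    · obtain rfl : s = 0 := by
        rcases Nat.mul_eq_zero.1 hs with h | h
        · exact h
        · omega
      have : g /ₘ φ = 0 := by
        rw [divByMonic_eq_zero_iff hφ]
        exact degree_lt_degree (by simpa using hg)
      simp [expCoeff, this]
    · apply ih
      rw [natDegree_divByMonic _ hφ]
      rw [add_mul] at hg
      omega

theorem natDegree_lt_of_degree_lt (hd : 0 < φ.natDegree) {a : k[X]} (h : a.degree < φ.degree) :
    a.natDegree < φ.natDegree := by
  by_cases ha : a = 0
  · simpa [ha] using hd
  · exact natDegree_lt_natDegree ha h

end Expansion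

namespace RatVal

variable {k : Type*} [Field k] {w : Valuation k ℤᵐ⁰} (μ : RatVal w) {φ : k[X]}

/-! ### Augmented values -/

/-- `min_s (μ(a_s) + s δ)`, where `∑ a_s φ^s` is the `φ`-expansion of `g`. -/
def augVal (φ : k[X]) (δ : ℚ) (g : k[X]) : WithTop ℚ :=
  (Finset.range (g.natDegree + 1)).inf fun s =>
    μ.pval (expCoeff φ g s) + (((s : ℚ) * δ : ℚ) : WithTop ℚ)

theorem inf_range_succ {f : ℕ → WithTop ℚ} (n : ℕ) :
    (Finset.range (n + 1)).inf f = min (f 0) ((Finset.range n).inf fun s => f (s + 1)) := by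
  refine le_antisymm (le_min ?_ ?_) ?_
  · exact Finset.inf_le (Finset.mem_range.2 n.succ_pos)
  · refine Finset.le_inf fun s hs => Finset.inf_le ?_
    rw [Finset.mem_range] at hs ⊢
    omega
  · refine Finset.le_inf fun s hs => ?_
    cases s with
    | zero => exact min_le_left _ _
    | succ s =>
      refine (min_le_right _ _).trans
        (Finset.inf_le (f := fun s => f (s + 1)) (Finset.mem_range.2 ?_))
      rw [Finset.mem_range] at hs
      omega

/-- The coefficients of index greater than deg g vanish, so they contribute ∞ and the range of the
minimum can be lengthened at will. -/
theorem augVal_eq_inf (hφ : φ.Monic) (hd : 0 < φ.natDegree) (δ : ℚ) {g : k[X]} {n : ℕ}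
    (hn : g.degree < (n : WithBot ℕ)) :
    μ.augVal φ δ g = (Finset.range n).inf fun s =>
      μ.pval (expCoeff φ g s) + (((s : ℚ) * δ : ℚ) : WithTop ℚ) := by
  have key : ∀ s : ℕ, g.degree < (s : WithBot ℕ) →
      μ.pval (expCoeff φ g s) + (((s : ℚ) * δ : ℚ) : WithTop ℚ) = ⊤ := by
    intro s hs
    by_cases hg : g = 0
    · have : expCoeff φ g s = 0 := by
        simp only [expCoeff, hg]
        rw [Function.iterate_fixed (zero_divByMonic φ), zero_modByMonic]
      rw [this, pval_zero, top_add]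
    · rw [expCoeff_eq_zero hφ hd, pval_zero, top_add]
      rw [← natDegree_lt_iff_degree_lt hg] at hs
      exact hs.trans_le (Nat.le_mul_of_pos_right _ hd)
  refine le_antisymm (Finset.le_inf fun s hs => ?_) (Finset.le_inf fun s hs => ?_)
  · by_cases h : g.degree < (s : WithBot ℕ)
    · rw [key s h]
      exact le_top
    · refine Finset.inf_le (Finset.mem_range.2 ?_)
      rw [not_lt] at h
      exact Nat.lt_succ_of_le (le_natDegree_of_coe_le_degree h)
  · by_cases h : g.degree < (s : WithBot ℕ)
    · rw [key s h]
      exact le_top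
    · refine Finset.inf_le (f := fun s : ℕ =>
        μ.pval (expCoeff φ g s) + (((s : ℚ) * δ : ℚ) : WithTop ℚ)) (Finset.mem_range.2 ?_)
      exact_mod_cast (not_lt.1 h).trans_lt hn

theorem augVal_le (hφ : φ.Monic) (hd : 0 < φ.natDegree) (δ : ℚ) (g : k[X]) (s : ℕ) :
    μ.augVal φ δ g ≤ μ.pval (expCoeff φ g s) + (((s : ℚ) * δ : ℚ) : WithTop ℚ) := by
  have h : g.degree < ((max (g.natDegree + 1) (s + 1) : ℕ) : WithBot ℕ) :=
    degree_le_natDegree.trans_lt (by exact_mod_cast lt_max_of_lt_left (Nat.lt_succ_self _))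
  rw [μ.augVal_eq_inf hφ hd δ h]
  exact Finset.inf_le (f := fun s : ℕ =>
    μ.pval (expCoeff φ g s) + (((s : ℚ) * δ : ℚ) : WithTop ℚ))
    (Finset.mem_range.2 (lt_max_of_lt_right s.lt_succ_self))

theorem augVal_zero (δ : ℚ) : μ.augVal φ δ 0 = ⊤ := by
  simp [augVal, expCoeff, pval_zero]

theorem inf_add_coe (n : ℕ) (f : ℕ → WithTop ℚ) (δ : ℚ) :
    (Finset.range n).inf f + (δ : WithTop ℚ) = (Finset.range n).inf fun s => f s + δ := by
  induction n with
  | zero => simp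
  | succ n ih => rw [Finset.range_add_one, Finset.inf_insert, Finset.inf_insert, ← ih,
      min_add_add_right]

/-- The Horner rule for augmented values, designed for `expansion_induction`. -/
theorem augVal_add_mul (hφ : φ.Monic) (hd : 0 < φ.natDegree) (δ : ℚ) {a : k[X]}
    (ha : a.degree < φ.degree) (g : k[X]) :
    μ.augVal φ δ (a + φ * g) = min (μ.pval a) (μ.augVal φ δ g + δ) := by
  obtain ⟨n, hn⟩ : ∃ n : ℕ, (a + φ * g).degree < ((n + 1 : ℕ) : WithBot ℕ) :=
    ⟨(a + φ * g).natDegree,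
      degree_le_natDegree.trans_lt (by exact_mod_cast Nat.lt_succ_self _)⟩
  obtain ⟨e1, e2⟩ := mod_div_add_mul hφ ha g
  have hg := degree_divByMonic_lt_of_lt_succ hφ hd hn
  rw [e2] at hg
  rw [μ.augVal_eq_inf hφ hd δ hn, μ.augVal_eq_inf hφ hd δ hg, inf_range_succ, inf_add_coe]
  congr 1
  · simp [expCoeff_zero, e1]
  · refine Finset.inf_congr rfl fun s _ => ?_
    rw [expCoeff_succ, e2, add_assoc, ← WithTop.coe_add]
    congr 2
    push_cast
    ring

theorem augVal_of_degree_lt (hφ : φ.Monic) (hd : 0 < φ.natDegree) (δ : ℚ) {a : k[X]}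
    (ha : a.degree < φ.degree) : μ.augVal φ δ a = μ.pval a := by
  have := μ.augVal_add_mul hφ hd δ ha 0
  simpa [augVal_zero] using this

theorem augVal_mul_left (hφ : φ.Monic) (hd : 0 < φ.natDegree) (δ : ℚ) (g : k[X]) :
    μ.augVal φ δ (φ * g) = μ.augVal φ δ g + δ := by
  have := μ.augVal_add_mul hφ hd δ (a := 0)
    (by rw [degree_zero]; exact bot_lt_iff_ne_bot.2 (mt degree_eq_bot.1 hφ.ne_zero)) g
  simpa [pval_zero] using this

theorem augVal_pow_mul (hφ : φ.Monic) (hd : 0 < φ.natDegree) (δ : ℚ) (n : ℕ) (g : k[X]) :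
    μ.augVal φ δ (φ ^ n * g) = μ.augVal φ δ g + ((n * δ : ℚ) : WithTop ℚ) := by
  induction n with
  | zero => simp
  | succ n ih =>
    rw [pow_succ', mul_assoc, augVal_mul_left μ hφ hd, ih, add_assoc, ← WithTop.coe_add]
    congr 2
    push_cast
    ring

theorem augVal_le_pval_mod (hφ : φ.Monic) (hd : 0 < φ.natDegree) (δ : ℚ) (g : k[X]) :
    μ.augVal φ δ g ≤ μ.pval (g %ₘ φ) := by
  conv_lhs => rw [← modByMonic_add_div g φ]
  rw [augVal_add_mul μ hφ hd δ (degree_modByMonic_lt g hφ)]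
  exact min_le_left _ _

theorem min_augVal_le (hφ : φ.Monic) (hd : 0 < φ.natDegree) (δ : ℚ) (g h : k[X]) :
    min (μ.augVal φ δ g) (μ.augVal φ δ h) ≤ μ.augVal φ δ (g + h) := by
  induction g using expansion_induction hφ hd generalizing h with
  | h0 => simp
  | h a g ha ih =>
    rw [← modByMonic_add_div h φ]
    set b := h %ₘ φ
    set h' := h /ₘ φ
    have hb : b.degree < φ.degree := degree_modByMonic_lt h hφ
    rw [show a + φ * g + (b + φ * h') = (a + b) + φ * (g + h') by ring,
      augVal_add_mul μ hφ hd δ ha, augVal_add_mul μ hφ hd δ hb, augVal_add_mul μ hφ hd δ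
      ((degree_add_le a b).trans_lt (max_lt ha hb))]
    refine le_min ?_ ?_
    · exact (min_le_min (min_le_left _ _) (min_le_left _ _)).trans (μ.pval_add a b)
    · refine (min_le_min (min_le_right _ _) (min_le_right _ _)).trans ?_
      rw [min_add_add_right]
      exact add_le_add_left (ih h') _

theorem augVal_neg (hφ : φ.Monic) (hd : 0 < φ.natDegree) (δ : ℚ) (g : k[X]) :
    μ.augVal φ δ (-g) = μ.augVal φ δ g := by
  induction g using expansion_induction hφ hd with
  | h0 => simp
  | h a g ha ih =>
    rw [show -(a + φ * g) = -a + φ * (-g) by ring, augVal_add_mul μ hφ hd δ ha,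
      augVal_add_mul μ hφ hd δ (by rwa [degree_neg]), ih, pval_neg]

theorem augVal_ne_top (hφ : φ.Monic) (hd : 0 < φ.natDegree) (δ : ℚ) {g : k[X]} (hg : g ≠ 0) :
    μ.augVal φ δ g ≠ ⊤ := by
  induction g using expansion_induction hφ hd with
  | h0 => exact absurd rfl hg
  | h a g ha ih =>
    rw [augVal_add_mul μ hφ hd δ ha]
    by_cases h0 : g = 0
    · subst h0
      simp only [mul_zero, add_zero] at hg
      intro h
      rw [min_eq_top, pval_eq_top_iff] at h
      exact hg h.1
    · intro h
      rw [min_eq_top, WithTop.add_eq_top] at h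
      simpa [ih h0] using h.2

theorem augVal_mono (hφ : φ.Monic) (hd : 0 < φ.natDegree) {δ δ' : ℚ} (h : δ ≤ δ') (g : k[X]) :
    μ.augVal φ δ g ≤ μ.augVal φ δ' g := by
  induction g using expansion_induction hφ hd with
  | h0 => simp [augVal_zero]
  | h a g ha ih =>
    rw [augVal_add_mul μ hφ hd _ ha, augVal_add_mul μ hφ hd _ ha]
    exact min_le_min le_rfl (add_le_add ih (WithTop.coe_le_coe.2 h))

/-! ### Minimal and key polynomials -/

variable {μ}

theorem IsMinimal.not_divides (hφ : μ.IsMinimal φ) {a : k[X]} (ha : a ≠ 0)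
    (hd : a.degree < φ.degree) : ¬ μ.Divides φ a :=
  hφ.2 a ha (natDegree_lt_of_degree_lt hφ.1 hd)

/-- A cancellation between a and φg would say that φ μ-divides a, with cofactor -g, against
minimality. -/
theorem IsMinimal.pval_add_mul (hφ : μ.IsMinimal φ) {a : k[X]} (ha : a.degree < φ.degree)
    (g : k[X]) : μ.pval (a + φ * g) = min (μ.pval a) (μ.pval (φ * g)) := by
  by_cases h0 : a = 0
  · simp [h0, pval_zero]
  refine le_antisymm ?_ (μ.pval_add _ _)
  have h := hφ.not_divides h0 ha
  rw [divides_iff μ h0] at h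
  push Not at h
  have h1 := h (-g)
  rw [mul_neg, sub_neg_eq_add] at h1
  refine le_min h1 ?_
  have h2 := μ.pval_sub (a + φ * g) a
  rw [add_sub_cancel_left, min_eq_left h1] at h2
  exact h2

theorem pval_eq_augVal (hm : φ.Monic) (hφ : μ.IsMinimal φ) (g : k[X]) :
    μ.pval g = μ.augVal φ (μ.qval φ) g := by
  induction g using expansion_induction hm hφ.1 with
  | h0 => rw [pval_zero, augVal_zero]
  | h a g ha ih =>
    rw [augVal_add_mul μ hm hφ.1 _ ha, hφ.pval_add_mul ha, pval_mul, ih,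
      μ.pval_eq_coe hm.ne_zero, add_comm (μ.qval φ : WithTop ℚ)]

theorem pval_le_augVal (hm : φ.Monic) (hφ : μ.IsMinimal φ) {δ : ℚ} (hδ : μ.qval φ ≤ δ)
    (g : k[X]) : μ.pval g ≤ μ.augVal φ δ g := by
  rw [pval_eq_augVal hm hφ g]
  exact augVal_mono μ hm hφ.1 hδ g

theorem pval_le_pval_mod (hm : φ.Monic) (hφ : μ.IsMinimal φ) (g : k[X]) :
    μ.pval g ≤ μ.pval (g %ₘ φ) := by
  rw [pval_eq_augVal hm hφ g]
  exact augVal_le_pval_mod μ hm hφ.1 _ g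

/-- Division with remainder by φ never lowers the value of the remainder below μ(g); if it raised
it, the quotient would exhibit φ ∣_μ g. -/
theorem pval_mod_eq (hm : φ.Monic) (hφ : μ.IsMinimal φ) {g : k[X]} (hg : ¬ μ.Divides φ g) :
    μ.pval (g %ₘ φ) = μ.pval g := by
  have h0 : g ≠ 0 := by
    rintro rfl
    exact hg (μ.divides_zero φ)
  rw [divides_iff μ h0] at hg
  push Not at hg
  refine le_antisymm ?_ (pval_le_pval_mod hm hφ g)
  have := hg (g /ₘ φ)
  rwa [← modByMonic_eq_sub_mul_div g] at this

theorem IsKey.monic (hφ : μ.IsKey φ) : φ.Monic := hφ.1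

theorem IsKey.isMinimal (hφ : μ.IsKey φ) : μ.IsMinimal φ := hφ.2.1

theorem IsKey.natDegree_pos (hφ : μ.IsKey φ) : 0 < φ.natDegree := hφ.2.1.1

theorem IsKey.divides_or_divides (hφ : μ.IsKey φ) {g h : k[X]} (H : μ.Divides φ (g * h)) :
    μ.Divides φ g ∨ μ.Divides φ h := by
  have := hφ.2.2.2.mem_or_mem (x := μ.H g) (y := μ.H h)
  simp only [Ideal.mem_span_singleton, ← H_mul] at this
  exact this H

theorem IsKey.divides_of_divides_pow (hφ : μ.IsKey φ) {g : k[X]} {n : ℕ}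
    (H : μ.Divides φ (g ^ n)) : μ.Divides φ g := by
  rw [Divides, H_pow, ← Ideal.mem_span_singleton] at H
  exact Ideal.mem_span_singleton.1 (hφ.2.2.2.mem_of_pow_mem n H)

theorem IsMinimal.not_divides_C (hφ : μ.IsMinimal φ) {c : k} (hc : c ≠ 0) :
    ¬ μ.Divides φ (C c) :=
  hφ.2 _ (C_ne_zero.2 hc) (by simpa using hφ.1)

/-- In a proper factorization, primality of the initial form makes φ μ-divide a factor of smaller
degree, against minimality. -/
theorem IsKey.irreducible (hφ : μ.IsKey φ) : Irreducible φ := by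
  rw [hφ.monic.irreducible_iff_natDegree]
  refine ⟨?_, fun f g hf hg hfg => ?_⟩
  · rintro rfl
    simpa using hφ.natDegree_pos
  · by_contra! hc
    have hdeg : φ.natDegree = f.natDegree + g.natDegree := by rw [← hfg, hf.natDegree_mul hg]
    have h := μ.divides_self φ
    nth_rewrite 2 [← hfg] at h
    rcases hφ.divides_or_divides h with h | h
    · exact hφ.isMinimal.2 f hf.ne_zero (by rw [hdeg]; exact Nat.lt_add_of_pos_right (Nat.pos_of_ne_zero hc.2)) h
    · exact hφ.isMinimal.2 g hg.ne_zero (by rw [hdeg]; exact Nat.lt_add_of_pos_left (Nat.pos_of_ne_zero hc.1)) h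

/-! ### Multiplicativity of augmented values -/

/-- A product of two coefficients may have to be expanded again, but since δ ≥ μ(φ) this does not
bring its augmented value below its μ-value. -/
theorem augVal_add_le_mul (hφ : μ.IsKey φ) {δ : ℚ} (hδ : μ.qval φ ≤ δ) (g h : k[X]) :
    μ.augVal φ δ g + μ.augVal φ δ h ≤ μ.augVal φ δ (g * h) := by
  have hm := hφ.monic
  have hd := hφ.natDegree_pos
  have small : ∀ a : k[X], a.degree < φ.degree → ∀ h : k[X],
      μ.pval a + μ.augVal φ δ h ≤ μ.augVal φ δ (a * h) := by
    intro a ha h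
    induction h using expansion_induction hm hd with
    | h0 => simp [augVal_zero]
    | h b h hb ih =>
      rw [augVal_add_mul μ hm hd δ hb, show a * (b + φ * h) = a * b + φ * (a * h) by ring]
      refine le_trans ?_ (min_augVal_le μ hm hd δ _ _)
      refine le_min ?_ ?_
      · refine (add_le_add_right (min_le_left _ _) _).trans ?_
        rw [← pval_mul]
        exact pval_le_augVal hm hφ.isMinimal hδ _
      · refine (add_le_add_right (min_le_right _ _) _).trans ?_
        rw [augVal_mul_left μ hm hd, ← add_assoc]
        exact add_le_add_left ih _
  induction g using expansion_induction hm hd with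
  | h0 => simp [augVal_zero]
  | h a g ha ih =>
    rw [augVal_add_mul μ hm hd δ ha, show (a + φ * g) * h = a * h + φ * (g * h) by ring]
    refine le_trans ?_ (min_augVal_le μ hm hd δ _ _)
    refine le_min ?_ ?_
    · exact (add_le_add_left (min_le_left _ _) _).trans (small a ha h)
    · refine (add_le_add_left (min_le_right _ _) _).trans ?_
      rw [augVal_mul_left μ hm hd, add_right_comm]
      exact add_le_add_left ih _

/-- Here i is the first index at which the minimum is attained: the terms before it are negligible,
and the remaining quotient g' attains its own minimum at its constant term. -/
theorem exists_initial_augVal (hm : φ.Monic) (hd : 0 < φ.natDegree) (δ : ℚ) {g : k[X]}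
    (hg : g ≠ 0) : ∃ (i : ℕ) (g' : k[X]), g' ≠ 0 ∧
      μ.augVal φ δ g < μ.augVal φ δ (g - φ ^ i * g') ∧
      μ.augVal φ δ g = μ.augVal φ δ (φ ^ i * g') ∧
      μ.pval (g' %ₘ φ) = μ.augVal φ δ g' := by
  induction g using expansion_induction hm hd with
  | h0 => exact absurd rfl hg
  | h a g ha ih =>
    rcases le_or_gt (μ.pval a) (μ.augVal φ δ g + δ) with hle | hlt
    · refine ⟨0, a + φ * g, hg, ?_, ?_, ?_⟩
      · rw [pow_zero, one_mul, sub_self, augVal_zero]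
        exact (augVal_ne_top μ hm hd δ hg).lt_top
      · simp
      · rw [(mod_div_add_mul hm ha g).1, augVal_add_mul μ hm hd δ ha, min_eq_left hle]
    · have h0 : g ≠ 0 := by
        rintro rfl
        simp [augVal_zero] at hlt
      obtain ⟨i, g', hg', h1, h2, h3⟩ := ih h0
      refine ⟨i + 1, g', hg', ?_, ?_, h3⟩
      · rw [augVal_add_mul μ hm hd δ ha, min_eq_right hlt.le,
          show a + φ * g - φ ^ (i + 1) * g' = a + φ * (g - φ ^ i * g') by ring,
          augVal_add_mul μ hm hd δ ha]
        exact lt_min hlt (WithTop.add_lt_add_right WithTop.coe_ne_top h1)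
      · rw [augVal_add_mul μ hm hd δ ha, min_eq_right hlt.le, pow_succ', mul_assoc,
          augVal_mul_left μ hm hd, h2]

theorem augVal_mul (hφ : μ.IsKey φ) {δ : ℚ} (hδ : μ.qval φ ≤ δ) (g h : k[X]) :
    μ.augVal φ δ (g * h) = μ.augVal φ δ g + μ.augVal φ δ h := by
  have hm := hφ.monic
  have hd := hφ.natDegree_pos
  by_cases hg : g = 0
  · simp [hg, augVal_zero]
  by_cases hh : h = 0
  · simp [hh, augVal_zero]
  refine le_antisymm ?_ (augVal_add_le_mul hφ hδ g h)
  obtain ⟨i, g', hg', g1, g2, g3⟩ := exists_initial_augVal (μ := μ) hm hd δ hg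
  obtain ⟨j, h', hh', h1, h2, h3⟩ := exists_initial_augVal (μ := μ) hm hd δ hh
  have hgt := augVal_ne_top μ hm hd δ hg
  have hht := augVal_ne_top μ hm hd δ hh
  -- After removal of the powers of φ, the constant term of g'h' is the remainder of a product of
  -- two polynomials of degree < deg φ. By primality φ does not μ-divide this product, so no value
  -- is gained.
  have upper : μ.augVal φ δ (φ ^ i * g' * (φ ^ j * h')) ≤ μ.augVal φ δ g + μ.augVal φ δ h := by
    rw [g2, h2, show φ ^ i * g' * (φ ^ j * h') = φ ^ i * (φ ^ j * (g' * h')) by ring,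
      augVal_pow_mul μ hm hd, augVal_pow_mul μ hm hd, augVal_pow_mul μ hm hd,
      augVal_pow_mul μ hm hd, add_add_add_comm, add_comm (((i : ℚ) * δ : ℚ) : WithTop ℚ),
      add_assoc]
    refine add_le_add_left ?_ _
    have hga : g' %ₘ φ ≠ 0 := by
      intro h
      rw [h, pval_zero] at g3
      exact augVal_ne_top μ hm hd δ hg' g3.symm
    have hha : h' %ₘ φ ≠ 0 := by
      intro h
      rw [h, pval_zero] at h3
      exact augVal_ne_top μ hm hd δ hh' h3.symm
    refine (augVal_le_pval_mod μ hm hd δ _).trans ?_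
    rw [mul_modByMonic, pval_mod_eq hm hφ.isMinimal, pval_mul, g3, h3]
    intro hdiv
    rcases hφ.divides_or_divides hdiv with h | h
    · exact hφ.isMinimal.not_divides hga (degree_modByMonic_lt _ hm) h
    · exact hφ.isMinimal.not_divides hha (degree_modByMonic_lt _ hm) h
  by_contra hlt
  rw [not_le] at hlt
  apply absurd upper
  rw [not_le]
  -- The product of the principal parts differs from gh by two terms of value greater than the sum;
  -- if gh also exceeded the sum, so would this product, contradicting `upper`.
  rw [show φ ^ i * g' * (φ ^ j * h') =
    g * h + (-((g - φ ^ i * g') * h) + -(φ ^ i * g' * (h - φ ^ j * h'))) by ring]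
  refine lt_of_lt_of_le (lt_min hlt ?_) (min_augVal_le μ hm hd δ _ _)
  refine lt_of_lt_of_le (lt_min ?_ ?_) (min_augVal_le μ hm hd δ _ _)
  · rw [augVal_neg μ hm hd]
    exact (WithTop.add_lt_add_right hht g1).trans_le (augVal_add_le_mul hφ hδ _ _)
  · rw [augVal_neg μ hm hd, g2]
    rw [g2] at hgt
    exact (WithTop.add_lt_add_left hgt h1).trans_le (augVal_add_le_mul hφ hδ _ _)

end RatVal

section MonicExpansion

variable {k : Type*} [Field k] {φ : k[X]}

theorem exists_leading_expCoeff (hφ : φ.Monic) (hd : 0 < φ.natDegree) {g : k[X]} (hg : g.Monic) :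
    ∃ s : ℕ, (expCoeff φ g s).Monic ∧
      g.natDegree = (expCoeff φ g s).natDegree + s * φ.natDegree := by
  induction hn : g.natDegree using Nat.strong_induction_on generalizing g with
  | _ n ih =>
    rcases lt_or_ge g.degree φ.degree with hlt | hle
    · refine ⟨0, ?_⟩
      rw [expCoeff_zero, (modByMonic_eq_self_iff hφ).2 hlt]
      exact ⟨hg, by omega⟩
    · have hm : (g /ₘ φ).Monic := by
        rw [Monic, leadingCoeff_divByMonic_of_monic hφ hle, hg]
      have hle' := natDegree_le_natDegree hle
      have e := natDegree_divByMonic g hφ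
      obtain ⟨s, hs, hs'⟩ := ih _ (by omega) hm rfl
      refine ⟨s + 1, ?_⟩
      rw [expCoeff_succ]
      refine ⟨hs, ?_⟩
      rw [add_mul]
      omega

end MonicExpansion

namespace RatVal

variable {k : Type*} [Field k] {w : Valuation k ℤᵐ⁰} {μ : RatVal w} {φ : k[X]}

/-! ### Bounds on values -/

theorem isAugmentation_iff {φ : k[X]} (hφ : φ ≠ 0) {l : ℚ} {μ' : RatVal w} :
    μ.IsAugmentation φ l μ' ↔ ∀ g, μ'.pval g = μ.augVal φ (μ.qval φ + l) g := by
  refine forall_congr' fun g => ?_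
  have : ∀ s : ℕ, μ.pval (expCoeff φ g s * φ ^ s) + (((s : ℚ) * l : ℚ) : WithTop ℚ) =
      μ.pval (expCoeff φ g s) + (((s : ℚ) * (μ.qval φ + l) : ℚ) : WithTop ℚ) := by
    intro s
    rw [pval_mul, μ.pval_eq_coe (pow_ne_zero s hφ), qval_pow μ hφ, add_assoc, ← WithTop.coe_add,
      mul_add]
  simp only [this, augVal]

theorem augVal_add_le (δ : ℚ) {l : ℚ} (hl : 0 ≤ l) (g : k[X]) :
    μ.augVal φ (δ + l) g ≤ μ.augVal φ δ g + ((g.natDegree * l : ℚ) : WithTop ℚ) := by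
  unfold augVal
  rw [inf_add_coe]
  refine Finset.le_inf fun s hs => (Finset.inf_le hs).trans ?_
  rw [add_assoc, ← WithTop.coe_add]
  refine add_le_add_right (WithTop.coe_le_coe.2 ?_) _
  have : (s : ℚ) ≤ g.natDegree := by
    rw [Finset.mem_range] at hs
    exact_mod_cast Nat.lt_succ_iff.1 hs
  nlinarith

/-- Each augmentation of slope l raises the value of g by at most l · deg g, so c is the sum of the
slopes. This upper bound complements `gauss_le_pval`. -/
theorem IsInductive.exists_pval_le (hμ : μ.IsInductive) : ∃ c : ℚ, 0 ≤ c ∧ ∀ g : k[X],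
    μ.pval g ≤ gauss w g + ((c * g.natDegree : ℚ) : WithTop ℚ) := by
  induction hμ with
  | minimal μ h =>
    refine ⟨0, le_rfl, fun g => ?_⟩
    rw [h g]
    simp
  | augment μ μ' φ l hμ hφ hl h ih =>
    obtain ⟨c, hc, hb⟩ := ih
    refine ⟨c + l, by positivity, fun g => ?_⟩
    rw [isAugmentation_iff hφ.monic.ne_zero] at h
    rw [h g]
    refine (augVal_add_le _ hl.le g).trans ?_
    rw [← pval_eq_augVal hφ.monic hφ.isMinimal]
    refine (add_le_add_left (hb g) _).trans ?_
    rw [add_assoc, ← WithTop.coe_add]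
    refine add_le_add_right (WithTop.coe_le_coe.2 (le_of_eq ?_)) _
    ring

/-- Among monic polynomials, `μ(g) / deg g` is maximal for the key polynomials. -/
theorem natDegree_mul_qval_le (hμ : μ.IsInductive) (hm : φ.Monic) (hφ : μ.IsMinimal φ)
    {g : k[X]} (hg : g.Monic) :
    (φ.natDegree : ℚ) * μ.qval g ≤ g.natDegree * μ.qval φ := by
  obtain ⟨c, hc, hb⟩ := hμ.exists_pval_le
  -- In the φ-expansion of g^N the leading coefficient r is monic of degree < deg φ, so μ(r) ≤ c ·
  -- deg φ for every N. The right-hand side is independent of N, which excludes a positive factor on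
  -- the left.
  have key : ∀ N : ℕ, (N : ℚ) * (φ.natDegree * μ.qval g - g.natDegree * μ.qval φ) ≤
      φ.natDegree * (c * φ.natDegree) + φ.natDegree * |μ.qval φ| := by
    intro N
    obtain ⟨s, hs, hs'⟩ := exists_leading_expCoeff hm hφ.1 (hg.pow N)
    set r := expCoeff φ (g ^ N) s with hr
    have hrd : r.natDegree < φ.natDegree :=
      natDegree_lt_of_degree_lt hφ.1 (expCoeff_degree_lt hm _ _)
    have h1 := augVal_le μ hm hφ.1 (μ.qval φ) (g ^ N) s
    rw [← pval_eq_augVal hm hφ, ← hr, μ.pval_eq_coe (hg.pow N).ne_zero, μ.pval_eq_coe hs.ne_zero, μ.qval_pow hg.ne_zero,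
      ← WithTop.coe_add, WithTop.coe_le_coe] at h1
    have h2 := (hb r).trans (add_le_add_left (gauss_le_zero_of_monic w hs) _)
    rw [zero_add, μ.pval_eq_coe hs.ne_zero, WithTop.coe_le_coe] at h2
    rw [hg.natDegree_pow] at hs'
    have h3 : (N : ℚ) * g.natDegree = r.natDegree + s * φ.natDegree := by exact_mod_cast hs'
    have h4 : (r.natDegree : ℚ) ≤ φ.natDegree := by exact_mod_cast hrd.le
    have h5 : -((r.natDegree : ℚ) * μ.qval φ) ≤ φ.natDegree * |μ.qval φ| := by
      have := neg_abs_le (μ.qval φ)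
      have := abs_nonneg (μ.qval φ)
      have h6 : (0 : ℚ) ≤ r.natDegree := by positivity
      nlinarith
    have h7 : (φ.natDegree : ℚ) * (N * μ.qval g) ≤
        φ.natDegree * (c * φ.natDegree + s * μ.qval φ) := by
      refine mul_le_mul_of_nonneg_left (h1.trans (add_le_add_left (h2.trans ?_) _)) (by positivity)
      exact mul_le_mul_of_nonneg_left h4 hc
    have h8 : (N : ℚ) * (g.natDegree * μ.qval φ) =
        r.natDegree * μ.qval φ + φ.natDegree * (s * μ.qval φ) := by
      rw [← mul_assoc, h3]
      ring
    linarith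
  by_contra! hlt
  have hpos : 0 < (φ.natDegree : ℚ) * μ.qval g - g.natDegree * μ.qval φ := by linarith
  obtain ⟨N, hN⟩ := exists_nat_gt ((φ.natDegree * (c * φ.natDegree) +
    φ.natDegree * |μ.qval φ|) / (φ.natDegree * μ.qval g - g.natDegree * μ.qval φ))
  rw [div_lt_iff₀ hpos] at hN
  exact absurd (key N) (not_le.2 hN)

/-! ### Powers of minimal polynomials -/

/-- The expansion of g involves only indices < n, and φ^n h only indices ≥ n. Nothing can cancel,
and the coefficients of g keep contributing to the minimum. -/
theorem pval_sub_pow_mul_le (hm : φ.Monic) (hφ : μ.IsMinimal φ) (n : ℕ) {g : k[X]}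
    (hg : g.degree < ((n * φ.natDegree : ℕ) : WithBot ℕ)) (h : k[X]) :
    μ.pval (g - φ ^ n * h) ≤ μ.pval g := by
  induction n generalizing g with
  | zero =>
    have : g = 0 := by
      rw [← degree_eq_bot]
      simpa using hg
    simp [this, pval_zero]
  | succ n ih =>
    have hd : (g /ₘ φ).degree < ((n * φ.natDegree : ℕ) : WithBot ℕ) := by
      by_cases h0 : g /ₘ φ = 0
      · rw [h0, degree_zero]
        exact WithBot.bot_lt_coe _
      have hg0 : g ≠ 0 := by
        rintro rfl
        simp at h0
      have hle : φ.natDegree ≤ g.natDegree := by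
        by_contra! hlt
        exact h0 ((divByMonic_eq_zero_iff hm).2 (degree_lt_degree hlt))
      rw [← natDegree_lt_iff_degree_lt h0, natDegree_divByMonic _ hm]
      rw [← natDegree_lt_iff_degree_lt hg0, add_mul] at hg
      omega
    have e := modByMonic_add_div g φ
    have ha := degree_modByMonic_lt g hm
    set a := g %ₘ φ
    set g' := g /ₘ φ
    rw [← e, show a + φ * g' - φ ^ (n + 1) * h = a + φ * (g' - φ ^ n * h) by ring,
      hφ.pval_add_mul ha, hφ.pval_add_mul ha, pval_mul, pval_mul]
    exact min_le_min le_rfl (add_le_add_right (ih hd) _)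

theorem isMinimal_of_equivalent_pow (hm : φ.Monic) (hφ : μ.IsMinimal φ) {n : ℕ} (hn : 0 < n)
    {f : k[X]} (hf : f.natDegree = n * φ.natDegree) (h : μ.Equivalent f (φ ^ n)) :
    μ.IsMinimal f := by
  refine ⟨hf ▸ Nat.mul_pos hn hφ.1, fun g hg hlt hdiv => ?_⟩
  have h' : μ.Divides (φ ^ n) g := by
    rw [Divides, ← show μ.H f = μ.H (φ ^ n) from h]
    exact hdiv
  rw [divides_iff μ hg] at h'
  obtain ⟨r, hr⟩ := h'
  refine absurd hr (not_lt.2 (pval_sub_pow_mul_le hm hφ n ?_ r))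
  rw [← natDegree_lt_iff_degree_lt hg]
  omega

/-! ### Residual ideals -/

variable (μ) in
/-- The subring of polynomials of non-negative value. -/
def nonneg : Subring k[X] where
  carrier := {g | 0 ≤ μ.pval g}
  add_mem' {a b} ha hb := le_trans (le_min ha hb) (μ.pval_add a b)
  zero_mem' := by simp [pval_zero]
  one_mem' := by simp [pval_one]
  mul_mem' {a b} ha hb := by
    change 0 ≤ μ.pval (a * b)
    rw [pval_mul]
    exact add_nonneg ha hb
  neg_mem' {a} ha := by simpa [pval_neg] using ha

variable (μ) in
/-- The reduction map onto `Δ(μ)`. -/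
def reduction : μ.nonneg →+* μ.Delta where
  toFun g := μ.cls ⟨g.1, g.2⟩
  map_zero' := rfl
  map_one' := rfl
  map_add' _ _ := rfl
  map_mul' g h := by
    apply DirectSum.of_injective (β := μ.Piece) 0
    rw [DirectSum.of_zero_mul, DirectSum.of_mul_of]
    exact μ.of_cls_eq (zero_add 0).symm _ (μ.pmul ⟨g.1, g.2⟩ ⟨h.1, h.2⟩) rfl

theorem reduction_surjective : Function.Surjective μ.reduction := by
  intro x
  obtain ⟨g, rfl⟩ := μ.cls_surjective x
  exact ⟨⟨g.1, g.2⟩, rfl⟩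

theorem reduction_eq_iff {g h : μ.nonneg} :
    μ.reduction g = μ.reduction h ↔ 0 < μ.pval (g.1 - h.1) :=
  μ.cls_eq_cls (α := 0) ⟨g.1, g.2⟩ ⟨h.1, h.2⟩

theorem reduction_mem_iff {f : k[X]} (hf : f ≠ 0) (g : μ.nonneg) :
    μ.reduction g ∈ μ.residualIdeal f ↔
      ∃ h, 0 ≤ μ.pval (f * h) ∧ 0 < μ.pval (g.1 - f * h) :=
  μ.mem_residualIdeal_iff hf ⟨g.1, g.2⟩

theorem reduction_mem_of_dvd {f : k[X]} (hf : f ≠ 0) {g : μ.nonneg} (h : f ∣ g.1) :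
    μ.reduction g ∈ μ.residualIdeal f := by
  obtain ⟨r, hr⟩ := h
  refine (reduction_mem_iff hf g).2 ⟨r, ?_, ?_⟩
  · rw [← hr]
    exact g.2
  · rw [← hr, sub_self, pval_zero]
    exact WithTop.coe_lt_top 0

/-- Inverses modulo a key polynomial. -/
theorem IsKey.exists_inverse (hφ : μ.IsKey φ) {a : k[X]} (ha : a ≠ 0) (hd : a.degree < φ.degree) :
    ∃ b : k[X], b ≠ 0 ∧ b.degree < φ.degree ∧ μ.pval (a * b) = 0 ∧ φ ∣ a * b - 1 := by
  have hm := hφ.monic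
  have hcop : IsCoprime φ a := by
    rw [hφ.irreducible.coprime_iff_not_dvd]
    intro hdvd
    exact absurd hd (not_lt.2 (degree_le_of_dvd hdvd ha))
  obtain ⟨u, v, huv⟩ := hcop
  have hb : φ ∣ a * (v %ₘ φ) - 1 := by
    refine ⟨-u - a * (v /ₘ φ), ?_⟩
    have e := modByMonic_add_div v φ
    linear_combination huv + a * e
  have hb0 : v %ₘ φ ≠ 0 := by
    intro h
    rw [h, mul_zero, zero_sub, dvd_neg] at hb
    exact hφ.irreducible.not_isUnit (isUnit_of_dvd_one hb)
  refine ⟨v %ₘ φ, hb0, degree_modByMonic_lt v hm, ?_, hb⟩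
  have h1 : (a * (v %ₘ φ)) %ₘ φ = 1 := by
    obtain ⟨c, hc⟩ := hb
    rw [sub_eq_iff_eq_add'] at hc
    rw [hc]
    refine (mod_div_add_mul hm ?_ c).1
    rw [degree_one, ← natDegree_pos_iff_degree_pos]
    exact hφ.natDegree_pos
  -- By primality φ does not μ-divide ab, so ab has the value of its remainder, which is 1.
  rw [← pval_mod_eq hm hφ.isMinimal, h1, pval_one]
  intro hdiv
  rcases hφ.divides_or_divides hdiv with h | h
  · exact hφ.isMinimal.not_divides ha hd h
  · exact hφ.isMinimal.not_divides hb0 (degree_modByMonic_lt v hm) h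

/-- A class outside the ideal has a representative whose remainder modulo φ has value exactly 0, and
such a remainder has an inverse modulo φ, again of value 0. -/
theorem IsKey.residualIdeal_isMaximal (hφ : μ.IsKey φ) : (μ.residualIdeal φ).IsMaximal := by
  have hm := hφ.monic
  have hprime : (μ.residualIdeal φ).IsPrime := by
    have := hφ.2.2.2
    exact Ideal.IsPrime.comap _
  rw [Ideal.isMaximal_iff]
  refine ⟨fun h => hprime.ne_top ((Ideal.eq_top_iff_one _).2 h), fun J x hJ hx hxJ => ?_⟩
  obtain ⟨g, rfl⟩ := reduction_surjective x
  have e := modByMonic_add_div g.1 φ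
  have had := degree_modByMonic_lt g.1 hm
  set a := g.1 %ₘ φ with ha
  set q := g.1 /ₘ φ
  have h1 : 0 ≤ μ.pval a := le_trans g.2 (pval_le_pval_mod hm hφ.isMinimal _)
  have h2 : 0 ≤ μ.pval (φ * q) := by
    have := μ.pval_sub g.1 a
    rw [← e, add_sub_cancel_left, e] at this
    exact le_trans (le_min g.2 h1) this
  have h3 : μ.pval a = 0 := by
    refine le_antisymm ?_ h1
    by_contra! hlt
    refine hx ((reduction_mem_iff hm.ne_zero g).2 ⟨q, h2, ?_⟩)
    rwa [← e, add_sub_cancel_right]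
  have ha0 : a ≠ 0 := by
    intro h
    rw [h, pval_zero] at h3
    exact WithTop.top_ne_coe h3
  obtain ⟨b, hb0, hbd, hab, c, hc⟩ := hφ.exists_inverse ha0 had
  have hb : b ∈ μ.nonneg := by
    rw [pval_mul, h3, zero_add] at hab
    exact hab.ge
  have h4 : μ.reduction (g * ⟨b, hb⟩ - 1) ∈ μ.residualIdeal φ := by
    refine reduction_mem_of_dvd hm.ne_zero ⟨c + q * b, ?_⟩
    change g.1 * b - 1 = _
    rw [← e]
    linear_combination hc
  have h5 : (1 : μ.Delta) = μ.reduction g * μ.reduction ⟨b, hb⟩ - μ.reduction (g * ⟨b, hb⟩ - 1) := by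
    rw [map_sub, map_mul, map_one]
    ring
  rw [h5]
  exact J.sub_mem (J.mul_mem_right _ hxJ) (hJ h4)

/-- The group of values of the polynomials of degree less than that of a key polynomial. -/
def IsKey.smallValues (hφ : μ.IsKey φ) : AddSubgroup ℚ where
  carrier := {r | ∃ a : k[X], a ≠ 0 ∧ a.degree < φ.degree ∧ μ.pval a = (r : WithTop ℚ)}
  zero_mem' := by
    refine ⟨1, one_ne_zero, ?_, pval_one μ⟩
    rw [degree_one, ← natDegree_pos_iff_degree_pos]
    exact hφ.natDegree_pos
  add_mem' := by
    rintro r s ⟨a, ha, had, har⟩ ⟨b, hb, hbd, hbs⟩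
    have h : μ.pval ((a * b) %ₘ φ) = ((r + s : ℚ) : WithTop ℚ) := by
      rw [pval_mod_eq hφ.monic hφ.isMinimal, pval_mul, har, hbs, WithTop.coe_add]
      intro hdiv
      rcases hφ.divides_or_divides hdiv with h | h
      · exact hφ.isMinimal.not_divides ha had h
      · exact hφ.isMinimal.not_divides hb hbd h
    refine ⟨(a * b) %ₘ φ, ?_, degree_modByMonic_lt _ hφ.monic, h⟩
    intro h0
    rw [h0, pval_zero] at h
    exact WithTop.top_ne_coe h
  neg_mem' := by
    rintro r ⟨a, ha, had, har⟩
    obtain ⟨b, hb, hbd, hab, -⟩ := hφ.exists_inverse ha had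
    refine ⟨b, hb, hbd, ?_⟩
    rw [pval_mul, har, μ.pval_eq_coe hb, ← WithTop.coe_add] at hab
    rw [μ.pval_eq_coe hb]
    have : r + μ.qval b = 0 := by exact_mod_cast hab
    congr 1
    linarith

theorem residualIdeal_antitone {f g : k[X]} (h : f ∣ g) :
    μ.residualIdeal g ≤ μ.residualIdeal f := by
  obtain ⟨r, rfl⟩ := h
  refine Ideal.comap_mono (Ideal.span_singleton_le_span_singleton.2 ?_)
  rw [H_mul]
  exact dvd_mul_right _ _

/-- Write a representative as φ^n(a + φq). If φ^n a had value 0, then nμ(φ) = -μ(a) would be a small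
value; so φ^n a vanishes in Δ(μ), and only φ^(n+1) q is left. -/
theorem IsKey.residualIdeal_pow_succ (hφ : μ.IsKey φ) {n : ℕ}
    (hn : (n : ℚ) * μ.qval φ ∉ hφ.smallValues) :
    μ.residualIdeal (φ ^ (n + 1)) = μ.residualIdeal (φ ^ n) := by
  have hm := hφ.monic
  refine le_antisymm (residualIdeal_antitone (pow_dvd_pow φ n.le_succ)) fun x hx => ?_
  obtain ⟨g, rfl⟩ := reduction_surjective x
  rw [reduction_mem_iff (pow_ne_zero _ hm.ne_zero)] at hx ⊢
  obtain ⟨h, h1, h2⟩ := hx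
  have e := modByMonic_add_div h φ
  have had := degree_modByMonic_lt h hm
  have hle := pval_le_pval_mod hm hφ.isMinimal h
  set a := h %ₘ φ
  set q := h /ₘ φ
  have h3 : 0 ≤ μ.pval (φ ^ n * a) := by
    refine h1.trans ?_
    rw [pval_mul, pval_mul]
    exact add_le_add_right hle _
  have h4 : 0 < μ.pval (φ ^ n * a) := by
    refine lt_of_le_of_ne h3 fun h5 => hn ?_
    have ha0 : a ≠ 0 := by
      intro h
      rw [h, mul_zero, pval_zero] at h5
      exact WithTop.coe_ne_top h5
    rw [← neg_mem_iff]
    refine ⟨a, ha0, had, ?_⟩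
    rw [pval_mul, μ.pval_eq_coe (pow_ne_zero n hm.ne_zero), μ.pval_eq_coe ha0,
      qval_pow μ hm.ne_zero, ← WithTop.coe_add] at h5
    rw [μ.pval_eq_coe ha0]
    have : 0 = n * μ.qval φ + μ.qval a := by exact_mod_cast h5
    congr 1
    linarith
  have e1 : φ ^ (n + 1) * q = φ ^ n * h - φ ^ n * a := by
    rw [← e]
    ring
  refine ⟨q, ?_, ?_⟩
  · rw [e1]
    exact (le_min h1 h3).trans (μ.pval_sub _ _)
  · rw [e1, ← sub_add]
    exact (lt_min h2 h4).trans_le (μ.pval_add _ _)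

theorem IsKey.residualIdeal_pow_eq (hφ : μ.IsKey φ) {m n : ℕ} (hmn : m ≤ n)
    (h : ∀ s, m ≤ s → s < n → (s : ℚ) * μ.qval φ ∉ hφ.smallValues) :
    μ.residualIdeal (φ ^ n) = μ.residualIdeal (φ ^ m) := by
  induction n, hmn using Nat.le_induction with
  | base => rfl
  | succ n hn ih =>
    rw [hφ.residualIdeal_pow_succ (h n hn n.lt_succ_self)]
    exact ih fun s h1 h2 => h s h1 (h2.trans n.lt_succ_self)

theorem residualIdeal_pow_le (f : k[X]) (n : ℕ) :
    μ.residualIdeal f ^ n ≤ μ.residualIdeal (f ^ n) := by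
  rw [residualIdeal, residualIdeal, H_pow, ← Ideal.span_singleton_pow]
  exact Ideal.le_comap_pow _ n

/-- An element congruent to 1 modulo I is invertible modulo I^n: the expansion of (1 - s^n)^n, which
lies in I^n, is 1 minus a multiple of s^n. -/
theorem mem_pow_of_mul_pow_mem {R : Type*} [CommRing R] {I : Ideal R} {x s : R} {n : ℕ}
    (hs : s - 1 ∈ I) (hx : x * s ^ n ∈ I ^ n) : x ∈ I ^ n := by
  have h1 : 1 - s ^ n ∈ I := by
    obtain ⟨t, ht⟩ := sub_dvd_pow_sub_pow s 1 n
    rw [one_pow] at ht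
    rw [← neg_sub, ht, ← mul_neg]
    exact I.mul_mem_right _ hs
  obtain ⟨t, ht⟩ := sub_dvd_pow_sub_pow 1 (1 - s ^ n) n
  rw [one_pow, sub_sub_cancel] at ht
  have : x = x * s ^ n * t + (1 - s ^ n) ^ n * x := by linear_combination x * ht
  rw [this]
  exact (I ^ n).add_mem (Ideal.mul_mem_right _ _ hx)
    (Ideal.mul_mem_right _ _ (Ideal.pow_mem_pow h1 n))

/-- Choose a of small degree with μ(φ^e a) = 0 and its inverse b modulo φ. Then φ^(en) r · (ab)^n =
(φ^e a)^n · r b^n, where φ^e a reduces into ℛ(φ), and the factor (ab)^n can be removed because ab ≡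
1 modulo ℛ(φ). -/
theorem IsKey.residualIdeal_pow_mul (hφ : μ.IsKey φ) {e : ℕ}
    (h : (e : ℚ) * μ.qval φ ∈ hφ.smallValues)
    (heq : μ.residualIdeal (φ ^ e) = μ.residualIdeal φ) (n : ℕ) :
    μ.residualIdeal (φ ^ (e * n)) = μ.residualIdeal φ ^ n := by
  have hm := hφ.monic
  have hm0 : φ ^ e ≠ 0 := pow_ne_zero e hm.ne_zero
  refine le_antisymm (fun x hx => ?_) ?_
  swap
  · rw [pow_mul, ← heq]
    exact residualIdeal_pow_le _ n
  rw [← neg_mem_iff] at h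
  obtain ⟨a, ha0, had, ha⟩ := h
  obtain ⟨b, hb0, hbd, hab, hb⟩ := hφ.exists_inverse ha0 had
  have hea : μ.pval (φ ^ e * a) = 0 := by
    rw [pval_mul, ha, μ.pval_eq_coe hm0, qval_pow μ hm.ne_zero, ← WithTop.coe_add,
      add_neg_cancel]
    rfl
  obtain ⟨g, rfl⟩ := reduction_surjective x
  obtain ⟨r, h1, h2⟩ := (reduction_mem_iff (pow_ne_zero _ hm.ne_zero) g).1 hx
  rw [show μ.reduction g = μ.reduction ⟨φ ^ (e * n) * r, h1⟩ from reduction_eq_iff.2 h2]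
  refine mem_pow_of_mul_pow_mem (s := μ.reduction ⟨a * b, hab.ge⟩) ?_ ?_
  · rw [← map_one μ.reduction, ← map_sub]
    exact reduction_mem_of_dvd hm.ne_zero hb
  · have h3 : 0 ≤ μ.pval (r * b ^ n) := by
      have e1 : φ ^ (e * n) * r * (a * b) ^ n = (φ ^ e * a) ^ n * (r * b ^ n) := by ring
      have e2 := congrArg μ.pval e1
      rw [pval_mul, pval_pow, hab, pval_mul μ ((φ ^ e * a) ^ n), pval_pow, hea, nsmul_zero,
        add_zero, zero_add] at e2
      rw [← e2]
      exact h1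
    have e3 : μ.reduction ⟨φ ^ (e * n) * r, h1⟩ * μ.reduction ⟨a * b, hab.ge⟩ ^ n =
        μ.reduction ⟨φ ^ e * a, hea.ge⟩ ^ n * μ.reduction ⟨r * b ^ n, h3⟩ := by
      rw [← map_pow, ← map_pow, ← map_mul, ← map_mul]
      congr 1
      apply Subtype.ext
      change φ ^ (e * n) * r * (a * b) ^ n = (φ ^ e * a) ^ n * (r * b ^ n)
      ring
    rw [e3]
    refine Ideal.mul_mem_right _ _ (Ideal.pow_mem_pow ?_ n)
    rw [← heq]
    exact reduction_mem_of_dvd hm0 (dvd_mul_right _ _)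

theorem IsKey.exists_residualIdeal_pow (hφ : μ.IsKey φ) (hw : ∃ c : k, addVal (w c) = 1) {l : ℕ}
    (hl : 0 < l) : ∃ n : ℕ, 0 < n ∧ μ.residualIdeal (φ ^ l) = μ.residualIdeal φ ^ n := by
  classical
  have hex : ∃ e : ℕ, 0 < e ∧ (e : ℚ) * μ.qval φ ∈ hφ.smallValues := by
    -- A constant of value 1 makes all integers small values, so the denominator of μ(φ) is a
    -- possible exponent.
    refine ⟨(μ.qval φ).den, (μ.qval φ).pos, ?_⟩
    obtain ⟨c, hc⟩ := hw
    have h1 : (1 : ℚ) ∈ hφ.smallValues := by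
      refine ⟨C c, ?_, ?_, ?_⟩
      · rintro h
        rw [C_eq_zero] at h
        rw [h, map_zero, addVal_zero] at hc
        exact WithTop.top_ne_coe hc
      · exact degree_C_le.trans_lt (natDegree_pos_iff_degree_pos.1 hφ.natDegree_pos)
      · rw [pval_C, hc]
        rfl
    have h2 := zsmul_mem h1 (μ.qval φ).num
    rwa [zsmul_eq_mul, mul_one, ← Rat.den_mul_eq_num] at h2
  set e := Nat.find hex with he
  obtain ⟨he0, heV⟩ := Nat.find_spec hex
  rw [← he] at he0 heV
  have hdvd : ∀ s : ℕ, (s : ℚ) * μ.qval φ ∈ hφ.smallValues → e ∣ s := by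
    intro s hs
    rw [Nat.dvd_iff_mod_eq_zero]
    by_contra h0
    refine Nat.find_min hex (Nat.mod_lt s he0) ⟨Nat.pos_of_ne_zero h0, ?_⟩
    have h1 := hφ.smallValues.sub_mem hs (hφ.smallValues.nsmul_mem heV (s / e))
    convert h1 using 1
    have h2 : (s : ℚ) = e * (s / e : ℕ) + (s % e : ℕ) := by exact_mod_cast (Nat.div_add_mod s e).symm
    rw [nsmul_eq_mul]
    linear_combination (-μ.qval φ) * h2
  have h1 : μ.residualIdeal (φ ^ e) = μ.residualIdeal φ := by
    have := hφ.residualIdeal_pow_eq (m := 1) (n := e) he0 fun s h1 h2 h3 => by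
      have := Nat.le_of_dvd h1 (hdvd s h3)
      omega
    rwa [pow_one] at this
  -- For l > 0 this is ⌈l/e⌉. There is no multiple of e in the interval from l up to, but excluding,
  -- e⌈l/e⌉, so ℛ(φ^l) equals ℛ(φ^(e⌈l/e⌉)).
  refine ⟨(l - 1) / e + 1, Nat.succ_pos _, ?_⟩
  rw [← hφ.residualIdeal_pow_mul heV h1]
  have h2 := Nat.div_add_mod (l - 1) e
  have h3 := Nat.mod_lt (l - 1) he0
  have h4 : e * ((l - 1) / e + 1) = e * ((l - 1) / e) + e := by ring
  refine (hφ.residualIdeal_pow_eq (by omega) fun s hs1 hs2 hs3 => ?_).symm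
  obtain ⟨t, rfl⟩ := hdvd s hs3
  have h5 : (l - 1) / e < t := by
    by_contra! hc
    have := Nat.mul_le_mul_left e hc
    omega
  have h6 : t < (l - 1) / e + 1 := Nat.lt_of_mul_lt_mul_left hs2
  omega

end RatVal

/-! ### The valuation of the algebraic closure -/

section AlgVal

variable {k : Type*} [Field k] {w : Valuation k ℤᵐ⁰} {Ω : Type*} [Field Ω] [Algebra k Ω]

theorem algVal_eq_of_minpoly_eq {x y : Ω} (h : minpoly k x = minpoly k y) :
    algVal w x = algVal w y := by
  rw [algVal, algVal, h]

theorem algVal_zero : algVal w (0 : Ω) = ⊤ := by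
  simp [algVal, minpoly.zero, addVal_zero]

variable [Algebra.IsAlgebraic k Ω]

theorem exists_algVal_eq {x : Ω} (hx : x ≠ 0) : ∃ q : ℚ, algVal w x = (q : WithTop ℚ) ∧
    addVal (w ((minpoly k x).coeff 0)) = (((minpoly k x).natDegree * q : ℚ) : WithTop ℚ) := by
  have hint : IsIntegral k x := Algebra.IsIntegral.isIntegral x
  have h0 : w ((minpoly k x).coeff 0) ≠ 0 := by
    rw [Ne, map_eq_zero]
    exact minpoly.coeff_zero_ne_zero hint hx
  have hd : ((minpoly k x).natDegree : ℚ) ≠ 0 := by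
    exact_mod_cast (minpoly.natDegree_pos hint).ne'
  refine ⟨((-WithZero.log (w ((minpoly k x).coeff 0)) : ℤ) : ℚ) / (minpoly k x).natDegree, ?_, ?_⟩
  · rw [algVal, addVal_of_ne_zero h0]
    rfl
  · rw [addVal_of_ne_zero h0, mul_div_cancel₀ _ hd]

end AlgVal

/-! ### The value on an algebraic extension and the spectral norm. -/

section Spectral

variable {k : Type*} [NontriviallyNormedField k] [IsUltrametricDist k] {w : Valuation k ℤᵐ⁰}
  {Ω : Type*} [Field Ω] [Algebra k Ω] [Algebra.IsAlgebraic k Ω]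

/-- With |c| = 2^(-v(c)), the spectral norm over a complete field is |p_0|^(1/d), which is the
definition of `algVal` in multiplicative form. Multiplicativity of `algVal` is deduced from this. -/
theorem spectralNorm_eq_rpow [CompleteSpace k]
    (hw : ∀ c : k, ∀ q : ℚ, addVal (w c) = (q : WithTop ℚ) → ‖c‖ = (2 : ℝ) ^ (-(q : ℝ)))
    {x : Ω} {q : ℚ} (hq : algVal w x = (q : WithTop ℚ)) :
    spectralNorm k Ω x = (2 : ℝ) ^ (-(q : ℝ)) := by
  have hx : x ≠ 0 := by
    rintro rfl
    rw [algVal_zero] at hq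
    exact WithTop.top_ne_coe hq
  obtain ⟨q', h1, h2⟩ := exists_algVal_eq (w := w) hx
  obtain rfl : q = q' := by
    rw [hq] at h1
    exact_mod_cast h1
  have hd : ((minpoly k x).natDegree : ℝ) ≠ 0 := by
    exact_mod_cast (minpoly.natDegree_pos (Algebra.IsIntegral.isIntegral (R := k) x)).ne'
  rw [spectralNorm.spectralNorm_eq_norm_coeff_zero_rpow, hw _ _ h2, ← Real.rpow_mul (by norm_num)]
  congr 1
  push_cast
  field_simp

theorem algVal_mul_of_norm [CompleteSpace k]
    (hw : ∀ c : k, ∀ q : ℚ, addVal (w c) = (q : WithTop ℚ) → ‖c‖ = (2 : ℝ) ^ (-(q : ℝ)))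
    (x y : Ω) : algVal w (x * y) = algVal w x + algVal w y := by
  by_cases hx : x = 0
  · simp [hx, algVal_zero]
  by_cases hy : y = 0
  · simp [hy, algVal_zero]
  obtain ⟨p, hp, -⟩ := exists_algVal_eq (w := w) hx
  obtain ⟨q, hq, -⟩ := exists_algVal_eq (w := w) hy
  obtain ⟨r, hr, -⟩ := exists_algVal_eq (w := w) (mul_ne_zero hx hy)
  have h : spectralNorm k Ω (x * y) = spectralNorm k Ω x * spectralNorm k Ω y :=
    spectralAlgNorm_mul x y
  rw [spectralNorm_eq_rpow hw hp, spectralNorm_eq_rpow hw hq, spectralNorm_eq_rpow hw hr,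
    ← Real.rpow_add (by norm_num)] at h
  have h' := (Real.rpow_right_inj (by norm_num) (by norm_num)).1 h
  rw [hp, hq, hr, ← WithTop.coe_add]
  congr 1
  have : (r : ℝ) = ((p + q : ℚ) : ℝ) := by
    push_cast
    linarith
  exact_mod_cast this

/-- The spectral norm is also the supremum of |p_j|^(1/(d-j)). Since the term j = 0 realizes it, the
Newton polygon of the minimal polynomial has no point below the line of slope -q through (d, 0). -/
theorem le_addVal_coeff_minpoly_of_norm [CompleteSpace k]
    (hw : ∀ c : k, ∀ q : ℚ, addVal (w c) = (q : WithTop ℚ) → ‖c‖ = (2 : ℝ) ^ (-(q : ℝ)))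
    {x : Ω} {q : ℚ} (hq : algVal w x = (q : WithTop ℚ)) {j : ℕ}
    (hj : j ≤ (minpoly k x).natDegree) :
    (((((minpoly k x).natDegree : ℚ) - j) * q : ℚ) : WithTop ℚ) ≤
      addVal (w ((minpoly k x).coeff j)) := by
  have hint : IsIntegral k x := Algebra.IsIntegral.isIntegral x
  rcases hj.eq_or_lt with rfl | hj
  · rw [show (minpoly k x).coeff (minpoly k x).natDegree = 1 from minpoly.monic hint, map_one,
      addVal_one, sub_self, zero_mul]
    rfl
  by_cases h0 : w ((minpoly k x).coeff j) = 0
  · rw [h0, addVal_zero]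
    exact le_top
  have hc := addVal_of_ne_zero h0
  set r : ℚ := ((-WithZero.log (w ((minpoly k x).coeff j)) : ℤ) : ℚ)
  have h1 : spectralValueTerms (minpoly k x) j ≤ spectralNorm k Ω x :=
    le_ciSup (spectralValueTerms_bddAbove (minpoly k x)) j
  rw [spectralValueTerms_of_lt_natDegree _ hj, spectralNorm_eq_rpow hw hq, hw _ _ hc,
    ← Real.rpow_mul (by norm_num), Real.rpow_le_rpow_left_iff (by norm_num)] at h1
  have hpos : (0 : ℝ) < (minpoly k x).natDegree - j := by
    rw [sub_pos]
    exact_mod_cast hj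
  rw [mul_one_div, div_le_iff₀ hpos] at h1
  rw [hc, WithTop.coe_le_coe]
  have : (((((minpoly k x).natDegree : ℚ) - j) * q : ℚ) : ℝ) ≤ (r : ℝ) := by
    push_cast
    linarith
  exact_mod_cast this

end Spectral

section Valued

variable {k : Type*} [Field k] [Valued k ℤᵐ⁰] [CompleteSpace k]
  {Ω : Type*} [Field Ω] [Algebra k Ω] [Algebra.IsAlgebraic k Ω]

/-- The rank one structure on a nontrivial `ℤᵐ⁰`-valued valuation, with base `2`. -/
@[reducible]
def rankOneTwo {k : Type*} [Field k] (w : Valuation k ℤᵐ⁰) (hw : ∃ c : k, addVal (w c) = 1) :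
    w.RankOne where
  hom' := (WithZeroMulInt.toNNReal (e := 2) (by norm_num)).comp
    MonoidWithZeroHom.ValueGroup₀.embedding
  strictMono' := (WithZeroMulInt.toNNReal_strictMono (e := 2) (by norm_num)).comp
    MonoidWithZeroHom.ValueGroup₀.embedding_strictMono
  exists_val_nontrivial := by
    obtain ⟨c, hc⟩ := hw
    refine ⟨c, ?_, ?_⟩
    · rintro h
      rw [h, addVal_zero] at hc
      exact WithTop.top_ne_coe hc
    · rintro h
      rw [h, addVal_one] at hc
      exact zero_ne_one hc

theorem toNNReal_eq_rpow {a : ℤᵐ⁰} {q : ℚ} (h : addVal a = (q : WithTop ℚ)) :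
    ((WithZeroMulInt.toNNReal (e := 2) (by norm_num) a : NNReal) : ℝ) = (2 : ℝ) ^ (-(q : ℝ)) := by
  have ha : a ≠ 0 := by
    rintro rfl
    rw [addVal_zero] at h
    exact WithTop.top_ne_coe h
  rw [addVal_of_ne_zero ha] at h
  have h' : q = ((-WithZero.log a : ℤ) : ℚ) := by exact_mod_cast h.symm
  rw [WithZeroMulInt.toNNReal_neg_apply _ ha, h']
  push_cast
  rw [neg_neg, Real.rpow_intCast]
  congr 1
  obtain ⟨m, rfl⟩ := WithZero.ne_zero_iff_exists.1 ha
  rfl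

theorem norm_eq_rpow {k : Type*} [Field k] [Valued k ℤᵐ⁰]
    (hw : ∃ c : k, addVal ((Valued.v : Valuation k ℤᵐ⁰) c) = 1) {c : k} {q : ℚ}
    (hq : addVal ((Valued.v : Valuation k ℤᵐ⁰) c) = (q : WithTop ℚ)) :
    letI := rankOneTwo (Valued.v : Valuation k ℤᵐ⁰) hw
    letI := Valued.toNontriviallyNormedField k ℤᵐ⁰
    ‖c‖ = (2 : ℝ) ^ (-(q : ℝ)) := by
  rw [← toNNReal_eq_rpow hq]
  change ((WithZeroMulInt.toNNReal (e := 2) (by norm_num) (MonoidWithZeroHom.ValueGroup₀.embedding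
    ((Valued.v : Valuation k ℤᵐ⁰).restrict c)) : NNReal) : ℝ) = _
  rw [Valuation.embedding_restrict]

theorem algVal_mul (hw : ∃ c : k, addVal ((Valued.v : Valuation k ℤᵐ⁰) c) = 1) (x y : Ω) :
    algVal (Valued.v : Valuation k ℤᵐ⁰) (x * y) = algVal (Valued.v : Valuation k ℤᵐ⁰) x + algVal (Valued.v : Valuation k ℤᵐ⁰) y := by
  let _ := rankOneTwo (Valued.v : Valuation k ℤᵐ⁰) hw
  let _ := Valued.toNontriviallyNormedField k ℤᵐ⁰
  refine algVal_mul_of_norm (fun c q hq => ?_) x y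
  exact norm_eq_rpow hw hq

theorem le_addVal_coeff_minpoly (hw : ∃ c : k, addVal ((Valued.v : Valuation k ℤᵐ⁰) c) = 1)
    {x : Ω} {q : ℚ} (hq : algVal (Valued.v : Valuation k ℤᵐ⁰) x = (q : WithTop ℚ)) {j : ℕ}
    (hj : j ≤ (minpoly k x).natDegree) :
    (((((minpoly k x).natDegree : ℚ) - j) * q : ℚ) : WithTop ℚ) ≤
      addVal ((Valued.v : Valuation k ℤᵐ⁰) ((minpoly k x).coeff j)) := by
  let _ := rankOneTwo (Valued.v : Valuation k ℤᵐ⁰) hw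
  let _ := Valued.toNontriviallyNormedField k ℤᵐ⁰
  refine le_addVal_coeff_minpoly_of_norm (fun c q hq => ?_) hq hj
  exact norm_eq_rpow hw hq

end Valued

/-! ### Roots of irreducible polynomials and conjugate values. -/

section Roots

variable {k : Type*} [Field k] {Ω : Type*} [Field Ω] [Algebra k Ω]

theorem minpoly_eq_of_monic_irreducible {F : k[X]} (hm : F.Monic) (hF : Irreducible F) {θ : Ω}
    (hθ : aeval θ F = 0) : minpoly k θ = F :=
  (minpoly.eq_of_irreducible_of_monic hF hθ hm).symm

theorem dvd_of_aeval_eq_zero {F : k[X]} (hm : F.Monic) (hF : Irreducible F) {θ : Ω}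
    (hθ : aeval θ F = 0) {g : k[X]} (hg : aeval θ g = 0) : F ∣ g := by
  rw [← minpoly_eq_of_monic_irreducible hm hF hθ]
  exact minpoly.dvd k θ hg

/-- Values of a polynomial at conjugate elements are conjugate. -/
theorem minpoly_aeval_eq [Algebra.IsAlgebraic k Ω] {F : k[X]} (hm : F.Monic) (hF : Irreducible F)
    {θ θ' : Ω} (hθ : aeval θ F = 0) (hθ' : aeval θ' F = 0) (g : k[X]) :
    minpoly k (aeval θ' g) = minpoly k (aeval θ g) := by
  have hint : IsIntegral k (aeval θ g) := Algebra.IsIntegral.isIntegral _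
  refine minpoly_eq_of_monic_irreducible (minpoly.monic hint) (minpoly.irreducible hint) ?_
  obtain ⟨r, hr⟩ := dvd_of_aeval_eq_zero hm hF hθ (g := (minpoly k (aeval θ g)).comp g) (by
    rw [aeval_comp, minpoly.aeval])
  rw [← aeval_comp, hr, map_mul, hθ', zero_mul]

end Roots

theorem comp_eq_sum {k : Type*} [Field k] (p g : k[X]) :
    p.comp g = ∑ j ∈ Finset.range (p.natDegree + 1), C (p.coeff j) * g ^ j := by
  rw [comp, eval₂_eq_sum_range]

section Composition

variable {k : Type*} [Field k] {w : Valuation k ℤᵐ⁰} {μ : RatVal w} {φ : k[X]}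

namespace RatVal

theorem exists_lt_pval_sub_mul_of_sum {T : ℚ} {ι : Type*} (s : Finset ι) (f : ι → k[X])
    (h : ∀ i ∈ s, ∃ r, (T : WithTop ℚ) < μ.pval (f i - φ * r)) :
    ∃ r, (T : WithTop ℚ) < μ.pval (∑ i ∈ s, f i - φ * r) := by
  classical
  induction s using Finset.induction_on with
  | empty => exact ⟨0, by simp [pval_zero]⟩
  | insert a s ha ih =>
    obtain ⟨r, hr⟩ := ih fun i hi => h i (Finset.mem_insert_of_mem hi)
    obtain ⟨r', hr'⟩ := h a (Finset.mem_insert_self a s)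
    refine ⟨r' + r, ?_⟩
    rw [Finset.sum_insert ha, mul_add, add_sub_add_comm]
    exact (lt_min hr' hr).trans_le (μ.pval_add _ _)

/-- If `φ` divides `∑ c_j g^j` and all the terms but one are divisible by `φ` modulo higher order
terms, then so is the remaining one. -/
theorem exists_of_divides_comp {p g : k[X]} {T : ℚ} {i : ℕ} (hi : i ≤ p.natDegree)
    (hdiv : μ.Divides φ (p.comp g))
    (hT : ∀ j ≤ p.natDegree, (T : WithTop ℚ) ≤ μ.pval (C (p.coeff j) * g ^ j))
    (h : ∀ j ≤ p.natDegree, j ≠ i →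
      ∃ r, (T : WithTop ℚ) < μ.pval (C (p.coeff j) * g ^ j - φ * r)) :
    ∃ r, (T : WithTop ℚ) < μ.pval (C (p.coeff i) * g ^ i - φ * r) := by
  classical
  have hG : ∃ r, (T : WithTop ℚ) < μ.pval (p.comp g - φ * r) := by
    by_cases h0 : p.comp g = 0
    · exact ⟨0, by simp [h0, pval_zero]⟩
    obtain ⟨r, hr⟩ := (divides_iff μ h0).1 hdiv
    refine ⟨r, lt_of_le_of_lt ?_ hr⟩
    rw [comp_eq_sum]
    refine AddValuation.map_le_sum μ.polyVal fun j hj => hT j ?_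
    exact Nat.lt_succ_iff.1 (Finset.mem_range.1 hj)
  obtain ⟨r, hr⟩ := hG
  obtain ⟨r', hr'⟩ := exists_lt_pval_sub_mul_of_sum (μ := μ) (φ := φ) (T := T)
    ((Finset.range (p.natDegree + 1)).erase i) (fun j => C (p.coeff j) * g ^ j)
    (fun j hj => h j (Nat.lt_succ_iff.1 (Finset.mem_range.1 (Finset.mem_of_mem_erase hj)))
      (Finset.ne_of_mem_erase hj))
  refine ⟨r - r', ?_⟩
  have e := Finset.add_sum_erase (Finset.range (p.natDegree + 1))
    (fun j => C (p.coeff j) * g ^ j) (Finset.mem_range.2 (Nat.lt_succ_of_le hi))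
  rw [← comp_eq_sum] at e
  have e' : C (p.coeff i) * g ^ i - φ * (r - r') = p.comp g - φ * r -
      (∑ j ∈ (Finset.range (p.natDegree + 1)).erase i, C (p.coeff j) * g ^ j - φ * r') := by
    rw [← e]
    ring
  rw [e']
  exact (lt_min hr hr').trans_le (μ.pval_sub _ _)

theorem le_pval_term {p g : k[X]} (hg : g ≠ 0) {j : ℕ} {q : ℚ}
    (hq : (q : WithTop ℚ) ≤ addVal (w (p.coeff j))) :
    ((q + j * μ.qval g : ℚ) : WithTop ℚ) ≤ μ.pval (C (p.coeff j) * g ^ j) := by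
  rw [pval_mul, pval_C, μ.pval_eq_coe (pow_ne_zero j hg), qval_pow μ hg, WithTop.coe_add]
  exact add_le_add_left hq _

end RatVal

end Composition

/-- The valuation of a valued field with values in `ℤᵐ⁰`. -/
abbrev fieldVal (k : Type*) [Field k] [Valued k ℤᵐ⁰] : Valuation k ℤᵐ⁰ := Valued.v

/-! ### Resultants, reciprocity, and the comparison of μ(g) with v(g(θ)). -/

section Complete

variable {k : Type*} [Field k] [Valued k ℤᵐ⁰] [CompleteSpace k]
  {Ω : Type*} [Field Ω] [Algebra k Ω] [Algebra.IsAlgebraic k Ω]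

theorem algVal_one (hw : ∃ c : k, addVal (fieldVal k c) = 1) : algVal (fieldVal k) (1 : Ω) = 0 := by
  obtain ⟨q, hq, -⟩ := exists_algVal_eq (w := (fieldVal k)) (one_ne_zero : (1 : Ω) ≠ 0)
  have h := algVal_mul hw (1 : Ω) 1
  rw [mul_one, hq, ← WithTop.coe_add] at h
  have h' : q = q + q := by exact_mod_cast h
  rw [hq, show q = 0 by linarith]
  rfl

theorem algVal_neg_one_pow (hw : ∃ c : k, addVal (fieldVal k c) = 1) (n : ℕ) :
    algVal (fieldVal k) ((-1 : Ω) ^ n) = 0 := by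
  obtain ⟨q, hq, -⟩ := exists_algVal_eq (w := (fieldVal k)) (neg_ne_zero.2 one_ne_zero : (-1 : Ω) ≠ 0)
  have h := algVal_mul hw (-1 : Ω) (-1)
  rw [neg_mul_neg, mul_one, hq, algVal_one hw, ← WithTop.coe_add] at h
  have h' : 0 = q + q := by exact_mod_cast h
  have h0 : algVal (fieldVal k) (-1 : Ω) = 0 := by
    rw [hq, show q = 0 by linarith]
    rfl
  induction n with
  | zero => rw [pow_zero, algVal_one hw]
  | succ n ih => rw [pow_succ, algVal_mul hw, ih, h0, add_zero]

theorem algVal_multiset_prod (hw : ∃ c : k, addVal (fieldVal k c) = 1) (s : Multiset Ω) (a : WithTop ℚ)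
    (h : ∀ x ∈ s, algVal (fieldVal k) x = a) : algVal (fieldVal k) s.prod = s.card • a := by
  induction s using Multiset.induction_on with
  | empty => simp [algVal_one hw]
  | cons x s ih =>
    rw [Multiset.prod_cons, algVal_mul hw, h x (Multiset.mem_cons_self x s),
      ih fun y hy => h y (Multiset.mem_cons_of_mem hy), Multiset.card_cons, succ_nsmul']

/-- The resultant is the product of G over the roots of F, counted with multiplicity, and conjugate
values of G have equal valuation. Separability plays no role. -/
theorem natDegree_nsmul_algVal_eq_resultant [IsAlgClosed Ω] (hw : ∃ c : k, addVal (fieldVal k c) = 1)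
    {F G : k[X]} (hm : F.Monic) (hF : Irreducible F) {θ : Ω} (hθ : aeval θ F = 0) :
    algVal (fieldVal k) (resultant (F.map (algebraMap k Ω)) (G.map (algebraMap k Ω))) =
      F.natDegree • algVal (fieldVal k) (aeval θ G) := by
  have hsp : (F.map (algebraMap k Ω)).Splits := IsAlgClosed.splits _
  rw [resultant_eq_prod_eval _ _ _ le_rfl hsp, (hm.map _).leadingCoeff, one_pow, one_mul,
    algVal_multiset_prod hw _ (algVal (fieldVal k) (aeval θ G)), Multiset.card_map, ← hsp.natDegree_eq_card_roots,
    natDegree_map]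
  intro x hx
  obtain ⟨θ', hθ', rfl⟩ := Multiset.mem_map.1 hx
  rw [eval_map_algebraMap]
  apply algVal_eq_of_minpoly_eq
  refine minpoly_aeval_eq hm hF hθ ?_ G
  have := (mem_roots'.1 hθ').2
  rwa [IsRoot, eval_map_algebraMap] at this

/-- Reciprocity for the values of two irreducible polynomials at each other's roots. -/
theorem natDegree_nsmul_algVal_comm [IsAlgClosed Ω] (hw : ∃ c : k, addVal (fieldVal k c) = 1)
    {F G : k[X]} (hFm : F.Monic) (hF : Irreducible F) {θ : Ω} (hθ : aeval θ F = 0)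
    (hGm : G.Monic) (hG : Irreducible G) {ξ : Ω} (hξ : aeval ξ G = 0) :
    F.natDegree • algVal (fieldVal k) (aeval θ G) = G.natDegree • algVal (fieldVal k) (aeval ξ F) := by
  rw [← natDegree_nsmul_algVal_eq_resultant hw hFm hF hθ,
    ← natDegree_nsmul_algVal_eq_resultant hw hGm hG hξ, resultant_comm, algVal_mul hw,
    algVal_neg_one_pow hw, zero_add]

namespace RatVal

variable {μ : RatVal (fieldVal k)} {φ : k[X]}

/-- If `φ` divides a prime polynomial with root `θ`, then `μ(g) ≤ v(g(θ))` for all `g`, with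
equality if and only if `φ` does not divide `g`. -/
theorem IsKey.pval_le_algVal_and (hφ : μ.IsKey φ) (hw : ∃ c : k, addVal (fieldVal k c) = 1)
    {F : k[X]} (hm : F.Monic) (hF : Irreducible F) {θ : Ω} (hθ : aeval θ F = 0)
    (hdiv : μ.Divides φ F) {g : k[X]} (hg : g ≠ 0) :
    μ.pval g ≤ algVal (fieldVal k) (aeval θ g) ∧
      (μ.pval g < algVal (fieldVal k) (aeval θ g) ↔ μ.Divides φ g) := by
  by_cases hy : aeval θ g = 0
  · rw [hy, algVal_zero, μ.pval_eq_coe hg]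
    exact ⟨le_top, fun _ => hdiv.trans_dvd μ (dvd_of_aeval_eq_zero hm hF hθ hy),
      fun _ => WithTop.coe_lt_top _⟩
  obtain ⟨q, hq, hq0⟩ := exists_algVal_eq (w := (fieldVal k)) hy
  set p := minpoly k (aeval θ g) with hp
  have hint : IsIntegral k (aeval θ g) := Algebra.IsIntegral.isIntegral _
  have hcoef : ∀ j ≤ p.natDegree, ((((p.natDegree : ℚ) - j) * q : ℚ) : WithTop ℚ) ≤
      addVal (fieldVal k (p.coeff j)) := fun j hj => le_addVal_coeff_minpoly hw hq hj
  have hpF : F ∣ p.comp g := dvd_of_aeval_eq_zero hm hF hθ (by rw [aeval_comp, minpoly.aeval])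
  have hdivp : μ.Divides φ (p.comp g) := hdiv.trans_dvd μ hpF
  have hdpos : 0 < p.natDegree := minpoly.natDegree_pos hint
  -- In the excluded case every term of index j > 0 of p(g) is, modulo φ, of value greater than d ·
  -- q = v(p_0). Then φ would μ-divide the non-zero constant p_0.
  have hlow : ¬ (q ≤ μ.qval g ∧ (q < μ.qval g ∨ μ.Divides φ g)) := by
    rintro ⟨hle, h⟩
    have hT : ∀ j ≤ p.natDegree, ((p.natDegree * q : ℚ) : WithTop ℚ) ≤
        μ.pval (C (p.coeff j) * g ^ j) := by
      intro j hj
      refine le_trans (WithTop.coe_le_coe.2 ?_) (le_pval_term hg (hcoef j hj))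
      have : (0 : ℚ) ≤ j := by positivity
      nlinarith
    obtain ⟨r, hr⟩ := exists_of_divides_comp (i := 0) (Nat.zero_le _) hdivp hT (by
      intro j hj hj0
      have hjpos : (0 : ℚ) < j := by exact_mod_cast Nat.pos_of_ne_zero hj0
      rcases h with h | h
      · refine ⟨0, ?_⟩
        rw [mul_zero, sub_zero]
        refine lt_of_lt_of_le (WithTop.coe_lt_coe.2 ?_) (le_pval_term hg (hcoef j hj))
        nlinarith
      · obtain ⟨r, hr⟩ := (divides_iff μ hg).1 h
        -- One factor g of the term is replaced by φr, which agrees with it up to higher value.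
        refine ⟨C (p.coeff j) * g ^ (j - 1) * r, ?_⟩
        obtain ⟨i, rfl⟩ : ∃ i, j = i + 1 := ⟨j - 1, by omega⟩
        rw [Nat.add_sub_cancel, show C (p.coeff (i + 1)) * g ^ (i + 1) -
          φ * (C (p.coeff (i + 1)) * g ^ i * r) = C (p.coeff (i + 1)) * g ^ i * (g - φ * r) by ring,
          pval_mul]
        have h2 : (((p.natDegree - (i + 1 : ℕ)) * q + i * μ.qval g : ℚ) : WithTop ℚ) ≤
            μ.pval (C (p.coeff (i + 1)) * g ^ i) := by
          rw [pval_mul, pval_C, μ.pval_eq_coe (pow_ne_zero i hg), qval_pow μ hg, WithTop.coe_add]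
          exact add_le_add_left (hcoef _ hj) _
        rw [μ.pval_eq_coe hg] at hr
        refine lt_of_le_of_lt ?_ (WithTop.add_lt_add_of_le_of_lt WithTop.coe_ne_top h2 hr)
        rw [← WithTop.coe_add, WithTop.coe_le_coe]
        push_cast at hjpos ⊢
        nlinarith)
    rw [pow_zero, mul_one] at hr
    have hc : p.coeff 0 ≠ 0 := minpoly.coeff_zero_ne_zero hint hy
    refine hφ.isMinimal.not_divides_C hc ((divides_iff μ (C_ne_zero.2 hc)).2 ⟨r, ?_⟩)
    rwa [pval_C, hq0]
  -- Now the term of index d dominates: all others have value greater than d · μ(g). So φ ∣_μ g^d,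
  -- and primality gives φ ∣_μ g.
  have hhigh : μ.qval g < q → μ.Divides φ g := by
    intro hlt
    have hT : ∀ j ≤ p.natDegree, ((p.natDegree * μ.qval g : ℚ) : WithTop ℚ) ≤
        μ.pval (C (p.coeff j) * g ^ j) := by
      intro j hj
      refine le_trans (WithTop.coe_le_coe.2 ?_) (le_pval_term hg (hcoef j hj))
      have : (j : ℚ) ≤ p.natDegree := by exact_mod_cast hj
      nlinarith
    obtain ⟨r, hr⟩ := exists_of_divides_comp (i := p.natDegree) le_rfl hdivp hT (by
      intro j hj hj0
      refine ⟨0, ?_⟩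
      rw [mul_zero, sub_zero]
      refine lt_of_lt_of_le (WithTop.coe_lt_coe.2 ?_) (le_pval_term hg (hcoef j hj))
      have : (j : ℚ) < p.natDegree := by exact_mod_cast lt_of_le_of_ne hj hj0
      nlinarith)
    rw [show p.coeff p.natDegree = 1 from minpoly.monic hint, C_1, one_mul] at hr
    refine hφ.divides_of_divides_pow (n := p.natDegree)
      ((divides_iff μ (pow_ne_zero _ hg)).2 ⟨r, ?_⟩)
    rwa [μ.pval_eq_coe (pow_ne_zero _ hg), qval_pow μ hg]
  rw [hq, μ.pval_eq_coe hg, WithTop.coe_le_coe, WithTop.coe_lt_coe]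
  have hle : μ.qval g ≤ q := by
    by_contra! hlt
    exact hlow ⟨hlt.le, Or.inl hlt⟩
  refine ⟨hle, hhigh, fun h => lt_of_le_of_ne hle fun e => hlow ⟨e.ge, Or.inr h⟩⟩

end RatVal

end Complete

namespace RatVal

variable {k : Type*} [Field k] {w : Valuation k ℤᵐ⁰} {μ : RatVal w} {φ : k[X]}

theorem augVal_sum_ge (hm : φ.Monic) (hd : 0 < φ.natDegree) (δ : ℚ) {T : WithTop ℚ} {ι : Type*}
    (s : Finset ι) (f : ι → k[X]) (h : ∀ i ∈ s, T ≤ μ.augVal φ δ (f i)) :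
    T ≤ μ.augVal φ δ (∑ i ∈ s, f i) := by
  classical
  induction s using Finset.induction_on with
  | empty => simp [augVal_zero]
  | insert a s ha ih =>
    rw [Finset.sum_insert ha]
    exact (le_min (h a (Finset.mem_insert_self a s))
      (ih fun i hi => h i (Finset.mem_insert_of_mem hi))).trans (min_augVal_le μ hm hd δ _ _)

theorem IsKey.eq_of_aeval_eq_zero (hφ : μ.IsKey φ) {Ω : Type*} [Field Ω] [Algebra k Ω]
    {F : k[X]} (hm : F.Monic) (hF : Irreducible F)
    {θ : Ω} (hθ : aeval θ F = 0) (h : aeval θ φ = 0) : F = φ := by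
  rw [← minpoly_eq_of_monic_irreducible hm hF hθ,
    minpoly_eq_of_monic_irreducible hφ.monic hφ.irreducible h]

end RatVal

/-! ### Prime polynomials and key polynomials that μ-divide them. -/

section PrimePolynomial

variable {k : Type*} [Field k] [Valued k ℤᵐ⁰] [CompleteSpace k]
  {Ω : Type*} [Field Ω] [Algebra k Ω] [Algebra.IsAlgebraic k Ω]

namespace RatVal

variable {μ : RatVal (fieldVal k)} {φ : k[X]}

theorem IsKey.algVal_eq_of_not_divides (hφ : μ.IsKey φ) (hw : ∃ c : k, addVal (fieldVal k c) = 1)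
    {ξ : Ω} (hξ : aeval ξ φ = 0) {g : k[X]} (hg : ¬ μ.Divides φ g) :
    algVal (fieldVal k) (aeval ξ g) = μ.pval g := by
  have h0 : g ≠ 0 := by
    rintro rfl
    exact hg (μ.divides_zero φ)
  obtain ⟨h1, h2⟩ := hφ.pval_le_algVal_and hw hφ.monic hφ.irreducible hξ (μ.divides_self φ) h0
  exact (h1.antisymm (not_lt.1 fun h => hg (h2.1 h))).symm

/-- The augmented value of a prime polynomial `F` with root `θ`, for the slope determined by
`v(φ(θ))`, is attained at the constant term of its `φ`-expansion. -/
theorem IsKey.pval_mod_eq_augVal (hφ : μ.IsKey φ) (hw : ∃ c : k, addVal (fieldVal k c) = 1)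
    {F : k[X]} (hm : F.Monic) (hF : Irreducible F) {θ : Ω} (hθ : aeval θ F = 0) {δ : ℚ}
    (hδ : algVal (fieldVal k) (aeval θ φ) = (δ : WithTop ℚ)) (hle : μ.qval φ ≤ δ) :
    μ.pval (F %ₘ φ) = μ.augVal φ δ F := by
  have hφm := hφ.monic
  have hφd := hφ.natDegree_pos
  have hy : aeval θ φ ≠ 0 := by
    intro h
    rw [h, algVal_zero] at hδ
    exact WithTop.top_ne_coe hδ
  set p := minpoly k (aeval θ φ) with hp
  have hint : IsIntegral k (aeval θ φ) := Algebra.IsIntegral.isIntegral _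
  have h0 : addVal (fieldVal k (p.coeff 0)) = ((p.natDegree * δ : ℚ) : WithTop ℚ) := by
    obtain ⟨q, hq, h0⟩ := exists_algVal_eq (w := fieldVal k) hy
    rw [hδ] at hq
    rw [h0]
    have : δ = q := by exact_mod_cast hq
    rw [this]
  obtain ⟨Q, hQ⟩ : F ∣ p.comp φ :=
    dvd_of_aeval_eq_zero hm hF hθ (by rw [aeval_comp, minpoly.aeval])
  -- The φ-expansion of p(φ) has the coefficients of p, so this is the bound on the polygon of p
  -- read for the slope δ.
  have hu : ((p.natDegree * δ : ℚ) : WithTop ℚ) ≤ μ.augVal φ δ (p.comp φ) := by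
    rw [comp_eq_sum]
    refine augVal_sum_ge hφm hφd δ _ _ fun j hj => ?_
    have hj' : j ≤ p.natDegree := Nat.lt_succ_iff.1 (Finset.mem_range.1 hj)
    rw [mul_comm (C (p.coeff j)), augVal_pow_mul μ hφm hφd, augVal_of_degree_lt μ hφm hφd, pval_C]
    · refine le_trans (le_of_eq ?_) (add_le_add_left (le_addVal_coeff_minpoly hw hδ hj') _)
      rw [← WithTop.coe_add]
      congr 1
      ring
    · exact degree_C_le.trans_lt (natDegree_pos_iff_degree_pos.1 hφd)
  have hmod : (p.comp φ) %ₘ φ = C (p.coeff 0) := by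
    have e : p.comp φ = C (p.coeff 0) + φ * p.divX.comp φ := by
      conv_lhs => rw [← divX_mul_X_add p]
      rw [add_comp, mul_comp, X_comp, C_comp]
      ring
    rw [e]
    exact (mod_div_add_mul hφm
      (degree_C_le.trans_lt (natDegree_pos_iff_degree_pos.1 hφd)) _).1
  have hc : p.coeff 0 ≠ 0 := minpoly.coeff_zero_ne_zero hint hy
  have hcomp : p.comp φ ≠ 0 := by
    intro h
    rw [h, zero_modByMonic] at hmod
    exact hc (C_eq_zero.1 hmod.symm)
  have hQ0 : Q ≠ 0 := by
    rintro rfl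
    rw [mul_zero] at hQ
    exact hcomp hQ
  -- The constant term of FQ = p(φ) attains the augmented value of the product. Since each remainder
  -- has at least the augmented value of its own factor, this inequality forces equality in both.
  have h1 : μ.pval (F %ₘ φ) + μ.pval (Q %ₘ φ) ≤ μ.augVal φ δ F + μ.augVal φ δ Q := by
    rw [← augVal_mul hφ hle, ← hQ]
    refine le_trans ?_ hu
    rw [← h0, ← pval_C μ, ← hmod, hQ, mul_modByMonic, ← pval_mul]
    exact pval_le_pval_mod hφm hφ.isMinimal _
  have h2 := augVal_le_pval_mod μ hφm hφd δ F
  have h3 := augVal_le_pval_mod μ hφm hφd δ Q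
  refine le_antisymm ?_ h2
  by_contra! hlt
  have h4 := WithTop.add_lt_add_of_lt_of_le (augVal_ne_top μ hφm hφd δ hQ0) hlt h3
  exact absurd h1 (not_le.2 h4)

variable [IsAlgClosed Ω]

/-- If φ does not μ-divide F, then v(F(ξ)) = μ(F) at a root ξ of φ; reciprocity and the bound on
μ(F)/deg F give v(φ(θ)) ≤ μ(φ). -/
theorem IsKey.divides_iff_lt_algVal (hφ : μ.IsKey φ) (hμ : μ.IsInductive)
    (hw : ∃ c : k, addVal (fieldVal k c) = 1) {F : k[X]} (hm : F.Monic) (hF : Irreducible F)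
    {θ : Ω} (hθ : aeval θ F = 0) :
    μ.Divides φ F ↔ μ.pval φ < algVal (fieldVal k) (aeval θ φ) := by
  refine ⟨fun h => (hφ.pval_le_algVal_and hw hm hF hθ h hφ.monic.ne_zero).2.2 (μ.divides_self φ),
    fun h => ?_⟩
  by_contra hdiv
  have hy : aeval θ φ ≠ 0 := by
    intro h0
    rw [hφ.eq_of_aeval_eq_zero hm hF hθ h0] at hdiv
    exact hdiv (μ.divides_self φ)
  obtain ⟨δ, hδ, -⟩ := exists_algVal_eq (w := fieldVal k) hy
  obtain ⟨ξ, hξ⟩ := IsAlgClosed.exists_aeval_eq_zero Ω φ hφ.irreducible.degree_pos.ne'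
  have h1 := natDegree_nsmul_algVal_comm hw hm hF hθ hφ.monic hφ.irreducible hξ
  rw [hφ.algVal_eq_of_not_divides hw hξ hdiv, hδ, μ.pval_eq_coe hm.ne_zero, ← WithTop.coe_nsmul,
    ← WithTop.coe_nsmul, WithTop.coe_inj, nsmul_eq_mul, nsmul_eq_mul] at h1
  have h2 := natDegree_mul_qval_le hμ hφ.monic hφ.isMinimal hm
  rw [← h1] at h2
  have h3 : (0 : ℚ) < F.natDegree := by exact_mod_cast hF.natDegree_pos
  rw [hδ, μ.pval_eq_coe hφ.monic.ne_zero, WithTop.coe_lt_coe] at h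
  exact absurd (le_of_mul_le_mul_left h2 h3) (not_le.2 h)

/-- The shape of the `φ`-expansion of a prime polynomial `F ≠ φ` which is divisible by `φ`. -/
theorem IsKey.expansion_of_divides (hφ : μ.IsKey φ) (hμ : μ.IsInductive)
    (hw : ∃ c : k, addVal (fieldVal k c) = 1) {F : k[X]} (hm : F.Monic) (hF : Irreducible F)
    {θ : Ω} (hθ : aeval θ F = 0) (hne : F ≠ φ) (hdiv : μ.Divides φ F) :
    ∃ (δ : ℚ) (l : ℕ), algVal (fieldVal k) (aeval θ φ) = (δ : WithTop ℚ) ∧ μ.qval φ < δ ∧ 0 < l ∧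
      F.natDegree = l * φ.natDegree ∧ expCoeff φ F l = 1 ∧
      μ.pval (expCoeff φ F 0) = ((l * δ : ℚ) : WithTop ℚ) ∧
      ∀ s : ℕ, ((l * δ : ℚ) : WithTop ℚ) ≤
        μ.pval (expCoeff φ F s) + (((s : ℚ) * δ : ℚ) : WithTop ℚ) := by
  have hφm := hφ.monic
  have hφd := hφ.natDegree_pos
  have hy : aeval θ φ ≠ 0 := fun h0 => hne (hφ.eq_of_aeval_eq_zero hm hF hθ h0)
  obtain ⟨δ, hδ, -⟩ := exists_algVal_eq (w := fieldVal k) hy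
  have hlt : μ.qval φ < δ := by
    have h := (hφ.divides_iff_lt_algVal hμ hw hm hF hθ).1 hdiv
    rwa [hδ, μ.pval_eq_coe hφm.ne_zero, WithTop.coe_lt_coe] at h
  obtain ⟨ξ, hξ⟩ := IsAlgClosed.exists_aeval_eq_zero Ω φ hφ.irreducible.degree_pos.ne'
  -- Otherwise φ divides the irreducible F, so the two are associated and φ(θ) = 0.
  have ha0 : F %ₘ φ ≠ 0 := by
    intro h
    rw [modByMonic_eq_zero_iff_dvd hφm] at h
    obtain ⟨r, hr⟩ := h
    apply hy
    have h1 := (hφ.irreducible.dvd_symm hF) ⟨r, hr⟩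
    obtain ⟨t, ht⟩ := h1
    rw [ht, map_mul, hθ, zero_mul]
  have had := degree_modByMonic_lt F hφm
  have hF0 : aeval ξ F = aeval ξ (F %ₘ φ) := by
    conv_lhs => rw [← modByMonic_add_div F φ]
    rw [map_add, map_mul, hξ, zero_mul, add_zero]
  have hres := natDegree_nsmul_algVal_comm hw hm hF hθ hφm hφ.irreducible hξ
  rw [hF0, hφ.algVal_eq_of_not_divides hw hξ (hφ.isMinimal.not_divides ha0 had), hδ,
    μ.pval_eq_coe ha0, ← WithTop.coe_nsmul, ← WithTop.coe_nsmul, WithTop.coe_inj, nsmul_eq_mul,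
    nsmul_eq_mul] at hres
  have hmod := hφ.pval_mod_eq_augVal hw hm hF hθ hδ hlt.le
  obtain ⟨l, hl, hdeg⟩ := exists_leading_expCoeff hφm hφd hm
  have h1 := augVal_le μ hφm hφd δ F l
  rw [← hmod, μ.pval_eq_coe ha0, μ.pval_eq_coe hl.ne_zero, ← WithTop.coe_add,
    WithTop.coe_le_coe] at h1
  have h2 := natDegree_mul_qval_le hμ hφm hφ.isMinimal hl
  have hn : (0 : ℚ) < φ.natDegree := by exact_mod_cast hφd
  have hdegQ : (F.natDegree : ℚ) = (expCoeff φ F l).natDegree + l * φ.natDegree := by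
    exact_mod_cast hdeg
  -- Reciprocity gives deg φ · μ(a_0) = deg F · δ, while μ(a_0) ≤ μ(a_l) + lδ and deg φ · μ(a_l) ≤
  -- deg a_l · μ(φ). Hence deg a_l · δ ≤ deg a_l · μ(φ), and μ(φ) < δ leaves only degree 0.
  have h3 : (expCoeff φ F l).natDegree = 0 := by
    by_contra hne0
    have hpos : (0 : ℚ) < (expCoeff φ F l).natDegree := by
      exact_mod_cast Nat.pos_of_ne_zero hne0
    have h4 := mul_le_mul_of_nonneg_left h1 hn.le
    rw [← hres, hdegQ] at h4
    nlinarith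
  have h5 : expCoeff φ F l = 1 := hl.natDegree_eq_zero.1 h3
  rw [h3, zero_add] at hdeg
  have hl0 : 0 < l := by
    rcases Nat.eq_zero_or_pos l with h | h
    · have := hF.natDegree_pos
      rw [hdeg, h, zero_mul] at this
      exact absurd this (lt_irrefl 0)
    · exact h
  have h6 : μ.pval (F %ₘ φ) = ((l * δ : ℚ) : WithTop ℚ) := by
    rw [μ.pval_eq_coe ha0]
    congr 1
    rw [hdeg] at hres
    push_cast at hres
    have : (φ.natDegree : ℚ) * μ.qval (F %ₘ φ) = φ.natDegree * (l * δ) := by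
      rw [← hres]
      ring
    exact mul_left_cancel₀ hn.ne' this
  refine ⟨δ, l, hδ, hlt, hl0, hdeg, h5, h6, fun s => ?_⟩
  rw [← h6, hmod]
  exact augVal_le μ hφm hφd δ F s

end RatVal

end PrimePolynomial

namespace RatVal

variable {k : Type*} [Field k] {w : Valuation k ℤᵐ⁰} {μ : RatVal w} {φ : k[X]}

theorem natDegree_iterate_divByMonic (hm : φ.Monic) (g : k[X]) (n : ℕ) :
    ((fun h : k[X] => h /ₘ φ)^[n] g).natDegree = g.natDegree - n * φ.natDegree := by
  induction n with
  | zero => simp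
  | succ n ih =>
    rw [Function.iterate_succ_apply', natDegree_divByMonic _ hm, ih, add_mul]
    omega

/-- For s < l the term a_s φ^s has value at least (l - s)δ + sμ(φ), which exceeds lμ(φ) because δ >
μ(φ). -/
theorem equivalent_pow_of_expansion (hm : φ.Monic) (hd : 0 < φ.natDegree) {F : k[X]} {l : ℕ}
    {δ : ℚ} (hδ : μ.qval φ < δ) (hdeg : F.natDegree = l * φ.natDegree)
    (hl : expCoeff φ F l = 1) (h : ∀ s : ℕ, ((l * δ : ℚ) : WithTop ℚ) ≤
      μ.pval (expCoeff φ F s) + (((s : ℚ) * δ : ℚ) : WithTop ℚ)) :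
    μ.Equivalent F (φ ^ l) := by
  have e := sum_expCoeff_add φ F l
  have h1 : (fun h : k[X] => h /ₘ φ)^[l] F = 1 := by
    rw [← hl, expCoeff, eq_comm, modByMonic_eq_self_iff hm]
    apply degree_lt_degree
    rwa [natDegree_iterate_divByMonic hm, hdeg, Nat.sub_self]
  rw [h1, one_mul] at e
  have h2 : φ ^ l - F = -∑ s ∈ Finset.range l, expCoeff φ F s * φ ^ s := by
    rw [eq_neg_iff_add_eq_zero, sub_add, sub_eq_zero]
    exact eq_sub_of_add_eq' e
  refine ((μ.H_eq_iff (pow_ne_zero l hm.ne_zero)).2 ?_).symm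
  rw [h2, pval_neg, μ.pval_eq_coe (pow_ne_zero l hm.ne_zero), qval_pow μ hm.ne_zero]
  refine AddValuation.map_lt_sum μ.polyVal WithTop.coe_ne_top fun s hs => ?_
  rw [polyVal_apply]
  by_cases h0 : expCoeff φ F s = 0
  · rw [h0, zero_mul, pval_zero]
    exact WithTop.coe_lt_top _
  have h3 := h s
  rw [μ.pval_eq_coe h0, ← WithTop.coe_add, WithTop.coe_le_coe] at h3
  rw [pval_mul, μ.pval_eq_coe h0, μ.pval_eq_coe (pow_ne_zero s hm.ne_zero),
    qval_pow μ hm.ne_zero, ← WithTop.coe_add, WithTop.coe_lt_coe]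
  have h4 : (s : ℚ) < l := by exact_mod_cast Finset.mem_range.1 hs
  nlinarith

end RatVal

/-! ### Newton polygons -/

section Polygon

/-- The lower boundary of the convex hull of a set in the plane. -/
def lowerHull (S : Set (ℝ × ℝ)) : Set (ℝ × ℝ) :=
  {p | p ∈ convexHull ℝ S ∧ ∀ y : ℝ, (p.1, y) ∈ convexHull ℝ S → p.2 ≤ y}

variable {S : Set (ℝ × ℝ)} {t c l : ℝ}

theorem convexHull_bounds (hS : ∀ p ∈ S, 0 ≤ p.1 ∧ p.1 ≤ t ∧ c ≤ p.2 + l * p.1) {p : ℝ × ℝ}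
    (hp : p ∈ convexHull ℝ S) : 0 ≤ p.1 ∧ p.1 ≤ t ∧ c ≤ p.2 + l * p.1 := by
  have hconv : Convex ℝ {p : ℝ × ℝ | 0 ≤ p.1 ∧ p.1 ≤ t ∧ c ≤ p.2 + l * p.1} := by
    rintro ⟨x₁, y₁⟩ ⟨h1, h2, h3⟩ ⟨x₂, y₂⟩ ⟨h4, h5, h6⟩ a b ha hb hab
    have hb' : b = 1 - a := by linarith
    simp only [Prod.smul_mk, smul_eq_mul, Prod.mk_add_mk, Set.mem_ofPred_eq] at *
    refine ⟨by positivity, ?_, ?_⟩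
    · nlinarith
    · have := mul_le_mul_of_nonneg_left h3 ha
      have := mul_le_mul_of_nonneg_left h6 hb
      have : a * c + b * c = c := by rw [← add_mul, hab, one_mul]
      linarith
  exact convexHull_min (t := {p : ℝ × ℝ | 0 ≤ p.1 ∧ p.1 ≤ t ∧ c ≤ p.2 + l * p.1}) hS hconv hp

theorem isLength_lowerHull (hS : ∀ p ∈ S, 0 ≤ p.1 ∧ p.1 ≤ t ∧ c ≤ p.2 + l * p.1)
    (ht : (t, c - l * t) ∈ S) : IsLength (lowerHull S) t := by
  refine ⟨⟨(t, c - l * t), ⟨subset_convexHull ℝ S ht, fun y hy => ?_⟩, rfl⟩, ?_⟩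
  · have := (convexHull_bounds hS hy).2.2
    simp only at this ⊢
    linarith
  · rintro _ ⟨p, hp, rfl⟩
    exact (convexHull_bounds hS hp.1).2.1

/-- Both end points lie on the line y + lx = c and no point of the set lies below it, so the lower
hull is the segment joining them. -/
theorem mem_lowerHull_iff (hS : ∀ p ∈ S, 0 ≤ p.1 ∧ p.1 ≤ t ∧ c ≤ p.2 + l * p.1)
    (ht : 0 < t) (h0 : (0, c) ∈ S) (h1 : (t, c - l * t) ∈ S) (p : ℝ × ℝ) :
    p ∈ lowerHull S ↔ 0 ≤ p.1 ∧ p.1 ≤ t ∧ p.2 + l * p.1 = c := by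
  have seg : ∀ x : ℝ, 0 ≤ x → x ≤ t → (x, c - l * x) ∈ convexHull ℝ S := by
    intro x hx hxt
    have h := (convex_convexHull ℝ S) (subset_convexHull ℝ S h0) (subset_convexHull ℝ S h1)
      (show 0 ≤ 1 - x / t by rw [sub_nonneg, div_le_one ht]; exact hxt)
      (show 0 ≤ x / t by positivity) (by ring)
    convert h using 1
    simp only [Prod.smul_mk, smul_eq_mul, Prod.mk_add_mk, Prod.mk.injEq]
    constructor <;> field_simp <;> ring
  constructor
  · rintro ⟨hp, hmin⟩
    obtain ⟨b1, b2, b3⟩ := convexHull_bounds hS hp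
    refine ⟨b1, b2, le_antisymm ?_ b3⟩
    have := hmin _ (seg p.1 b1 b2)
    linarith
  · rintro ⟨b1, b2, b3⟩
    have hp : p = (p.1, c - l * p.1) := Prod.ext rfl (by simp only; linarith)
    refine ⟨hp ▸ seg p.1 b1 b2, fun y hy => ?_⟩
    have := (convexHull_bounds hS hy).2.2
    simp only at this
    linarith

theorem isOneSided_lowerHull (hS : ∀ p ∈ S, 0 ≤ p.1 ∧ p.1 ≤ t ∧ c ≤ p.2 + l * p.1)
    (ht : 0 < t) (h0 : (0, c) ∈ S) (h1 : (t, c - l * t) ∈ S) : IsOneSided (lowerHull S) l := by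
  have hmem := mem_lowerHull_iff hS ht h0 h1
  have hcomp : lowerHull S = component (lowerHull S) l := by
    ext p
    refine ⟨fun hp => ⟨hp, fun q hq => ?_⟩, fun hp => hp.1⟩
    rw [((hmem p).1 hp).2.2, ((hmem q).1 hq).2.2]
  refine ⟨hcomp, ?_, t, ?_, ht⟩
  · rw [← hcomp]
    refine ⟨⟨(0, c), (hmem _).2 ⟨le_rfl, ht.le, by simp⟩, rfl⟩, ?_⟩
    rintro _ ⟨p, hp, rfl⟩
    exact ((hmem p).1 hp).1
  · rw [← hcomp]
    exact isLength_lowerHull hS h1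

end Polygon

namespace RatVal

variable {k : Type*} [Field k] {w : Valuation k ℤᵐ⁰} {μ : RatVal w} {φ : k[X]}

/-- The cloud of φ is the single point (1, μ(φ)), so the length is 1 although the polygon is not
one-sided. -/
theorem isLength_newton_self (hm : φ.Monic) (hd : 0 < φ.natDegree) :
    IsLength (μ.newton φ φ) 1 := by
  have e0 : expCoeff φ φ 0 = 0 := by
    rw [expCoeff_zero, modByMonic_eq_zero_iff_dvd hm]
  have e1 : expCoeff φ φ 1 = 1 := by
    have e := (mod_div_add_mul hm (a := 0)
      (by rw [degree_zero]; exact bot_lt_iff_ne_bot.2 (mt degree_eq_bot.1 hm.ne_zero)) 1).2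
    rw [zero_add, mul_one] at e
    rw [expCoeff_succ, e, expCoeff_zero]
    rw [modByMonic_eq_self_iff hm, degree_one, ← natDegree_pos_iff_degree_pos]
    exact hd
  refine isLength_lowerHull (l := 0) (c := ((μ.qval φ : ℚ) : ℝ)) ?_ ?_
  · rintro _ ⟨s, hs, rfl⟩
    have h1 : s = 1 := by
      rcases Nat.lt_trichotomy s 1 with h | h | h
      · obtain rfl : s = 0 := by omega
        exact absurd e0 hs
      · exact h
      · exact absurd (expCoeff_eq_zero hm hd (by nlinarith)) hs
    subst h1
    simp [e1]
  · exact ⟨1, by rw [e1]; exact one_ne_zero, by simp [e1]⟩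

/-- The end points are (0, lδ) and (l, lμ(φ)); in the cloud the ordinate is μ(a_s) + sμ(φ), which
turns the slope δ into δ - μ(φ). -/
theorem newton_of_expansion (hm : φ.Monic) (hd : 0 < φ.natDegree) {F : k[X]} {l : ℕ} {δ : ℚ}
    (hl0 : 0 < l) (hdeg : F.natDegree = l * φ.natDegree)
    (hl : expCoeff φ F l = 1) (h0 : μ.pval (expCoeff φ F 0) = ((l * δ : ℚ) : WithTop ℚ))
    (h : ∀ s : ℕ, ((l * δ : ℚ) : WithTop ℚ) ≤
      μ.pval (expCoeff φ F s) + (((s : ℚ) * δ : ℚ) : WithTop ℚ)) :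
    IsOneSided (μ.newton φ F) ((δ - μ.qval φ : ℚ) : ℝ) ∧ IsLength (μ.newton φ F) (l : ℝ) := by
  have hS : ∀ p ∈ μ.cloud φ F, 0 ≤ p.1 ∧ p.1 ≤ (l : ℝ) ∧
      ((l * δ : ℚ) : ℝ) ≤ p.2 + ((δ - μ.qval φ : ℚ) : ℝ) * p.1 := by
    rintro _ ⟨s, hs, rfl⟩
    refine ⟨Nat.cast_nonneg s, ?_, ?_⟩
    · by_contra! hlt
      change (l : ℝ) < (s : ℝ) at hlt
      have hlt' : l < s := by exact_mod_cast hlt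
      exact hs (expCoeff_eq_zero hm hd (by rw [hdeg]; exact Nat.mul_lt_mul_of_pos_right hlt' hd))
    · have h1 := h s
      rw [μ.pval_eq_coe hs, ← WithTop.coe_add, WithTop.coe_le_coe] at h1
      have h2 : l * δ ≤ μ.qval (expCoeff φ F s * φ ^ s) + (δ - μ.qval φ) * s := by
        rw [qval_mul μ hs (pow_ne_zero s hm.ne_zero), qval_pow μ hm.ne_zero]
        linarith
      change ((l * δ : ℚ) : ℝ) ≤ ((μ.qval (expCoeff φ F s * φ ^ s) : ℚ) : ℝ) +
        ((δ - μ.qval φ : ℚ) : ℝ) * (s : ℝ)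
      exact_mod_cast h2
  have hc0 : ((0 : ℝ), ((l * δ : ℚ) : ℝ)) ∈ μ.cloud φ F := by
    have hne : expCoeff φ F 0 ≠ 0 := by
      intro e
      rw [e, pval_zero] at h0
      exact WithTop.top_ne_coe h0
    refine ⟨0, hne, ?_⟩
    rw [pow_zero, mul_one, Nat.cast_zero]
    rw [μ.pval_eq_coe hne, WithTop.coe_inj] at h0
    rw [h0]
  have hcl : ((l : ℝ), ((l * δ : ℚ) : ℝ) - ((δ - μ.qval φ : ℚ) : ℝ) * (l : ℝ)) ∈ μ.cloud φ F := by
    refine ⟨l, by rw [hl]; exact one_ne_zero, ?_⟩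
    rw [hl, one_mul, qval_pow μ hm.ne_zero]
    congr 1
    push_cast
    ring
  exact ⟨isOneSided_lowerHull hS (by exact_mod_cast hl0) hc0 hcl, isLength_lowerHull hS hcl⟩

end RatVal

/-! ### Extension to the completion -/

section Extension

variable {K : Type*} [Field K] {v : Valuation K ℤᵐ⁰}

theorem complVal_toCompl (a : K) : complVal v (toCompl v a) = v a :=
  Valued.valuedCompletion_apply (K := WithVal v) _

/-- Surjectivity of v supplies elements of arbitrarily large value, hence a basis of neighbourhoods,
and K is dense in K_v. -/
theorem exists_lt_addVal_sub (hv : Function.Surjective v) (c : v.Completion) (T : ℚ) :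
    ∃ a : K, (T : WithTop ℚ) < addVal (complVal v (c - toCompl v a)) := by
  obtain ⟨n, hn⟩ := exists_nat_ge T
  obtain ⟨z, hz⟩ := hv (WithZero.exp (-(n : ℤ)))
  have hz0 : v z ≠ 0 := by
    rw [hz]
    exact WithZero.exp_ne_zero
  have hzn : addVal (v z) = ((n : ℚ) : WithTop ℚ) := by
    rw [addVal_of_ne_zero hz0, hz, WithZero.log_exp]
    simp
  have hz0' : (complVal v).restrict (toCompl v z) ≠ 0 := by
    rw [Ne, map_eq_zero, map_eq_zero]
    rintro rfl
    simp at hz0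
  have hmem : {y : v.Completion | (complVal v).restrict (y - c) <
      (complVal v).restrict (toCompl v z)} ∈ nhds c := by
    rw [Valued.mem_nhds]
    exact ⟨Units.mk0 _ hz0', subset_rfl⟩
  obtain ⟨_, ⟨a, rfl⟩, hy⟩ :=
    (UniformSpace.Completion.denseRange_coe (α := WithVal v)).inter_nhds_nonempty hmem
  refine ⟨WithVal.equiv v a, ?_⟩
  have hy' : complVal v ((a : v.Completion) - c) < complVal v (toCompl v z) :=
    ((complVal v).restrict_lt_iff).1 hy
  rw [complVal_toCompl] at hy'
  refine lt_of_le_of_lt (WithTop.coe_le_coe.2 hn) ?_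
  rw [← hzn, addVal_lt_addVal_iff, Valuation.map_sub_swap]
  exact hy'

theorem exists_lt_gauss_sub (hv : Function.Surjective v) (g : v.Completion[X]) (T : ℚ) :
    ∃ G : K[X], G.natDegree ≤ g.natDegree ∧
      (T : WithTop ℚ) < gauss (complVal v) (g - G.map (toCompl v)) := by
  choose a ha using fun i => exists_lt_addVal_sub hv (g.coeff i) T
  refine ⟨∑ i ∈ Finset.range (g.natDegree + 1), monomial i (a i), ?_, ?_⟩
  · refine natDegree_sum_le_of_forall_le _ _ fun i hi => (natDegree_monomial_le _).trans ?_
    exact Nat.lt_succ_iff.1 (Finset.mem_range.1 hi)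
  · rw [lt_gauss_iff]
    intro i
    rw [coeff_sub, coeff_map, finsetSum_coeff]
    simp only [coeff_monomial]
    rw [Finset.sum_ite_eq']
    split_ifs with hi
    · exact ha i
    · rw [coeff_eq_zero_of_natDegree_lt (by
        rw [Finset.mem_range] at hi
        omega), map_zero, sub_zero, map_zero, addVal_zero]
      exact WithTop.coe_lt_top T

theorem gauss_map_toCompl (G : K[X]) : gauss (complVal v) (G.map (toCompl v)) = gauss v G := by
  refine le_antisymm ?_ ?_
  · rw [le_gauss_iff]
    intro i
    have := gauss_le_coeff (complVal v) (G.map (toCompl v)) i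
    rwa [coeff_map, complVal_toCompl] at this
  · rw [le_gauss_iff]
    intro i
    rw [coeff_map, complVal_toCompl]
    exact gauss_le_coeff v G i

theorem exists_gauss_eq {k : Type*} [Field k] (w : Valuation k ℤᵐ⁰) {g : k[X]} (hg : g ≠ 0) :
    ∃ c : ℚ, gauss w g = (c : WithTop ℚ) := by
  obtain ⟨c, hc⟩ := WithTop.ne_top_iff_exists.1 (gauss_ne_top w hg)
  exact ⟨c, hc.symm⟩

namespace RatVal

/-! #### Polynomials over the completion as limits -/

variable {μ : RatVal v}

/-- If γ is the Gauss value of g, an approximant G₀ of degree ≤ deg g has μ(G₀) ≤ γ + c · deg g. Any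
G closer to g than this threshold differs from G₀ by something of larger value, so μ(G) = μ(G₀). -/
theorem exists_limit_value (hv : Function.Surjective v) (hμ : μ.IsInductive)
    {g : v.Completion[X]} (hg : g ≠ 0) : ∃ q T : ℚ, ∀ G : K[X],
      (T : WithTop ℚ) < gauss (complVal v) (g - G.map (toCompl v)) →
        μ.pval G = (q : WithTop ℚ) := by
  obtain ⟨c, hc, hb⟩ := hμ.exists_pval_le
  obtain ⟨γ, hγ⟩ := exists_gauss_eq (complVal v) hg
  have hγT : γ ≤ γ + c * g.natDegree := le_add_of_nonneg_right (by positivity)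
  obtain ⟨G₀, hd, hG₀⟩ := exists_lt_gauss_sub hv g (γ + c * g.natDegree)
  have h1 : gauss v G₀ ≤ γ := by
    by_contra! hlt
    rw [← gauss_map_toCompl] at hlt
    have h := min_gauss_le (complVal v) (g - G₀.map (toCompl v)) (G₀.map (toCompl v))
    rw [sub_add_cancel, hγ] at h
    exact absurd h (not_le.2 (lt_min ((WithTop.coe_le_coe.2 hγT).trans_lt hG₀) hlt))
  have h2 : μ.pval G₀ ≤ ((γ + c * g.natDegree : ℚ) : WithTop ℚ) := by
    refine (hb G₀).trans ?_
    rw [WithTop.coe_add]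
    refine add_le_add h1 (WithTop.coe_le_coe.2 ?_)
    exact mul_le_mul_of_nonneg_left (by exact_mod_cast hd) hc
  have h0 : G₀ ≠ 0 := by
    rintro rfl
    rw [pval_zero] at h2
    exact absurd h2 (not_le.2 (WithTop.coe_lt_top _))
  refine ⟨μ.qval G₀, γ + c * g.natDegree, fun G hG => ?_⟩
  rw [← μ.pval_eq_coe h0]
  apply μ.pval_eq_of_lt_sub
  refine h2.trans_lt (lt_of_lt_of_le ?_ (μ.gauss_le_pval _))
  have h3 := min_gauss_le (complVal v) (g - G.map (toCompl v)) (-(g - G₀.map (toCompl v)))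
  rw [gauss_neg, ← sub_eq_add_neg, sub_sub_sub_cancel_left, ← Polynomial.map_sub,
    gauss_map_toCompl] at h3
  exact (lt_min hG hG₀).trans_le h3

open Classical in
/-- The limit of the values `μ(G)`, for `G` tending to the polynomial `g` over the completion. -/
def limVal (hv : Function.Surjective v) (hμ : μ.IsInductive) (g : v.Completion[X]) : WithTop ℚ :=
  if h : g = 0 then ⊤ else ((exists_limit_value hv hμ h).choose : WithTop ℚ)

theorem limVal_zero (hv : Function.Surjective v) (hμ : μ.IsInductive) : limVal hv hμ 0 = ⊤ := by
  simp [limVal]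

theorem exists_limVal_eq (hv : Function.Surjective v) (hμ : μ.IsInductive) {g : v.Completion[X]}
    (hg : g ≠ 0) : ∃ T : ℚ, ∀ G : K[X],
      (T : WithTop ℚ) < gauss (complVal v) (g - G.map (toCompl v)) →
        μ.pval G = limVal hv hμ g := by
  rw [limVal, dif_neg hg]
  exact (exists_limit_value hv hμ hg).choose_spec

theorem limVal_ne_top (hv : Function.Surjective v) (hμ : μ.IsInductive) {g : v.Completion[X]}
    (hg : g ≠ 0) : limVal hv hμ g ≠ ⊤ := by
  rw [limVal, dif_neg hg]
  exact WithTop.coe_ne_top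

theorem limVal_map (hv : Function.Surjective v) (hμ : μ.IsInductive) (G : K[X]) :
    limVal hv hμ (G.map (toCompl v)) = μ.pval G := by
  by_cases hG : G = 0
  · rw [hG, Polynomial.map_zero, limVal_zero, pval_zero]
  have h : G.map (toCompl v) ≠ 0 := (Polynomial.map_ne_zero_iff (toCompl v).injective).2 hG
  obtain ⟨T, hT⟩ := exists_limVal_eq hv hμ h
  rw [hT G]
  rw [sub_self, gauss_zero]
  exact WithTop.coe_lt_top T

theorem min_limVal_le (hv : Function.Surjective v) (hμ : μ.IsInductive) (g h : v.Completion[X]) :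
    min (limVal hv hμ g) (limVal hv hμ h) ≤ limVal hv hμ (g + h) := by
  by_cases hg : g = 0
  · simp [hg, limVal_zero]
  by_cases hh : h = 0
  · simp [hh, limVal_zero]
  by_cases hgh : g + h = 0
  · simp [hgh, limVal_zero]
  obtain ⟨T₁, h₁⟩ := exists_limVal_eq hv hμ hg
  obtain ⟨T₂, h₂⟩ := exists_limVal_eq hv hμ hh
  obtain ⟨T₃, h₃⟩ := exists_limVal_eq hv hμ hgh
  obtain ⟨G, -, hG⟩ := exists_lt_gauss_sub hv g (max T₁ T₃)
  obtain ⟨H, -, hH⟩ := exists_lt_gauss_sub hv h (max T₂ T₃)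
  rw [WithTop.coe_max, max_lt_iff] at hG hH
  rw [← h₁ G hG.1, ← h₂ H hH.1, ← h₃ (G + H)]
  · exact μ.pval_add G H
  · rw [Polynomial.map_add, add_sub_add_comm]
    exact (lt_min hG.2 hH.2).trans_le (min_gauss_le _ _ _)

theorem limVal_mul (hv : Function.Surjective v) (hμ : μ.IsInductive) (g h : v.Completion[X]) :
    limVal hv hμ (g * h) = limVal hv hμ g + limVal hv hμ h := by
  by_cases hg : g = 0
  · simp [hg, limVal_zero]
  by_cases hh : h = 0
  · simp [hh, limVal_zero]
  obtain ⟨T₁, h₁⟩ := exists_limVal_eq hv hμ hg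
  obtain ⟨T₂, h₂⟩ := exists_limVal_eq hv hμ hh
  obtain ⟨T₃, h₃⟩ := exists_limVal_eq hv hμ (mul_ne_zero hg hh)
  obtain ⟨γ, hγ⟩ := exists_gauss_eq (complVal v) hg
  obtain ⟨η, hη⟩ := exists_gauss_eq (complVal v) hh
  -- The precisions are dictated by gh - GH = (g - G)h + G(h - H); the bound γ ensures that G has
  -- Gauss value at least that of g.
  obtain ⟨G, -, hG⟩ := exists_lt_gauss_sub hv g (max T₁ (max γ (T₃ - η)))
  obtain ⟨H, -, hH⟩ := exists_lt_gauss_sub hv h (max T₂ (T₃ - γ))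
  rw [WithTop.coe_max, max_lt_iff] at hG hH
  rw [WithTop.coe_max, max_lt_iff] at hG
  have hGγ : (γ : WithTop ℚ) ≤ gauss (complVal v) (G.map (toCompl v)) := by
    have h := min_gauss_le (complVal v) g (-(g - G.map (toCompl v)))
    rw [gauss_neg, ← sub_eq_add_neg, sub_sub_cancel, hγ, min_eq_left hG.2.1.le] at h
    exact h
  rw [← h₁ G hG.1, ← h₂ H hH.1, ← h₃ (G * H), pval_mul]
  rw [Polynomial.map_mul, show g * h - G.map (toCompl v) * H.map (toCompl v) =
    (g - G.map (toCompl v)) * h + G.map (toCompl v) * (h - H.map (toCompl v)) by ring]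
  refine lt_of_lt_of_le (lt_min ?_ ?_) (min_gauss_le _ _ _)
  · refine lt_of_lt_of_le ?_ (gauss_add_le_mul _ _ _)
    have := WithTop.add_lt_add_of_lt_of_le (WithTop.coe_ne_top (a := η)) hG.2.2 hη.ge
    rwa [← WithTop.coe_add, sub_add_cancel] at this
  · refine lt_of_lt_of_le ?_ (gauss_add_le_mul _ _ _)
    have := WithTop.add_lt_add_of_le_of_lt (WithTop.coe_ne_top (a := γ)) hGγ hH.2
    rwa [← WithTop.coe_add, add_sub_cancel] at this

theorem limVal_C (hv : Function.Surjective v) (hμ : μ.IsInductive) (c : v.Completion) :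
    limVal hv hμ (C c) = addVal (complVal v c) := by
  by_cases hc : c = 0
  · simp [hc, limVal_zero, addVal_zero]
  obtain ⟨T, hT⟩ := exists_limVal_eq hv hμ (C_ne_zero.2 hc)
  have hc0 : complVal v c ≠ 0 := by rwa [Ne, map_eq_zero]
  obtain ⟨a, ha⟩ := exists_lt_addVal_sub hv c (max T ((-WithZero.log (complVal v c) : ℤ) : ℚ))
  rw [WithTop.coe_max, max_lt_iff, ← addVal_of_ne_zero hc0, addVal_lt_addVal_iff] at ha
  rw [← hT (C a), pval_C, ← complVal_toCompl]
  · congr 1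
    rw [Valuation.map_sub_swap] at ha
    have := Valuation.map_add_eq_of_lt_left (complVal v) ha.2
    rwa [add_sub_cancel] at this
  · rw [lt_gauss_iff]
    intro i
    rw [map_C, ← C_sub, coeff_C]
    split_ifs
    · exact ha.1
    · rw [map_zero, addVal_zero]
      exact WithTop.coe_lt_top T

/-- The limit valuation on polynomials over the completion. -/
def limAddVal (hv : Function.Surjective v) (hμ : μ.IsInductive) :
    AddValuation v.Completion[X] (WithTop ℚ) :=
  AddValuation.of (limVal hv hμ) (limVal_zero hv hμ)
    (by
      have := limVal_map hv hμ 1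
      rwa [Polynomial.map_one, pval_one] at this)
    (min_limVal_le hv hμ) (limVal_mul hv hμ)

theorem nonZeroDivisors_le_supp (hv : Function.Surjective v) (hμ : μ.IsInductive) :
    nonZeroDivisors v.Completion[X] ≤ (limAddVal hv hμ).toValuation.supp.primeCompl := by
  intro g hg h
  exact limVal_ne_top hv hμ (nonZeroDivisors.ne_zero hg) h

/-- The limit valuation on rational functions over the completion. -/
def limRatFuncVal (hv : Function.Surjective v) (hμ : μ.IsInductive) :
    AddValuation (RatFunc v.Completion) (WithTop ℚ) :=
  AddValuation.ofValuation ((limAddVal hv hμ).toValuation.extendToLocalization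
    (nonZeroDivisors_le_supp hv hμ) (RatFunc v.Completion))

theorem limRatFuncVal_algebraMap (hv : Function.Surjective v) (hμ : μ.IsInductive)
    (g : v.Completion[X]) :
    limRatFuncVal hv hμ (algebraMap _ (RatFunc v.Completion) g) = limVal hv hμ g :=
  Valuation.extendToLocalization_apply_map_apply _ (nonZeroDivisors_le_supp hv hμ) _ g

theorem exists_limVal_eq_div (hv : Function.Surjective v) (hμ : μ.IsInductive) : ∃ e : ℕ, 0 < e ∧
    ∀ g : v.Completion[X], g ≠ 0 →
      ∃ n : ℤ, limVal hv hμ g = (((n : ℚ) / (e : ℚ) : ℚ) : WithTop ℚ) := by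
  obtain ⟨e, he, h⟩ := μ.discrete
  refine ⟨e, he, fun g hg => ?_⟩
  obtain ⟨T, hT⟩ := exists_limVal_eq hv hμ hg
  obtain ⟨G, -, hG⟩ := exists_lt_gauss_sub hv g T
  have hG' := hT G hG
  have hG0 : G ≠ 0 := by
    rintro rfl
    rw [pval_zero] at hG'
    exact limVal_ne_top hv hμ hg hG'.symm
  obtain ⟨n, hn⟩ := h (algebraMap K[X] (RatFunc K) G)
    ((map_ne_zero_iff _ (RatFunc.algebraMap_injective K)).2 hG0)
  exact ⟨n, hG'.symm.trans hn⟩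

/-- The extension by continuity of an inductive valuation to the completion. -/
def limRatVal (hv : Function.Surjective v) (hμ : μ.IsInductive) : RatVal (complVal v) where
  val := limRatFuncVal hv hμ
  extends_base a := by
    rw [← RatFunc.algebraMap_C, limRatFuncVal_algebraMap, limVal_C]
  nonneg_X := by
    have h := μ.nonneg_X
    rw [← RatFunc.algebraMap_X] at h
    rw [← RatFunc.algebraMap_X, limRatFuncVal_algebraMap, ← Polynomial.map_X (toCompl v),
      limVal_map]
    exact h
  discrete := by
    obtain ⟨e, he, h⟩ := exists_limVal_eq_div hv hμ
    refine ⟨e, he, fun f hf => ?_⟩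
    obtain ⟨a, b, hb, rfl⟩ := IsFractionRing.div_surjective (A := v.Completion[X]) f
    have hb0 : b ≠ 0 := nonZeroDivisors.ne_zero hb
    have ha0 : a ≠ 0 := by
      rintro rfl
      simp at hf
    obtain ⟨m, hm⟩ := h a ha0
    obtain ⟨n, hn⟩ := h b hb0
    refine ⟨m - n, ?_⟩
    have h1 : limRatFuncVal hv hμ (algebraMap _ _ a / algebraMap _ (RatFunc v.Completion) b) +
        limVal hv hμ b = limVal hv hμ a := by
      rw [← limRatFuncVal_algebraMap, ← limRatFuncVal_algebraMap, ← AddValuation.map_mul,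
        div_mul_cancel₀]
      exact (map_ne_zero_iff _ (RatFunc.algebraMap_injective _)).2 hb0
    rw [hm, hn] at h1
    refine WithTop.add_right_cancel (WithTop.coe_ne_top) (h1.trans ?_)
    rw [← WithTop.coe_add]
    congr 1
    push_cast
    ring

theorem limRatVal_pval_map (hv : Function.Surjective v) (hμ : μ.IsInductive) (G : K[X]) :
    (limRatVal hv hμ).pval (G.map (toCompl v)) = μ.pval G :=
  (limRatFuncVal_algebraMap hv hμ _).trans (limVal_map hv hμ G)

/-! #### Valuations with a given restriction -/

variable {ν : RatVal (complVal v)}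

theorem exists_lt_pval_sub (hv : Function.Surjective v) (ν : RatVal (complVal v))
    (g : v.Completion[X]) (T : ℚ) :
    ∃ G : K[X], G.natDegree ≤ g.natDegree ∧
      (T : WithTop ℚ) < ν.pval (g - G.map (toCompl v)) := by
  obtain ⟨G, hd, hG⟩ := exists_lt_gauss_sub hv g T
  exact ⟨G, hd, hG.trans_le (ν.gauss_le_pval _)⟩

theorem ext_pval {k : Type*} [Field k] {w : Valuation k ℤᵐ⁰} {μ ν : RatVal w}
    (h : ∀ g, μ.pval g = ν.pval g) : μ = ν := by
  refine RatVal.ext (AddValuation.ext fun f => ?_)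
  obtain ⟨a, b, hb, rfl⟩ := IsFractionRing.div_surjective (A := k[X]) f
  have hb0 : b ≠ 0 := nonZeroDivisors.ne_zero hb
  have key : ∀ ρ : RatVal w, ρ.val (algebraMap _ _ a / algebraMap _ (RatFunc k) b) + ρ.pval b =
      ρ.pval a := by
    intro ρ
    rw [pval, pval, ← AddValuation.map_mul, div_mul_cancel₀]
    exact (map_ne_zero_iff _ (RatFunc.algebraMap_injective _)).2 hb0
  refine WithTop.add_right_cancel (z := μ.pval b) ?_ ?_
  · rw [Ne, pval_eq_top_iff]
    exact hb0
  · rw [key μ, h b, key ν, h a]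

/-- Both valuations dominate the Gauss value, so a sufficiently close approximant over K has the
value of g for both. -/
theorem eq_of_pval_map_eq (hv : Function.Surjective v) {ν₁ ν₂ : RatVal (complVal v)}
    (h : ∀ G : K[X], ν₁.pval (G.map (toCompl v)) = ν₂.pval (G.map (toCompl v))) : ν₁ = ν₂ := by
  refine ext_pval fun g => ?_
  by_cases hg : g = 0
  · rw [hg, pval_zero, pval_zero]
  obtain ⟨G, -, hG⟩ := exists_lt_gauss_sub hv g (max (ν₁.qval g) (ν₂.qval g))
  rw [WithTop.coe_max, max_lt_iff, ← pval_eq_coe _ hg, ← pval_eq_coe _ hg] at hG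
  rw [← ν₁.pval_eq_of_lt_sub (hG.1.trans_le (ν₁.gauss_le_pval _)),
    ← ν₂.pval_eq_of_lt_sub (hG.2.trans_le (ν₂.gauss_le_pval _)), h]

/-! #### Comparison of the graded algebras -/

variable (hν : ∀ G : K[X], ν.pval (G.map (toCompl v)) = μ.pval G)

/-- The inclusion of the filtration of `K[x]` in that of `K_v[x]`. -/
def mapP (hν : ∀ G : K[X], ν.pval (G.map (toCompl v)) = μ.pval G) (α : ℚ) : μ.P α →+ ν.P α where
  toFun g := ⟨g.1.map (toCompl v), by
    rw [mem_P_iff, hν]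
    exact g.2⟩
  map_zero' := Subtype.ext (Polynomial.map_zero _)
  map_add' g h := Subtype.ext (Polynomial.map_add _)

/-- The homomorphism of graded pieces induced by the inclusion of `K` in `K_v`. -/
def mapPiece (hν : ∀ G : K[X], ν.pval (G.map (toCompl v)) = μ.pval G) (α : ℚ) :
    μ.Piece α →+ ν.Piece α :=
  QuotientAddGroup.map _ _ (mapP hν α) (by
    intro g hg
    rw [AddSubgroup.mem_addSubgroupOf] at hg
    rw [AddSubgroup.mem_comap, AddSubgroup.mem_addSubgroupOf]
    change (α : WithTop ℚ) < ν.pval (g.1.map (toCompl v))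
    rw [hν]
    exact hg)

theorem mapPiece_cls (α : ℚ) (g : μ.P α) : mapPiece hν α (μ.cls g) = ν.cls (mapP hν α g) := rfl

theorem mapPiece_injective (α : ℚ) : Function.Injective (mapPiece hν α) := by
  intro x y h
  obtain ⟨g, rfl⟩ := μ.cls_surjective x
  obtain ⟨g', rfl⟩ := μ.cls_surjective y
  rw [mapPiece_cls, mapPiece_cls, cls_eq_cls] at h
  rw [cls_eq_cls, ← hν, Polynomial.map_sub]
  exact h

theorem mem_P_of_lt_pval_sub
    (hν : ∀ G : K[X], ν.pval (G.map (toCompl v)) = μ.pval G) {α : ℚ} {g : v.Completion[X]} {G : K[X]} (hg : g ∈ ν.P α)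
    (h : (α : WithTop ℚ) < ν.pval (g - G.map (toCompl v))) : G ∈ μ.P α := by
  rw [mem_P_iff, ← hν, ← sub_sub_cancel g (G.map (toCompl v))]
  exact (le_min hg h.le).trans (ν.pval_sub _ _)

theorem mapPiece_surjective (hv : Function.Surjective v) (α : ℚ) :
    Function.Surjective (mapPiece hν α) := by
  intro y
  obtain ⟨g, rfl⟩ := ν.cls_surjective y
  obtain ⟨G, -, hG⟩ := exists_lt_pval_sub hv ν g.1 α
  refine ⟨μ.cls ⟨G, mem_P_of_lt_pval_sub hν g.2 hG⟩, ?_⟩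
  rw [mapPiece_cls, cls_eq_cls, pval_sub_comm]
  exact hG

/-- The homomorphism of graded algebras induced by the inclusion of `K` in `K_v`. -/
def mapGr : μ.Gr →+* ν.Gr :=
  DirectSum.toSemiring (fun α => (DirectSum.of ν.Piece α).comp (mapPiece hν α))
    (by
      change DirectSum.of ν.Piece 0 (mapPiece hν 0 (μ.cls μ.pone)) = 1
      rw [mapPiece_cls]
      exact ν.of_cls_eq rfl _ ν.pone (Polynomial.map_one _))
    (by
      intro α β a b
      obtain ⟨g, rfl⟩ := μ.cls_surjective a
      obtain ⟨h, rfl⟩ := μ.cls_surjective b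
      change DirectSum.of ν.Piece (α + β) (mapPiece hν (α + β) (μ.cls (μ.pmul g h))) =
        DirectSum.of ν.Piece α (mapPiece hν α (μ.cls g)) *
          DirectSum.of ν.Piece β (mapPiece hν β (μ.cls h))
      rw [mapPiece_cls, mapPiece_cls, mapPiece_cls, DirectSum.of_mul_of]
      exact ν.of_cls_eq rfl _ (ν.pmul (mapP hν α g) (mapP hν β h)) (Polynomial.map_mul _))

theorem mapGr_of (α : ℚ) (x : μ.Piece α) :
    mapGr hν (DirectSum.of μ.Piece α x) = DirectSum.of ν.Piece α (mapPiece hν α x) := by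
  rw [mapGr, DirectSum.toSemiring_of]
  rfl

theorem mapGr_bijective (hv : Function.Surjective v) : Function.Bijective (mapGr hν) := by
  have h : ⇑(mapGr hν) = ⇑(DirectSum.map (α := μ.Piece) (β := ν.Piece) (mapPiece hν)) := by
    funext x
    induction x using DirectSum.induction_on with
    | zero => rw [map_zero, map_zero]
    | of α x => rw [mapGr_of, DirectSum.map_of]
    | add x y hx hy => rw [map_add, map_add, hx, hy]
  rw [h]
  exact ⟨(DirectSum.map_injective _).2 (mapPiece_injective hν),
    (DirectSum.map_surjective _).2 (mapPiece_surjective hν hv)⟩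

theorem mapGr_H (G : K[X]) : mapGr hν (μ.H G) = ν.H (G.map (toCompl v)) := by
  by_cases hG : G = 0
  · rw [hG, Polynomial.map_zero, H_zero, H_zero, map_zero]
  have h0 : G.map (toCompl v) ≠ 0 := (Polynomial.map_ne_zero_iff (toCompl v).injective).2 hG
  have hval : ν.pval (G.map (toCompl v)) = (μ.qval G : WithTop ℚ) := by
    rw [hν, μ.pval_eq_coe hG]
  rw [H, mapGr_of, mapPiece_cls, ν.H_eq_of h0 hval (by rw [mem_P_iff, hval])]
  rfl

/-! #### Transfer of key polynomials and augmentations -/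

/-- Minimality descends to K by approximating both the dividend and the cofactor; primality is
carried by the isomorphism of graded algebras. -/
theorem IsKey.map_toCompl
    (hν : ∀ G : K[X], ν.pval (G.map (toCompl v)) = μ.pval G) (hv : Function.Surjective v) {φ : K[X]} (hφ : μ.IsKey φ) :
    ν.IsKey (φ.map (toCompl v)) := by
  have hdeg : (φ.map (toCompl v)).natDegree = φ.natDegree := natDegree_map _
  refine ⟨hφ.monic.map _, ⟨hdeg ▸ hφ.natDegree_pos, fun g hg hlt hdiv => ?_⟩, ?_, ?_⟩
  · obtain ⟨h, hh⟩ := (divides_iff ν hg).1 hdiv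
    rw [pval_eq_coe _ hg] at hh
    obtain ⟨G, hGd, hG⟩ := exists_lt_pval_sub hv ν g (ν.qval g)
    -- With this precision φ(h - H) has value greater than the value of g.
    obtain ⟨H, -, hH⟩ := exists_lt_pval_sub hv ν h (ν.qval g - ν.qval (φ.map (toCompl v)))
    have hG' : ν.pval (G.map (toCompl v)) = ν.pval g := by
      apply ν.pval_eq_of_lt_sub
      rwa [pval_eq_coe _ hg]
    have hG0 : G ≠ 0 := by
      rintro rfl
      rw [Polynomial.map_zero, pval_zero] at hG'
      exact hg (ν.pval_eq_top_iff.1 hG'.symm)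
    refine hφ.isMinimal.2 G hG0 (by omega) ((divides_iff μ hG0).2 ⟨H, ?_⟩)
    rw [← hν, ← hν, hG', Polynomial.map_sub, Polynomial.map_mul, pval_eq_coe _ hg]
    have e : G.map (toCompl v) - φ.map (toCompl v) * H.map (toCompl v) =
        (g - φ.map (toCompl v) * h) - ((g - G.map (toCompl v)) -
          φ.map (toCompl v) * (h - H.map (toCompl v))) := by ring
    rw [e]
    refine (lt_min hh (lt_of_lt_of_le (lt_min hG ?_) (ν.pval_sub _ _))).trans_le (ν.pval_sub _ _)
    rw [pval_mul, pval_eq_coe _ (hφ.monic.map (toCompl v)).ne_zero]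
    have := WithTop.add_lt_add_left (WithTop.coe_ne_top (a := ν.qval (φ.map (toCompl v)))) hH
    rwa [← WithTop.coe_add, add_sub_cancel] at this
  · rw [Ne, Ideal.span_singleton_eq_bot]
    exact ν.H_ne_zero (hφ.monic.map _).ne_zero
  · have h := hφ.2.2.2
    let e : μ.Gr ≃+* ν.Gr := RingEquiv.ofBijective (mapGr hν) (mapGr_bijective hν hv)
    have h2 : Ideal.span {ν.H (φ.map (toCompl v))} = (Ideal.span {μ.H φ}).map e := by
      rw [Ideal.map_span, Set.image_singleton]
      congr 2
      exact (mapGr_H hν φ).symm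
    rw [h2]
    exact Ideal.map_isPrime_of_equiv e

theorem expCoeff_map {φ : K[X]} (hφ : φ.Monic) (G : K[X]) (s : ℕ) :
    expCoeff (φ.map (toCompl v)) (G.map (toCompl v)) s = (expCoeff φ G s).map (toCompl v) := by
  induction s generalizing G with
  | zero => rw [expCoeff_zero, expCoeff_zero, map_modByMonic _ hφ]
  | succ s ih => rw [expCoeff_succ, expCoeff_succ, ← map_divByMonic _ hφ, ih]

theorem augVal_map
    (hν : ∀ G : K[X], ν.pval (G.map (toCompl v)) = μ.pval G) {φ : K[X]} (hφ : φ.Monic) (δ : ℚ) (G : K[X]) :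
    ν.augVal (φ.map (toCompl v)) δ (G.map (toCompl v)) = μ.augVal φ δ G := by
  unfold augVal
  rw [natDegree_map]
  refine Finset.inf_congr rfl fun s _ => ?_
  rw [expCoeff_map hφ, hν]

theorem pval_eq_of_gauss_close {g : v.Completion[X]} (hg : g ≠ 0) {T : ℚ} (hT : ν.qval g ≤ T)
    {G : K[X]} (hG : (T : WithTop ℚ) < gauss (complVal v) (g - G.map (toCompl v))) :
    ν.pval g = ν.pval (G.map (toCompl v)) := by
  refine (ν.pval_eq_of_lt_sub (lt_of_le_of_lt ?_ (hG.trans_le (ν.gauss_le_pval _)))).symm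
  rw [pval_eq_coe _ hg]
  exact WithTop.coe_le_coe.2 hT

/-- The Gauss value is bounded above by ν, and ν by the augmented value, so both sides of the
required identity are unchanged on passing to a close approximant over K, where the identity is
known. -/
theorem isAugmentation_map
    (hν : ∀ G : K[X], ν.pval (G.map (toCompl v)) = μ.pval G) (hv : Function.Surjective v) {μ' : RatVal v} {ν' : RatVal (complVal v)}
    (hν' : ∀ G : K[X], ν'.pval (G.map (toCompl v)) = μ'.pval G) {φ : K[X]} (hφ : μ.IsKey φ)
    {l : ℚ} (hl : 0 < l) (h : μ.IsAugmentation φ l μ') :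
    ν.IsAugmentation (φ.map (toCompl v)) l ν' := by
  have hΦ := hφ.map_toCompl hν hv
  have hq : ν.qval (φ.map (toCompl v)) = μ.qval φ := by
    rw [qval, qval, hν]
  rw [isAugmentation_iff hΦ.monic.ne_zero]
  rw [isAugmentation_iff hφ.monic.ne_zero] at h
  set δ := ν.qval (φ.map (toCompl v)) + l with hδ
  intro g
  by_cases hg : g = 0
  · rw [hg, pval_zero, augVal_zero]
  obtain ⟨γ, hγ⟩ := WithTop.ne_top_iff_exists.1
    (augVal_ne_top ν hΦ.monic hΦ.natDegree_pos δ hg)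
  obtain ⟨G, -, hG⟩ := exists_lt_gauss_sub hv g (max γ (ν'.qval g))
  rw [pval_eq_of_gauss_close hg (le_max_right _ _) hG, hν', h G, ← hq, ← hδ,
    ← augVal_map hν hφ.monic]
  have h1 : (γ : WithTop ℚ) < ν.augVal (φ.map (toCompl v)) δ (g - G.map (toCompl v)) := by
    rw [WithTop.coe_max, max_lt_iff] at hG
    refine hG.1.trans_le ((ν.gauss_le_pval _).trans ?_)
    exact pval_le_augVal hΦ.monic hΦ.isMinimal (le_add_of_nonneg_right hl.le) _
  have h2 := min_augVal_le ν hΦ.monic hΦ.natDegree_pos δ g (-(g - G.map (toCompl v)))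
  have h3 := min_augVal_le ν hΦ.monic hΦ.natDegree_pos δ (G.map (toCompl v))
    (g - G.map (toCompl v))
  rw [augVal_neg ν hΦ.monic hΦ.natDegree_pos, ← sub_eq_add_neg, sub_sub_cancel, ← hγ,
    min_eq_left h1.le] at h2
  rw [add_sub_cancel, ← hγ] at h3
  rw [← hγ]
  refine le_antisymm ?_ h2
  by_contra! hlt
  exact absurd h3 (not_le.2 (lt_min hlt h1))

end RatVal

/-- The extension is always the limit valuation. Induction is needed only to see that it is
inductive: the limit of an augmentation is the augmentation of an extension already known to be
inductive. -/
theorem exists_isNaturalExtension (hv : Function.Surjective v) {μ : RatVal v}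
    (hμ : μ.IsInductive) : ∃ μ' : RatVal (complVal v), IsNaturalExtension μ μ' := by
  induction hμ with
  | minimal μ h =>
    have hμ : μ.IsInductive := RatVal.IsInductive.minimal μ h
    refine ⟨RatVal.limRatVal hv hμ, RatVal.IsInductive.minimal _ fun g => ?_,
      RatVal.limRatVal_pval_map hv hμ⟩
    by_cases hg : g = 0
    · rw [hg, RatVal.pval_zero, gauss_zero]
    obtain ⟨γ, hγ⟩ := exists_gauss_eq (complVal v) hg
    obtain ⟨G, -, hG⟩ := exists_lt_gauss_sub hv g (max γ ((RatVal.limRatVal hv hμ).qval g))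
    rw [RatVal.pval_eq_of_gauss_close hg (le_max_right _ _) hG, RatVal.limRatVal_pval_map, h G,
      ← gauss_map_toCompl]
    rw [WithTop.coe_max, max_lt_iff, ← hγ] at hG
    have h2 := min_gauss_le (complVal v) g (-(g - G.map (toCompl v)))
    have h3 := min_gauss_le (complVal v) (G.map (toCompl v)) (g - G.map (toCompl v))
    rw [gauss_neg, ← sub_eq_add_neg, sub_sub_cancel, min_eq_left hG.1.le] at h2
    rw [add_sub_cancel] at h3
    refine le_antisymm ?_ h2
    by_contra! hlt
    exact absurd h3 (not_le.2 (lt_min hlt hG.1))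
  | augment μ μ' φ l hμ hφ hl h ih =>
    obtain ⟨ν, hνi, hν⟩ := ih
    have hμ' : μ'.IsInductive := RatVal.IsInductive.augment μ μ' φ l hμ hφ hl h
    have hν' := RatVal.limRatVal_pval_map hv hμ'
    exact ⟨RatVal.limRatVal hv hμ', RatVal.IsInductive.augment ν _ (φ.map (toCompl v)) l hνi
      (hφ.map_toCompl hν hv) hl (RatVal.isAugmentation_map hν hv hν' hφ hl h), hν'⟩

theorem existsUnique_isNaturalExtension (hv : Function.Surjective v) {μ : RatVal v}
    (hμ : μ.IsInductive) : ∃! μ' : RatVal (complVal v), IsNaturalExtension μ μ' := by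
  obtain ⟨μ', h⟩ := exists_isNaturalExtension hv hμ
  refine ⟨μ', h, fun ν hν => RatVal.eq_of_pval_map_eq hv fun G => ?_⟩
  rw [hν.2, h.2]

end Extension

end MacLane

end

/-! ### Proof of the theorem. -/

theorem mainTheorem8 {K : Type*} [Field K] (v : Valuation K ℤᵐ⁰) (hv : Function.Surjective v)
    {Ω : Type*} [Field Ω] [Algebra v.Completion Ω] [IsAlgClosure v.Completion Ω]
    (F : (MacLane.complVal v).valuationSubring[X]) (hFmonic : F.Monic) (hFirr : Irreducible F)
    (θ : Ω) (hθ : aeval θ (F.map (algebraMap _ v.Completion)) = 0)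
    (μ : MacLane.RatVal v) (hμ : μ.IsInductive) (φ : K[X]) (hφ : μ.IsKey φ) :
    (∃! μ' : MacLane.RatVal (MacLane.complVal v), MacLane.IsNaturalExtension μ μ') ∧
    ∀ μ' : MacLane.RatVal (MacLane.complVal v), MacLane.IsNaturalExtension μ μ' →
      ∀ f Φ : v.Completion[X], f = F.map (algebraMap _ v.Completion) →
        Φ = φ.map (MacLane.toCompl v) →
        (μ'.Divides Φ f ↔ μ.pval φ < MacLane.algVal (MacLane.complVal v) (aeval θ Φ)) ∧
        (μ'.Divides Φ f →
          (f = Φ ∨ ∃ l : ℚ, 0 < l ∧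
            MacLane.algVal (MacLane.complVal v) (aeval θ Φ) = μ.pval φ + (l : WithTop ℚ) ∧
            MacLane.IsOneSided (μ'.newton Φ f) (l : ℝ)) ∧
          ∃ ℓ : ℕ, MacLane.IsLength (μ'.newton Φ f) (ℓ : ℝ) ∧
            f.natDegree = ℓ * Φ.natDegree ∧
            μ'.IsMinimal f ∧
            μ'.Equivalent f (Φ ^ ℓ) ∧
            (μ'.residualIdeal Φ).IsMaximal ∧
            ∃ n : ℕ, 0 < n ∧ μ'.residualIdeal f = μ'.residualIdeal Φ ^ n) := by
  -- A uniformizer of K keeps value 1 in the completion.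
  have hw : ∃ c : v.Completion, MacLane.addVal (MacLane.fieldVal v.Completion c) = 1 := by
    obtain ⟨z, hz⟩ := hv (WithZero.exp (-1))
    refine ⟨MacLane.toCompl v z, ?_⟩
    have h : MacLane.complVal v (MacLane.toCompl v z) = WithZero.exp (-1) := by
      rw [MacLane.complVal_toCompl, hz]
    rw [MacLane.fieldVal, h, MacLane.addVal_of_ne_zero WithZero.exp_ne_zero, WithZero.log_exp]
    norm_num
  have : IsAlgClosed Ω := IsAlgClosure.isAlgClosed v.Completion
  have : Algebra.IsAlgebraic v.Completion Ω := IsAlgClosure.isAlgebraic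
  refine ⟨MacLane.existsUnique_isNaturalExtension hv hμ, ?_⟩
  rintro ν ⟨hνi, hν⟩ f Φ rfl rfl
  have hΦ := hφ.map_toCompl hν hv
  have hm := hFmonic.map (algebraMap (MacLane.complVal v).valuationSubring v.Completion)
  -- Gauss's lemma for monic polynomials over the valuation ring, which is integrally closed.
  have hirr : Irreducible (F.map (algebraMap (MacLane.complVal v).valuationSubring
      v.Completion)) := (hFmonic.irreducible_iff_irreducible_map_fraction_map).1 hFirr
  set f := F.map (algebraMap (MacLane.complVal v).valuationSubring v.Completion)
  set Φ := φ.map (MacLane.toCompl v)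
  have hΦν : ν.pval Φ = μ.pval φ := hν φ
  refine ⟨hΦν ▸ hΦ.divides_iff_lt_algVal hνi hw hm hirr hθ, fun hdiv => ?_⟩
  have hmax := hΦ.residualIdeal_isMaximal
  -- When F = φ the value v(φ(θ)) is infinite and there is no slope; all claims hold with ℓ = n = 1.
  by_cases hne : f = Φ
  · refine ⟨Or.inl hne, 1, ?_, by rw [hne, one_mul], ?_, ?_, hmax, 1, one_pos, ?_⟩
    · rw [hne, Nat.cast_one]
      exact MacLane.RatVal.isLength_newton_self hΦ.monic hΦ.natDegree_pos
    · rw [hne]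
      exact hΦ.isMinimal
    · rw [hne, pow_one]
      exact rfl
    · rw [hne, pow_one]
  · obtain ⟨δ, l, h1, h2, h3, h4, h5, h6, h7⟩ :=
      hΦ.expansion_of_divides hνi hw hm hirr hθ hne hdiv
    obtain ⟨hside, hlen⟩ :=
      MacLane.RatVal.newton_of_expansion hΦ.monic hΦ.natDegree_pos h3 h4 h5 h6 h7
    have heq := MacLane.RatVal.equivalent_pow_of_expansion hΦ.monic hΦ.natDegree_pos h2 h4 h5 h7
    refine ⟨Or.inr ⟨δ - ν.qval Φ, sub_pos.2 h2, ?_, hside⟩, l, hlen, h4,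
      MacLane.RatVal.isMinimal_of_equivalent_pow hΦ.monic hΦ.isMinimal h3 h4 heq, heq, hmax, ?_⟩
    · rw [h1, ← hΦν, ν.pval_eq_coe hΦ.monic.ne_zero, ← WithTop.coe_add, add_sub_cancel]
    · obtain ⟨n, hn, hres⟩ := hΦ.exists_residualIdeal_pow hw h3
      refine ⟨n, hn, ?_⟩
      rw [← hres, MacLane.RatVal.residualIdeal, MacLane.RatVal.residualIdeal,
        show ν.H f = ν.H (Φ ^ l) from heq]
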